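/- **Notation.** For a finite set $\mathcal X$, let $\mathcal P(\mathcal X)$ be the set of probability measures on $\mathcal X$, and for $\nu_1,\nu_2\in\mathcal P(\mathcal X)$ let $\Pi(\nu_1,\nu_2)$ be the set of probability measures on $\mathcal X\times\mathcal X$ with first marginal $\nu_1$ and second marginal $\nu_2$. For $\pi\in\Pi(\nu_1,\nu_2)$, $(p_x)_{x\in\mathcal X}$ denotes any family of probability measures with $\pi(x,y)=\nu_1(x)p_x(y)$ for all $x,y\in\mathcal X$ (the costs below do not depend on its choice). The relative entropy is $H(\nu|\mu)=\int\log\frac{d\nu}{d\mu}\,d\nu$ if $\nu\ll\mu$, and $H(\nu|\mu)=+\infty$ otherwise. For a distance $d$ on $\mathcal X$ put $$W_1(\nu_1,\nu_2)=\inf_{\pi\in\Pi(\nu_1,\nu_2)}\iint d(x,y)\,d\pi(x,y),\qquad \widetilde T_2(\nu_2|\nu_1)=\inf_{\pi\in\Pi(\nu_1,\nu_2)}\int\Big(\int d(x,y)\,dp_x(y)\Big)^2d\nu_1(x),$$ and, when $\mathcal X$ is a set of words $x=(x_1,\dots,x_n)$ of length $n$, $$\widehat T_2(\nu_2|\nu_1)=\inf_{\pi\in\Pi(\nu_1,\nu_2)}\int\sum_{i=1}^n\Big(\int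 \mathbf 1_{x_i\ne y_i}\,dp_x(y)\Big)^2d\nu_1(x).$$ **Theorem.** Let $n\ge 1$ and $0\le k\le n$, let $\mathcal X_{k,n-k}=\{x\in\{0,1\}^n:\sum_{i=1}^n x_i=k\}$, with the distance $d_h(x,y)=\frac12\sum_{i=1}^n\mathbf 1_{x_i\ne y_i}$, let $\mu_{k,n-k}$ be the uniform law on $\mathcal X_{k,n-k}$, and let $C_{k,n-k}=\min(k,n-k)$. (a) For all probability measures $\nu_1,\nu_2$ on $\mathcal X_{k,n-k}$, with $W_1$ and $\widetilde T_2$ taken for $d=d_h$, $$2\,W_1^2(\nu_1,\nu_2)\le C_{k,n-k}\Big(\sqrt{H(\nu_1|\mu_{k,n-k})}+\sqrt{H(\nu_2|\mu_{k,n-k})}\Big)^2$$ and $$\frac12\,\widetilde T_2(\nu_2|\nu_1)\le C_{k,n-k}\Big(\sqrt{H(\nu_1|\mu_{k,n-k})}+\sqrt{H(\nu_2|\mu_{k,n-k})}\Big)^2 .$$ (b) For all probability measures $\nu_1,\nu_2$ on $\mathcal X_{k,n-k}$, $$\frac18\,\widehat T_2(\nu_2|\nu_1)\le\Big(\sqrt{H(\nu_1|\mu_{k,n-k})}+\sqrt{H(\nu_2|\mu_{k,n-k})}\Big)^2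 .$$ (c) (Multinomial laws.) Let $E=\{e_1,\dots,e_m\}$ be a set of cardinality $m$, let $k_1,\dots,k_m\ge1$ be integers with $k_1+\dots+k_m=n$, and let $\mu_{k_1,\dots,k_m}$ be the uniform law on $$\mathcal X_{k_1,\dots,k_m}=\big\{x\in E^n:\ \#\{i: x_i=e_l\}=k_l\ \text{ for all } l\in\{1,\dots,m\}\big\}.$$ Then for all probability measures $\nu_1,\nu_2$ on $\mathcal X_{k_1,\dots,k_m}$, $$\frac18\,\widehat T_2(\nu_2|\nu_1)\le\Big(\sqrt{H(\nu_1|\mu_{k_1,\dots,k_m})}+\sqrt{H(\nu_2|\mu_{k_1,\dots,k_m})}\Big)^2 .$$ -/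

import Mathlib

open MeasureTheory ProbabilityTheory InformationTheory
open scoped ENNReal

noncomputable section

/-- The slice `{x ∈ {0,1}ⁿ : x₁ + ⋯ + xₙ = k}` of the discrete cube. -/
def slice (n k : ℕ) : Set (Fin n → Fin 2) :=
  {x | ∑ i, (x i : ℕ) = k}

/-- The words of length `n` over an alphabet with `m` letters in which the letter `l` occurs
exactly `k l` times. -/
def multislice {m : ℕ} (n : ℕ) (k : Fin m → ℕ) : Set (Fin n → Fin m) :=
  {x | ∀ l, (Finset.univ.filter fun i => x i = l).card = k l}

/-- The uniform probability measure on a finite nonempty type. -/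
def uniformLaw (X : Type*) [MeasurableSpace X] : Measure X :=
  uniformOn (Set.univ : Set X)

/-- `Π(ν₁, ν₂)`: the probability measures on `X × X` with marginals `ν₁` and `ν₂`. -/
def couplings {X : Type*} [MeasurableSpace X] (ν₁ ν₂ : Measure X) : Set (Measure (X × X)) :=
  {π | IsProbabilityMeasure π ∧ π.map Prod.fst = ν₁ ∧ π.map Prod.snd = ν₂}

/-- `p` is a family of conditional laws of `π` given the first coordinate, whose law is `ν`:
every `p x` is a probability measure and `π(x, y) = ν(x) pₓ(y)`.
To be used on finite spaces, where points determine a measure. -/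
def IsDisintegration {X : Type*} [MeasurableSpace X] (π : Measure (X × X)) (ν : Measure X)
    (p : X → Measure X) : Prop :=
  (∀ x, IsProbabilityMeasure (p x)) ∧ ∀ x y, π {(x, y)} = ν {x} * p x {y}

/-- The Wasserstein cost `W₁(ν₁, ν₂)` associated with `d`. -/
def wasserstein {X : Type*} [MeasurableSpace X] (d : X → X → ℝ≥0∞) (ν₁ ν₂ : Measure X) : ℝ≥0∞ :=
  ⨅ π ∈ couplings ν₁ ν₂, ∫⁻ z, d z.1 z.2 ∂π

/-- The weak transport cost `T̃₂(ν₂ | ν₁)` associated with `d`. The arguments are in the order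
`ν₂`, `ν₁`. -/
def weakCostTilde {X : Type*} [MeasurableSpace X] (d : X → X → ℝ≥0∞) (ν₂ ν₁ : Measure X) :
    ℝ≥0∞ :=
  ⨅ (π ∈ couplings ν₁ ν₂) (p : X → Measure X) (_ : IsDisintegration π ν₁ p),
    ∫⁻ x, (∫⁻ y, d x y ∂(p x)) ^ 2 ∂ν₁

/-- The weak transport cost `T̂₂(ν₂ | ν₁)` on a set of words of length `n`; the inner integral
`∫ 1_{xᵢ ≠ yᵢ} dpₓ(y)` is the mass that `pₓ` gives to `{y : xᵢ ≠ yᵢ}`. The arguments are in the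
order `ν₂`, `ν₁`. -/
def weakCostHat {n : ℕ} {E : Type*} [DecidableEq E] [MeasurableSpace E] {S : Set (Fin n → E)}
    (ν₂ ν₁ : Measure S) : ℝ≥0∞ :=
  ⨅ (π ∈ couplings ν₁ ν₂) (p : S → Measure S) (_ : IsDisintegration π ν₁ p),
    ∫⁻ x, ∑ i, (∫⁻ y, (if x.1 i ≠ y.1 i then 1 else 0) ∂(p x)) ^ 2 ∂ν₁

/-- The halved Hamming distance on a set of words: half the number of differing coordinates. -/
def halvedHamming {n : ℕ} {E : Type*} [DecidableEq E] {S : Set (Fin n → E)} (x y : S) : ℝ≥0∞ :=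
  (hammingDist x.1 y.1 : ℝ≥0∞) / 2

/-- `(√H(ν₁|μ) + √H(ν₂|μ))²`, where `H` is the relative entropy. -/
def entropyBound {X : Type*} [MeasurableSpace X] (μ ν₁ ν₂ : Measure X) : ℝ≥0∞ :=
  (klDiv ν₁ μ ^ (1 / 2 : ℝ) + klDiv ν₂ μ ^ (1 / 2 : ℝ)) ^ 2

end

/-! Everything is proved on the symmetric group. For a fixed word `x`, the map `σ ↦ x ∘ σ` onto the
orbit of `x` has fibres of equal size. A law on words therefore lifts to permutations with the same
relative entropy, and a kernel between lifted laws projects to a kernel between the original laws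
without raising the costs. Part (a) follows from the cost `imageDist K`, where `K` is the set of
positions of one of the two letters (so `K.card` is `k` or `n - k`), and parts (b), (c) from the
costs `differAt m`.

The square roots of the costs satisfy a triangle inequality under composition of kernels (Jensen and
Minkowski). Passing through the uniform law (`exists_kernel_through_unif`) turns a bound by `c * H`,
valid when one of the two laws is uniform, into a bound by `c * (√H₁ + √H₂)²`.

With one law uniform, the proof is an induction on cosets, the sets of permutations with prescribed
values on `A`. Revealing the value at a free position `l` splits a coset into smaller cosets,
identified with one another by transpositions of values. A kernel on the coset is built by moving
the value at `l` with a kernel between the two laws of that value and then applying the induction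
hypothesis to the conditional laws (`stepKernel`). Its cost separates into a one-step cost and
conditional costs, matching the chain rule `IsTwisted.entOn_eq`; uniformity passes to the
conditional laws.

For `imageDist K` only positions in `K` are revealed. The total variation coupling costs at most
Pinsker's or Marton's bound per step, and Cauchy–Schwarz over the steps produces the factor `K.card`
(`exists_kernel_imageDist`).

For the coordinatewise cost (`exists_kernel_differAt`) the kernel is averaged over all free `l`. The
transposition at `l` also disturbs the position that held the new value, so the total one-step
effect is the vector `displacement`. Its mean squared norm must be at most 8 times the sum over `l`
of the entropies of the one-position laws; then averaging the chain rule over `l` closes the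
induction with the same constant 8. If the target is uniform, a spread-out flow on the complete
graph achieves this (`displacement_flow_le`). If the source is uniform, the total variation coupling
does, because the uniform permutation makes collisions between different positions rare
(`meanOn_displacement_tv_le`). -/

/-! ### Scalar inequalities for `klFun`. -/

theorem nonneg_of_deriv_sign {f f' : ℝ → ℝ} (hf : ∀ x, 0 < x → HasDerivAt f (f' x) x)
    (h1 : f 1 = 0) (hlo : ∀ x, 0 < x → x ≤ 1 → f' x ≤ 0) {x : ℝ} (hx : 0 < x) (hx1 : x ≤ 1) :
    0 ≤ f x := by
  have hanti : AntitoneOn f (Set.Icc x 1) := by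
    refine antitoneOn_of_deriv_nonpos (convex_Icc x 1) (fun y hy => ?_) (fun y hy => ?_)
      (fun y hy => ?_)
    · exact (hf y (hx.trans_le hy.1)).continuousAt.continuousWithinAt
    · rw [interior_Icc] at hy
      exact (hf y (hx.trans hy.1)).differentiableAt.differentiableWithinAt
    · rw [interior_Icc] at hy
      rw [(hf y (hx.trans hy.1)).deriv]
      exact hlo y (hx.trans hy.1) hy.2.le
  simpa [h1] using hanti (Set.left_mem_Icc.2 hx1) (Set.right_mem_Icc.2 hx1) hx1

theorem nonneg_of_deriv_sign' {f f' : ℝ → ℝ} (hf : ∀ x, 0 < x → HasDerivAt f (f' x) x)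
    (h1 : f 1 = 0) (hhi : ∀ x, 1 ≤ x → 0 ≤ f' x) {x : ℝ} (hx1 : 1 ≤ x) :
    0 ≤ f x := by
  have hmono : MonotoneOn f (Set.Icc 1 x) := by
    refine monotoneOn_of_deriv_nonneg (convex_Icc 1 x) (fun y hy => ?_) (fun y hy => ?_)
      (fun y hy => ?_)
    · exact (hf y (one_pos.trans_le hy.1)).continuousAt.continuousWithinAt
    · rw [interior_Icc] at hy
      exact (hf y (one_pos.trans hy.1)).differentiableAt.differentiableWithinAt
    · rw [interior_Icc] at hy
      rw [(hf y (one_pos.trans hy.1)).deriv]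
      exact hhi y hy.1.le
  simpa [h1] using hmono (Set.left_mem_Icc.2 hx1) (Set.right_mem_Icc.2 hx1) hx1

theorem log_add_inv_ge_one {x : ℝ} (hx : 0 < x) : 0 ≤ Real.log x + x⁻¹ - 1 := by
  have := Real.one_sub_inv_le_log_of_pos hx
  linarith

theorem two_mul_sub_le_add_one_mul_log {b : ℝ} (hb : 1 ≤ b) :
    2 * (b - 1) ≤ (b + 1) * Real.log b := by
  have key := nonneg_of_deriv_sign' (f := fun b => (b + 1) * Real.log b - 2 * (b - 1))
    (f' := fun b => Real.log b + b⁻¹ - 1) (fun x hx => ?_) (by simp)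
    (fun x hx => log_add_inv_ge_one (by linarith)) hb
  · linarith
  · have h1 := (((hasDerivAt_id x).add_const 1).mul (Real.hasDerivAt_log hx.ne')).sub
      (((hasDerivAt_id x).sub_const 1).const_mul 2)
    refine HasDerivAt.congr_deriv h1 ?_
    simp only [id_eq]
    field_simp
    ring

theorem sq_sub_one_le_two_mul_log {a : ℝ} (ha : 0 < a) (ha1 : a ≤ 1) :
    a ^ 2 - 1 ≤ 2 * a * Real.log a := by
  have key := nonneg_of_deriv_sign (f := fun a => 2 * a * Real.log a - (a ^ 2 - 1))
    (f' := fun a => 2 * (Real.log a + 1 - a)) (fun x hx => ?_) (by simp)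
    (fun x hx _ => by have := Real.log_le_sub_one_of_pos hx; linarith) ha ha1
  · linarith
  · have h1 := (((hasDerivAt_id x).const_mul 2).mul (Real.hasDerivAt_log hx.ne')).sub
      (((hasDerivAt_id x).pow 2).sub_const 1)
    refine HasDerivAt.congr_deriv h1 ?_
    simp only [id_eq]
    field_simp
    ring

/-- The pointwise form of Pinsker's inequality. -/
theorem three_mul_sq_le_klFun {x : ℝ} (hx : 0 ≤ x) :
    3 * (x - 1) ^ 2 ≤ 2 * (x + 2) * klFun x := by
  rcases hx.eq_or_lt with rfl | hx
  · rw [klFun_zero]; norm_num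
  -- The difference of the two sides and its first derivative vanish at 1, and its second derivative
  -- `4 * (log x + x⁻¹ - 1)` is nonnegative. The two sign lemmas are applied twice, on each side of
  -- 1.
  have hd : ∀ x : ℝ, 0 < x → HasDerivAt (fun x => 2 * (x + 2) * klFun x - 3 * (x - 1) ^ 2)
      (2 * klFun x + 2 * (x + 2) * Real.log x - 6 * (x - 1)) x := fun x hx => by
    have h1 := ((((hasDerivAt_id x).add_const 2).const_mul 2).mul (hasDerivAt_klFun hx.ne')).sub
      ((((hasDerivAt_id x).sub_const 1).pow 2).const_mul 3)
    refine HasDerivAt.congr_deriv h1 ?_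
    simp only [id_eq]
    norm_num
    ring
  have hd2 : ∀ x : ℝ, 0 < x →
      HasDerivAt (fun x => 2 * klFun x + 2 * (x + 2) * Real.log x - 6 * (x - 1))
      (4 * (Real.log x + x⁻¹ - 1)) x := fun x hx => by
    have h1 := (((hasDerivAt_klFun hx.ne').const_mul 2).add
      ((((hasDerivAt_id x).add_const 2).const_mul 2).mul (Real.hasDerivAt_log hx.ne'))).sub
      (((hasDerivAt_id x).sub_const 1).const_mul 6)
    refine HasDerivAt.congr_deriv h1 ?_
    simp only [id_eq]
    field_simp
    ring
  have key : 0 ≤ 2 * (x + 2) * klFun x - 3 * (x - 1) ^ 2 := by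
    rcases le_total x 1 with h | h
    · refine nonneg_of_deriv_sign hd (by simp [klFun_one]) (fun y hy hy1 => ?_) hx h
      have := nonneg_of_deriv_sign
        (f := fun x => -(2 * klFun x + 2 * (x + 2) * Real.log x - 6 * (x - 1)))
        (fun x hx => (hd2 x hx).neg) (by simp [klFun_one])
        (fun z hz _ => by have := log_add_inv_ge_one hz; linarith) hy hy1
      linarith
    · refine nonneg_of_deriv_sign' hd (by simp [klFun_one]) (fun y hy1 => ?_) h
      exact nonneg_of_deriv_sign' hd2 (by simp [klFun_one])
        (fun z hz => by have := log_add_inv_ge_one (by linarith : 0 < z); linarith) hy1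
  linarith

/-- In the pointwise Pinsker inequality, `x + 2 ≤ 3` for `x ≤ 1`; the companion bound below uses `x
+ 2 ≤ 3 * x` for `x ≥ 1`. -/
theorem sq_le_two_mul_klFun_of_le_one {x : ℝ} (hx : 0 ≤ x) (hx1 : x ≤ 1) :
    (1 - x) ^ 2 ≤ 2 * klFun x := by
  have := three_mul_sq_le_klFun hx
  have h2 := klFun_nonneg hx
  nlinarith

theorem sq_div_le_two_mul_klFun_of_one_le {x : ℝ} (hx1 : 1 ≤ x) :
    (x - 1) ^ 2 / x ≤ 2 * klFun x := by
  have := three_mul_sq_le_klFun (by linarith : 0 ≤ x)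
  have h2 := klFun_nonneg (by linarith : 0 ≤ x)
  rw [div_le_iff₀ (by linarith)]
  nlinarith

/-- The correction term in `sq_div_le_klFun_add`. -/
noncomputable def pairCorrection (b : ℝ) : ℝ := if 1 ≤ b then -Real.log b else 1 - b

/-- Near `a = b = 1` the left side can be twice `2 * klFun a + 2 * klFun b`, as for `a = 1 + ε`, `b
= 1 - ε`, so a correction is unavoidable. The one chosen is a sum of products of a centred factor
with a function of the other variable, and thus disappears when summed over all pairs of values of a
density. If both variables lie on the same side of 1, the proof applies the one-variable bound to
their ratio; otherwise it compares each with 1. -/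
theorem sq_div_le_klFun_add {a b : ℝ} (hb : 0 ≤ b) (hab : b ≤ a) :
    (a - b) ^ 2 / a ≤ 2 * klFun a + 2 * klFun b +
      (a - 1) * pairCorrection b + (b - 1) * pairCorrection a := by
  rcases (hb.trans hab).eq_or_lt with rfl | ha
  · obtain rfl : b = 0 := le_antisymm hab hb
    norm_num [klFun_zero, pairCorrection]
  rcases lt_or_ge a 1 with ha1 | ha1
  · have hlog : b * Real.log (b / a) = b * Real.log b - b * Real.log a := by
      rcases hb.eq_or_lt with rfl | hb0
      · simp
      · rw [Real.log_div hb0.ne' ha.ne']; ring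
    have h1 : (a - b) ^ 2 / a ≤ 2 * (b * Real.log b - b * Real.log a) - 2 * b + 2 * a := by
      have h := mul_le_mul_of_nonneg_left (sq_le_two_mul_klFun_of_le_one (div_nonneg hb ha.le)
        (div_le_one_of_le₀ hab ha.le)) ha.le
      rw [← hlog]
      calc (a - b) ^ 2 / a = a * (1 - b / a) ^ 2 := by field_simp
        _ ≤ _ := h
        _ = _ := by rw [klFun_apply]; field_simp; ring
    have h2 := sq_sub_one_le_two_mul_log ha ha1.le
    have h3 := mul_nonneg (sub_nonneg.2 hab) (sub_nonneg.2 (Real.log_le_sub_one_of_pos ha))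
    rw [pairCorrection, if_neg (by linarith), pairCorrection, if_neg (by linarith), klFun_apply,
      klFun_apply]
    nlinarith
  rcases lt_or_ge b 1 with hb1 | hb1
  · rw [pairCorrection, if_neg (by linarith), pairCorrection, if_pos ha1]
    have h1 := sq_div_le_two_mul_klFun_of_one_le ha1
    have h2 := sq_le_two_mul_klFun_of_le_one hb hb1.le
    have h3 := mul_le_mul_of_nonneg_left (Real.one_sub_inv_le_log_of_pos ha) (sub_nonneg.2 hb1.le)
    have h4 : (a - b) ^ 2 / a ≤
        (a - 1) ^ 2 / a + (1 - b) ^ 2 + (a - 1) * (1 - b) + (1 - b) * (1 - a⁻¹) := by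
      rw [← sub_nonneg]
      have : (a - 1) ^ 2 / a + (1 - b) ^ 2 + (a - 1) * (1 - b) + (1 - b) * (1 - a⁻¹) -
          (a - b) ^ 2 / a = ((1 - b) ^ 2 * (a - 1) + (a - 1) * (1 - b) * (a - 1)) / a := by
        field_simp
        ring
      rw [this]
      have := sub_nonneg.2 ha1
      have := sub_nonneg.2 hb1.le
      positivity
    linarith
  · have hb0 : 0 < b := by linarith
    rw [pairCorrection, if_pos hb1, pairCorrection, if_pos ha1]
    have h1 : (a - b) ^ 2 / a ≤ 2 * a * (Real.log a - Real.log b) - 2 * a + 2 * b := by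
      have h := mul_le_mul_of_nonneg_left (sq_div_le_two_mul_klFun_of_one_le
        ((one_le_div hb0).2 hab)) hb0.le
      rw [← Real.log_div ha.ne' hb0.ne']
      calc (a - b) ^ 2 / a = b * ((a / b - 1) ^ 2 / (a / b)) := by field_simp
        _ ≤ _ := h
        _ = _ := by rw [klFun_apply]; field_simp; ring
    have h2 := two_mul_sub_le_add_one_mul_log hb1
    have h3 : (b - 1) * (Real.log a - Real.log b) ≤ (a - b) * Real.log b := by
      have h4 : Real.log a - Real.log b ≤ (a - b) / b := by
        rw [← Real.log_div ha.ne' hb0.ne']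
        refine (Real.log_le_sub_one_of_pos (by positivity)).trans_eq ?_
        field_simp
      calc _ ≤ (b - 1) * ((a - b) / b) := mul_le_mul_of_nonneg_left h4 (sub_nonneg.2 hb1)
        _ = (a - b) * (1 - b⁻¹) := by field_simp
        _ ≤ _ := mul_le_mul_of_nonneg_left (Real.one_sub_inv_le_log_of_pos hb0)
          (sub_nonneg.2 hab)
    rw [klFun_apply, klFun_apply]
    nlinarith

/-! ### Weights, kernels, entropy and costs on finite sets. -/

noncomputable section

/-- The weights `ν` define a probability on the finite set `s`. -/
structure IsProbOn {X : Type*} (s : Finset X) (ν : X → ℝ) : Prop where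
  nonneg : ∀ x ∈ s, 0 ≤ ν x
  sum_eq : ∑ x ∈ s, ν x = 1

/-- The weights of the uniform probability on `s`. -/
def unifOn {X : Type*} (s : Finset X) : X → ℝ := fun _ => (s.card : ℝ)⁻¹

/-- The relative entropy of `ν` with respect to the uniform probability on `s`. -/
def entOn {X : Type*} (s : Finset X) (ν : X → ℝ) : ℝ :=
  ∑ x ∈ s, ν x * Real.log (s.card * ν x)

/-- `P` is a Markov kernel on `s`. -/
structure IsKernelOn {X : Type*} (s : Finset X) (P : X → X → ℝ) : Prop where
  nonneg : ∀ x ∈ s, ∀ y ∈ s, 0 ≤ P x y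
  sum_eq : ∀ x ∈ s, ∑ y ∈ s, P x y = 1

/-- `P` transports `ν₁` to `ν₂`. -/
def Pushes {X : Type*} (s : Finset X) (P : X → X → ℝ) (ν₁ ν₂ : X → ℝ) : Prop :=
  ∀ y ∈ s, ∑ x ∈ s, ν₁ x * P x y = ν₂ y

/-- The weak transport cost of a kernel: the squared `L²(ν)` norm of the vector of the mean
displacements, measured by `D i` for `i ∈ I`. -/
def weakCostOn {X ι : Type*} (s : Finset X) (I : Finset ι) (D : ι → X → X → ℝ) (ν : X → ℝ)
    (P : X → X → ℝ) : ℝ :=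
  ∑ x ∈ s, ν x * ∑ i ∈ I, (∑ y ∈ s, P x y * D i x y) ^ 2

/-- The transport cost of a kernel for the cost function `d`. -/
def linCostOn {X : Type*} (s : Finset X) (d : X → X → ℝ) (ν : X → ℝ) (P : X → X → ℝ) : ℝ :=
  ∑ x ∈ s, ν x * ∑ y ∈ s, P x y * d x y

section FiniteKernels

variable {X Y ι : Type*}

theorem IsProbOn.nonempty {s : Finset X} {ν : X → ℝ} (h : IsProbOn s ν) : s.Nonempty := by
  rw [Finset.nonempty_iff_ne_empty]
  rintro rfl
  simpa using h.sum_eq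

theorem IsProbOn.card_pos {s : Finset X} {ν : X → ℝ} (h : IsProbOn s ν) : (0 : ℝ) < s.card := by
  exact_mod_cast h.nonempty.card_pos

theorem isProbOn_unifOn {s : Finset X} (hs : s.Nonempty) : IsProbOn s (unifOn s) where
  nonneg _ _ := by unfold unifOn; positivity
  sum_eq := by
    have : (s.card : ℝ) ≠ 0 := by exact_mod_cast hs.card_pos.ne'
    simp [unifOn, this]

theorem entOn_unifOn (s : Finset X) : entOn s (unifOn s) = 0 := by
  refine Finset.sum_eq_zero fun x hx => ?_
  have : (s.card : ℝ) ≠ 0 := by exact_mod_cast (Finset.card_pos.2 ⟨x, hx⟩).ne'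
  simp [unifOn, this]

theorem entOn_eq_klFun {s : Finset X} {ν : X → ℝ} (h : IsProbOn s ν) :
    entOn s ν = (s.card : ℝ)⁻¹ * ∑ x ∈ s, klFun (s.card * ν x) := by
  have hs := h.card_pos.ne'
  simp only [klFun_apply, Finset.sum_sub_distrib, Finset.sum_add_distrib, ← Finset.mul_sum,
    h.sum_eq]
  simp only [mul_assoc, ← Finset.mul_sum, entOn]
  simp [hs]

theorem entOn_nonneg {s : Finset X} {ν : X → ℝ} (h : IsProbOn s ν) : 0 ≤ entOn s ν := by
  rw [entOn_eq_klFun h]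
  exact mul_nonneg (by positivity) (Finset.sum_nonneg fun x hx =>
    klFun_nonneg (mul_nonneg (by positivity) (h.nonneg x hx)))

theorem entOn_congr {s : Finset X} {ν ν' : X → ℝ} (h : ∀ x ∈ s, ν x = ν' x) :
    entOn s ν = entOn s ν' :=
  Finset.sum_congr rfl fun x hx => by rw [h x hx]

theorem exists_isKernelOn (s : Finset X) : ∃ P : X → X → ℝ, IsKernelOn s P := by
  rcases s.eq_empty_or_nonempty with rfl | hs
  · exact ⟨fun _ _ => 0, by simp, by simp⟩
  · exact ⟨fun _ => unifOn s, fun _ _ => (isProbOn_unifOn hs).nonneg,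
      fun _ _ => (isProbOn_unifOn hs).sum_eq⟩

/-! ### Composition of kernels and the triangle inequalities for the costs. -/

section Composition

/-- The composition of two kernels. -/
def compKernel (s : Finset X) (P Q : X → X → ℝ) : X → X → ℝ := fun x z => ∑ y ∈ s, P x y * Q y z

variable {s : Finset X} {P Q : X → X → ℝ} {ν₁ ν₂ ν₃ : X → ℝ}

theorem IsKernelOn.comp (hP : IsKernelOn s P) (hQ : IsKernelOn s Q) :
    IsKernelOn s (compKernel s P Q) where
  nonneg x hx z hz := Finset.sum_nonneg fun y hy =>
    mul_nonneg (hP.nonneg x hx y hy) (hQ.nonneg y hy z hz)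
  sum_eq x hx := by
    simp only [compKernel]
    rw [Finset.sum_comm, ← hP.sum_eq x hx]
    refine Finset.sum_congr rfl fun y hy => ?_
    rw [← Finset.mul_sum, hQ.sum_eq y hy, mul_one]

theorem Pushes.comp (hP : Pushes s P ν₁ ν₂) (hQ : Pushes s Q ν₂ ν₃) :
    Pushes s (compKernel s P Q) ν₁ ν₃ := fun z hz => by
  simp only [compKernel, Finset.mul_sum]
  rw [Finset.sum_comm, ← hQ z hz]
  refine Finset.sum_congr rfl fun y hy => ?_
  rw [← hP y hy, Finset.sum_mul]
  exact Finset.sum_congr rfl fun x _ => by ring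

theorem sum_compKernel_le (hP : IsKernelOn s P) (hQ : IsKernelOn s Q) {d : X → X → ℝ}
    (hd : ∀ x ∈ s, ∀ y ∈ s, ∀ z ∈ s, d x z ≤ d x y + d y z) {x : X} (hx : x ∈ s) :
    ∑ z ∈ s, compKernel s P Q x z * d x z ≤
      ∑ y ∈ s, P x y * d x y + ∑ y ∈ s, P x y * ∑ z ∈ s, Q y z * d y z := by
  simp only [compKernel, Finset.sum_mul]
  rw [Finset.sum_comm, ← Finset.sum_add_distrib]
  refine Finset.sum_le_sum fun y hy => ?_
  calc ∑ z ∈ s, P x y * Q y z * d x z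
      ≤ ∑ z ∈ s, P x y * Q y z * (d x y + d y z) := Finset.sum_le_sum fun z hz =>
        mul_le_mul_of_nonneg_left (hd x hx y hy z hz)
          (mul_nonneg (hP.nonneg x hx y hy) (hQ.nonneg y hy z hz))
    _ = P x y * d x y * ∑ z ∈ s, Q y z + P x y * ∑ z ∈ s, Q y z * d y z := by
        rw [Finset.mul_sum, Finset.mul_sum, ← Finset.sum_add_distrib]
        exact Finset.sum_congr rfl fun z _ => by ring
    _ = _ := by rw [hQ.sum_eq y hy, mul_one]

theorem Pushes.mul_eq_zero (hp : Pushes s P ν₁ ν₂) (hP : IsKernelOn s P)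
    (hν : ∀ x ∈ s, 0 ≤ ν₁ x) {x y : X} (hx : x ∈ s) (hy : y ∈ s) (h0 : ν₂ y = 0) :
    ν₁ x * P x y = 0 := by
  rw [← hp y hy] at h0
  exact (Finset.sum_eq_zero_iff_of_nonneg fun x hx =>
    mul_nonneg (hν x hx) (hP.nonneg x hx y hy)).1 h0 x hx

/-- A bound of the separated form `e₁ x + e₂ y` integrates against any coupling to an expression in
the marginals alone. It is needed only at pairs of positive mass, since the coupling charges no
others; this matters because conditional laws are meaningless over null values. -/
theorem Pushes.sum_le (hp : Pushes s P ν₁ ν₂) (hP : IsKernelOn s P) (hν : ∀ x ∈ s, 0 ≤ ν₁ x)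
    {f : X → X → ℝ} {e₁ e₂ : X → ℝ}
    (hf : ∀ x ∈ s, ∀ y ∈ s, ν₁ x ≠ 0 → ν₂ y ≠ 0 → f x y ≤ e₁ x + e₂ y) :
    ∑ x ∈ s, ∑ y ∈ s, ν₁ x * P x y * f x y ≤ ∑ x ∈ s, ν₁ x * e₁ x + ∑ y ∈ s, ν₂ y * e₂ y := by
  have h2 : ∑ x ∈ s, ν₁ x * e₁ x + ∑ y ∈ s, ν₂ y * e₂ y =
      ∑ x ∈ s, ∑ y ∈ s, ν₁ x * P x y * (e₁ x + e₂ y) := by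
    simp only [mul_add, Finset.sum_add_distrib]
    congr 1
    · refine Finset.sum_congr rfl fun x hx => ?_
      rw [← Finset.sum_mul, ← Finset.mul_sum, hP.sum_eq x hx, mul_one]
    · rw [Finset.sum_comm]
      refine Finset.sum_congr rfl fun y hy => ?_
      rw [← Finset.sum_mul, hp y hy]
  rw [h2]
  refine Finset.sum_le_sum fun x hx => Finset.sum_le_sum fun y hy => ?_
  by_cases h0 : ν₁ x * P x y = 0
  · simp [h0]
  · exact mul_le_mul_of_nonneg_left (hf x hx y hy (left_ne_zero_of_mul h0) fun hb => h0
      (hp.mul_eq_zero hP hν hx hy hb)) (mul_nonneg (hν x hx) (hP.nonneg x hx y hy))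

theorem Pushes.sum_eq (h : Pushes s P ν₁ ν₂) (g : X → ℝ) :
    ∑ x ∈ s, ν₁ x * ∑ y ∈ s, P x y * g y = ∑ y ∈ s, ν₂ y * g y := by
  simp only [Finset.mul_sum]
  rw [Finset.sum_comm]
  refine Finset.sum_congr rfl fun y hy => ?_
  rw [← h y hy, Finset.sum_mul]
  exact Finset.sum_congr rfl fun x _ => by ring

theorem linCostOn_comp_le (hν : ∀ x ∈ s, 0 ≤ ν₁ x) (hP : IsKernelOn s P) (hQ : IsKernelOn s Q)
    (hPp : Pushes s P ν₁ ν₂) {d : X → X → ℝ}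
    (hd : ∀ x ∈ s, ∀ y ∈ s, ∀ z ∈ s, d x z ≤ d x y + d y z) :
    linCostOn s d ν₁ (compKernel s P Q) ≤ linCostOn s d ν₁ P + linCostOn s d ν₂ Q := by
  unfold linCostOn
  rw [← hPp.sum_eq, ← Finset.sum_add_distrib]
  refine Finset.sum_le_sum fun x hx => ?_
  rw [← mul_add]
  exact mul_le_mul_of_nonneg_left (sum_compKernel_le hP hQ hd hx) (hν x hx)

/-- Jensen's inequality for the square function. -/
theorem sq_sum_mul_le {t : Finset X} {w f : X → ℝ} (hw : ∀ x ∈ t, 0 ≤ w x)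
    (h1 : ∑ x ∈ t, w x ≤ 1) : (∑ x ∈ t, w x * f x) ^ 2 ≤ ∑ x ∈ t, w x * f x ^ 2 := by
  have h := Finset.sum_sq_le_sum_mul_sum_of_sq_le_mul t (r := fun x => w x * f x) (f := w)
    (g := fun x => w x * f x ^ 2) hw (fun x hx => mul_nonneg (hw x hx) (sq_nonneg _))
    (fun x _ => le_of_eq (by ring))
  refine h.trans (mul_le_of_le_one_left (Finset.sum_nonneg fun x hx =>
    mul_nonneg (hw x hx) (sq_nonneg _)) h1)

/-- Minkowski's inequality in `L²` for nonnegative weights, in squared form. -/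
theorem sum_mul_add_sq_le {t : Finset X} {w f g : X → ℝ} (hw : ∀ x ∈ t, 0 ≤ w x) :
    ∑ x ∈ t, w x * (f x + g x) ^ 2 ≤
      (√(∑ x ∈ t, w x * f x ^ 2) + √(∑ x ∈ t, w x * g x ^ 2)) ^ 2 := by
  have hF : 0 ≤ ∑ x ∈ t, w x * f x ^ 2 :=
    Finset.sum_nonneg fun x hx => mul_nonneg (hw x hx) (sq_nonneg _)
  have hG : 0 ≤ ∑ x ∈ t, w x * g x ^ 2 :=
    Finset.sum_nonneg fun x hx => mul_nonneg (hw x hx) (sq_nonneg _)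
  have h := Finset.sum_sq_le_sum_mul_sum_of_sq_le_mul t (r := fun x => w x * f x * g x)
    (f := fun x => w x * f x ^ 2) (g := fun x => w x * g x ^ 2)
    (fun x hx => mul_nonneg (hw x hx) (sq_nonneg _))
    (fun x hx => mul_nonneg (hw x hx) (sq_nonneg _)) (fun x _ => le_of_eq (by ring))
  have h2 : ∑ x ∈ t, w x * f x * g x ≤
      √(∑ x ∈ t, w x * f x ^ 2) * √(∑ x ∈ t, w x * g x ^ 2) := by
    rw [← Real.sqrt_mul hF]
    exact Real.le_sqrt_of_sq_le h
  have h3 : ∑ x ∈ t, w x * (f x + g x) ^ 2 =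
      ∑ x ∈ t, w x * f x ^ 2 + 2 * ∑ x ∈ t, w x * f x * g x + ∑ x ∈ t, w x * g x ^ 2 := by
    rw [Finset.mul_sum, ← Finset.sum_add_distrib, ← Finset.sum_add_distrib]
    exact Finset.sum_congr rfl fun x _ => by ring
  rw [h3, add_sq, Real.sq_sqrt hF, Real.sq_sqrt hG]
  linarith

/-- The triangle inequality for the square roots of the weak transport costs. -/
theorem weakCostOn_comp_le (hν : ∀ x ∈ s, 0 ≤ ν₁ x) (hP : IsKernelOn s P) (hQ : IsKernelOn s Q)
    (hPp : Pushes s P ν₁ ν₂) {I : Finset ι} {D : ι → X → X → ℝ}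
    (hD0 : ∀ i ∈ I, ∀ x ∈ s, ∀ y ∈ s, 0 ≤ D i x y)
    (hD : ∀ i ∈ I, ∀ x ∈ s, ∀ y ∈ s, ∀ z ∈ s, D i x z ≤ D i x y + D i y z) :
    weakCostOn s I D ν₁ (compKernel s P Q) ≤
      (√(weakCostOn s I D ν₁ P) + √(weakCostOn s I D ν₂ Q)) ^ 2 := by
  have hPQ := hP.comp hQ
  let F : X → ι → ℝ := fun x i => ∑ y ∈ s, P x y * D i x y
  let G : X → ι → ℝ := fun x i => ∑ y ∈ s, P x y * ∑ z ∈ s, Q y z * D i y z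
  have h1 : weakCostOn s I D ν₁ (compKernel s P Q) ≤
      ∑ p ∈ s ×ˢ I, ν₁ p.1 * (F p.1 p.2 + G p.1 p.2) ^ 2 := by
    rw [Finset.sum_product]
    refine Finset.sum_le_sum fun x hx => ?_
    simp only
    rw [← Finset.mul_sum]
    refine mul_le_mul_of_nonneg_left (Finset.sum_le_sum fun i hi => ?_) (hν x hx)
    exact pow_le_pow_left₀ (Finset.sum_nonneg fun z hz => mul_nonneg (hPQ.nonneg x hx z hz)
      (hD0 i hi x hx z hz)) (sum_compKernel_le hP hQ (hD i hi) hx) 2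
  refine h1.trans ((sum_mul_add_sq_le fun p hp =>
    hν p.1 (Finset.mem_product.1 hp).1).trans ?_)
  have hF : ∑ p ∈ s ×ˢ I, ν₁ p.1 * F p.1 p.2 ^ 2 = weakCostOn s I D ν₁ P := by
    rw [Finset.sum_product]
    exact Finset.sum_congr rfl fun x _ => by rw [Finset.mul_sum]
  -- `G` averages the mean displacement of `Q` over `P x`. Jensen moves the square inside this
  -- average, and pushing `ν₁` forward by `P` gives `ν₂`.
  have hG : ∑ p ∈ s ×ˢ I, ν₁ p.1 * G p.1 p.2 ^ 2 ≤ weakCostOn s I D ν₂ Q := by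
    unfold weakCostOn
    rw [Finset.sum_product, ← hPp.sum_eq]
    refine Finset.sum_le_sum fun x hx => ?_
    simp only
    rw [← Finset.mul_sum]
    refine mul_le_mul_of_nonneg_left ?_ (hν x hx)
    simp only [Finset.mul_sum]
    rw [Finset.sum_comm]
    refine Finset.sum_le_sum fun i _ => ?_
    have := sq_sum_mul_le (f := fun y => ∑ z ∈ s, Q y z * D i y z) (hP.nonneg x hx)
      (hP.sum_eq x hx).le
    simpa only [G, Finset.mul_sum] using this
  rw [hF]
  gcongr

end Composition

/-! ### Fibrations with identified fibres: chain rule and one-step kernels. -/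

section Fibration

/-- The fibre of `φ` over `i` in `s`. -/
def fiberOn [DecidableEq Y] (s : Finset X) (φ : X → Y) (i : Y) : Finset X :=
  s.filter fun x => φ x = i

/-- The image of the weights `ν` on `s` under `φ`. -/
def margOn [DecidableEq Y] (s : Finset X) (φ : X → Y) (ν : X → ℝ) (i : Y) : ℝ :=
  ∑ x ∈ fiberOn s φ i, ν x

/-- The weights `ν` on `s` conditioned by `φ = i`. -/
def condOn [DecidableEq Y] (s : Finset X) (φ : X → Y) (ν : X → ℝ) (i : Y) (x : X) : ℝ :=
  ν x / margOn s φ ν i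

/-- `φ : s → V` with bijections `T j` between its fibres: `T j` maps any fibre to the one over `j`,
and its inverse is `T i` on the fibre over `i`. -/
structure IsTwisted (s : Finset X) (V : Finset Y) (φ : X → Y) (T : Y → X → X) : Prop where
  map_mem : ∀ x ∈ s, φ x ∈ V
  twist_mem : ∀ x ∈ s, ∀ j ∈ V, T j x ∈ s
  map_twist : ∀ x ∈ s, ∀ j ∈ V, φ (T j x) = j
  twist_twist : ∀ x ∈ s, ∀ j ∈ V, T (φ x) (T j x) = x

variable [DecidableEq Y] {s : Finset X} {V : Finset Y} {φ : X → Y} {T : Y → X → X}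
  {ν ν₁ ν₂ : X → ℝ}

theorem mem_fiberOn {i : Y} {x : X} : x ∈ fiberOn s φ i ↔ x ∈ s ∧ φ x = i := Finset.mem_filter

theorem sum_fiberOn (hφ : ∀ x ∈ s, φ x ∈ V) (g : X → ℝ) :
    ∑ i ∈ V, ∑ x ∈ fiberOn s φ i, g x = ∑ x ∈ s, g x :=
  Finset.sum_fiberwise_of_maps_to hφ g

theorem IsTwisted.sum_twist (h : IsTwisted s V φ T) {i j : Y} (hi : i ∈ V) (hj : j ∈ V)
    (g : X → ℝ) : ∑ y ∈ fiberOn s φ i, g (T j y) = ∑ y ∈ fiberOn s φ j, g y := by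
  refine Finset.sum_bij' (fun y _ => T j y) (fun y _ => T i y) ?_ ?_ ?_ ?_ ?_
  · intro y hy
    rw [mem_fiberOn] at hy ⊢
    exact ⟨h.twist_mem y hy.1 j hj, h.map_twist y hy.1 j hj⟩
  · intro y hy
    rw [mem_fiberOn] at hy ⊢
    exact ⟨h.twist_mem y hy.1 i hi, h.map_twist y hy.1 i hi⟩
  · intro y hy
    obtain ⟨hys, hyi⟩ := mem_fiberOn.1 hy
    simpa [hyi] using h.twist_twist y hys j hj
  · intro y hy
    obtain ⟨hys, hyi⟩ := mem_fiberOn.1 hy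
    simpa [hyi] using h.twist_twist y hys i hi
  · intro y _
    rfl

theorem IsTwisted.card_fiberOn_eq (h : IsTwisted s V φ T) {i j : Y} (hi : i ∈ V) (hj : j ∈ V) :
    (fiberOn s φ i).card = (fiberOn s φ j).card := by
  have := h.sum_twist hi hj (fun _ => 1)
  simp only [Finset.sum_const, nsmul_eq_mul, mul_one] at this
  exact_mod_cast this

theorem IsTwisted.card_mul (h : IsTwisted s V φ T) {i : Y} (hi : i ∈ V) :
    (V.card : ℝ) * (fiberOn s φ i).card = s.card := by
  have h1 := Finset.card_eq_sum_card_fiberwise h.map_mem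
  have h2 : s.card = V.card * (fiberOn s φ i).card := by
    rw [h1]
    exact Finset.sum_const_nat fun j hj => (h.card_fiberOn_eq hi hj).symm
  exact_mod_cast h2.symm

theorem margOn_nonneg (hν : ∀ x ∈ s, 0 ≤ ν x) (i : Y) : 0 ≤ margOn s φ ν i :=
  Finset.sum_nonneg fun x hx => hν x (mem_fiberOn.1 hx).1

theorem IsProbOn.marg (hν : IsProbOn s ν) (hφ : ∀ x ∈ s, φ x ∈ V) : IsProbOn V (margOn s φ ν) where
  nonneg i _ := margOn_nonneg hν.nonneg i
  sum_eq := (sum_fiberOn hφ ν).trans hν.sum_eq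

theorem IsProbOn.cond (hν : IsProbOn s ν) {i : Y} (hi : margOn s φ ν i ≠ 0) :
    IsProbOn (fiberOn s φ i) (condOn s φ ν i) where
  nonneg x hx := div_nonneg (hν.nonneg x (mem_fiberOn.1 hx).1) (margOn_nonneg hν.nonneg i)
  sum_eq := by
    simp only [condOn, ← Finset.sum_div]
    exact div_self hi

theorem eq_zero_of_margOn_eq_zero (hν : ∀ x ∈ s, 0 ≤ ν x) {i : Y} (hi : margOn s φ ν i = 0)
    {x : X} (hx : x ∈ fiberOn s φ i) : ν x = 0 :=
  (Finset.sum_eq_zero_iff_of_nonneg fun y hy => hν y (mem_fiberOn.1 hy).1).1 hi x hx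

theorem margOn_mul_condOn (hν : ∀ x ∈ s, 0 ≤ ν x) {i : Y} {x : X} (hx : x ∈ fiberOn s φ i) :
    margOn s φ ν i * condOn s φ ν i x = ν x := by
  by_cases hi : margOn s φ ν i = 0
  · rw [hi, zero_mul, eq_zero_of_margOn_eq_zero hν hi hx]
  · exact mul_div_cancel₀ _ hi

theorem IsTwisted.margOn_unifOn (h : IsTwisted s V φ T) {i : Y} (hi : i ∈ V) (hs : s.Nonempty) :
    margOn s φ (unifOn s) i = unifOn V i := by
  have h1 := h.card_mul hi
  have h2 : (s.card : ℝ) ≠ 0 := by exact_mod_cast hs.card_pos.ne'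
  have h3 : (V.card : ℝ) ≠ 0 := by rintro h0; rw [h0, zero_mul] at h1; exact h2 h1.symm
  simp only [margOn, unifOn, Finset.sum_const, nsmul_eq_mul]
  rw [← h1] at h2 ⊢
  have h4 := right_ne_zero_of_mul h2
  field_simp

theorem IsTwisted.condOn_unifOn (h : IsTwisted s V φ T) {i : Y} (hi : i ∈ V)
    (hs : s.Nonempty) (x : X) :
    condOn s φ (unifOn s) i x = unifOn (fiberOn s φ i) x := by
  rw [condOn, h.margOn_unifOn hi hs]
  have h1 := h.card_mul hi
  have h2 : (s.card : ℝ) ≠ 0 := by exact_mod_cast hs.card_pos.ne'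
  have h3 : (V.card : ℝ) ≠ 0 := by rintro h0; rw [h0, zero_mul] at h1; exact h2 h1.symm
  simp only [unifOn]
  rw [← h1]
  field_simp

/-- The chain rule for the relative entropy. -/
theorem IsTwisted.entOn_eq (h : IsTwisted s V φ T) (hν : IsProbOn s ν) :
    entOn s ν = entOn V (margOn s φ ν) +
      ∑ i ∈ V, margOn s φ ν i * entOn (fiberOn s φ i) (condOn s φ ν i) := by
  have key : ∀ i ∈ V, ∑ x ∈ fiberOn s φ i, ν x * Real.log (s.card * ν x) =
      margOn s φ ν i * Real.log (V.card * margOn s φ ν i) +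
        margOn s φ ν i * entOn (fiberOn s φ i) (condOn s φ ν i) := by
    intro i hi
    conv_rhs => enter [1, 1]; rw [margOn]
    rw [entOn, Finset.mul_sum, Finset.sum_mul, ← Finset.sum_add_distrib]
    refine Finset.sum_congr rfl fun x hx => ?_
    rw [← mul_assoc, margOn_mul_condOn hν.nonneg hx, ← mul_add]
    by_cases hx0 : ν x = 0
    · simp [hx0]
    have hm : margOn s φ ν i ≠ 0 := fun h0 => hx0 (eq_zero_of_margOn_eq_zero hν.nonneg h0 hx)
    have h1 := h.card_mul hi
    have h2 := hν.card_pos.ne'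
    have h3 : (V.card : ℝ) ≠ 0 := by rintro h0; rw [h0, zero_mul] at h1; exact h2 h1.symm
    have h4 : ((fiberOn s φ i).card : ℝ) ≠ 0 := by
      rintro h0; rw [h0, mul_zero] at h1; exact h2 h1.symm
    rw [← Real.log_mul (mul_ne_zero h3 hm)
      (mul_ne_zero h4 (by rw [condOn]; exact div_ne_zero hx0 hm)), ← h1]
    congr 2
    rw [condOn]
    field_simp
  rw [entOn, ← sum_fiberOn h.map_mem, Finset.sum_congr rfl key, Finset.sum_add_distrib, entOn]

theorem IsTwisted.isProbOn_twist (h : IsTwisted s V φ T) {i j : Y} (hi : i ∈ V) (hj : j ∈ V)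
    (hν : IsProbOn (fiberOn s φ j) ν) : IsProbOn (fiberOn s φ i) fun y => ν (T j y) where
  nonneg y hy := hν.nonneg _ <| by
    rw [mem_fiberOn] at hy ⊢
    exact ⟨h.twist_mem y hy.1 j hj, h.map_twist y hy.1 j hj⟩
  sum_eq := (h.sum_twist hi hj ν).trans hν.sum_eq

theorem IsTwisted.entOn_twist (h : IsTwisted s V φ T) {i j : Y} (hi : i ∈ V) (hj : j ∈ V)
    (ν : X → ℝ) : entOn (fiberOn s φ i) (fun y => ν (T j y)) = entOn (fiberOn s φ j) ν := by
  rw [entOn, entOn, ← h.sum_twist hi hj, h.card_fiberOn_eq hi hj]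

/-- The kernel that first moves `φ x` by `p`, and then moves `x` inside its fibre. -/
def stepKernel (φ : X → Y) (T : Y → X → X) (p : Y → Y → ℝ) (P : Y → Y → X → X → ℝ) :
    X → X → ℝ :=
  fun x y => p (φ x) (φ y) * P (φ x) (φ y) x (T (φ x) y)

variable {p : Y → Y → ℝ} {P : Y → Y → X → X → ℝ}

theorem IsTwisted.sum_stepKernel (h : IsTwisted s V φ T) {x : X} (hx : x ∈ s) (g : X → ℝ) :
    ∑ y ∈ s, stepKernel φ T p P x y * g y =
      ∑ j ∈ V, p (φ x) j * ∑ y ∈ fiberOn s φ (φ x), P (φ x) j x y * g (T j y) := by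
  rw [← sum_fiberOn h.map_mem]
  refine Finset.sum_congr rfl fun j hj => ?_
  rw [← h.sum_twist (h.map_mem x hx) hj, Finset.mul_sum]
  refine Finset.sum_congr rfl fun y hy => ?_
  obtain ⟨hy, hyx⟩ := mem_fiberOn.1 hy
  rw [stepKernel, h.map_twist y hy j hj, ← hyx, h.twist_twist y hy j hj, mul_assoc]

theorem IsTwisted.isKernelOn_step (h : IsTwisted s V φ T) (hp : IsKernelOn V p)
    (hP : ∀ i ∈ V, ∀ j ∈ V, IsKernelOn (fiberOn s φ i) (P i j)) :
    IsKernelOn s (stepKernel φ T p P) where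
  nonneg x hx y hy := mul_nonneg (hp.nonneg _ (h.map_mem x hx) _ (h.map_mem y hy))
    ((hP _ (h.map_mem x hx) _ (h.map_mem y hy)).nonneg x (mem_fiberOn.2 ⟨hx, rfl⟩) _
      (mem_fiberOn.2 ⟨h.twist_mem y hy _ (h.map_mem x hx), h.map_twist y hy _ (h.map_mem x hx)⟩))
  sum_eq x hx := by
    have h1 := h.sum_stepKernel (p := p) (P := P) hx (fun _ => 1)
    simp only [mul_one] at h1
    rw [h1, ← hp.sum_eq _ (h.map_mem x hx)]
    refine Finset.sum_congr rfl fun j hj => ?_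
    rw [(hP _ (h.map_mem x hx) _ hj).sum_eq x (mem_fiberOn.2 ⟨hx, rfl⟩), mul_one]

/-- Inside the fibre over `i`, the kernel `P i j` must reach the conditional law over `j` pulled
back by the twist; the twist `T j` then carries it to the fibre over `j`. Pairs with a null marginal
carry no mass and impose nothing on `P i j`. -/
theorem IsTwisted.pushes_step (h : IsTwisted s V φ T) (hν₁ : IsProbOn s ν₁) (hν₂ : IsProbOn s ν₂)
    (hp : IsKernelOn V p) (hpp : Pushes V p (margOn s φ ν₁) (margOn s φ ν₂))
    (hP : ∀ i ∈ V, ∀ j ∈ V, margOn s φ ν₁ i ≠ 0 → margOn s φ ν₂ j ≠ 0 →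
      Pushes (fiberOn s φ i) (P i j) (condOn s φ ν₁ i) fun y => condOn s φ ν₂ j (T j y)) :
    Pushes s (stepKernel φ T p P) ν₁ ν₂ := by
  intro y hy
  have hj := h.map_mem y hy
  have key : ∀ i ∈ V, ∑ x ∈ fiberOn s φ i, ν₁ x * stepKernel φ T p P x y =
      margOn s φ ν₁ i * p i (φ y) * condOn s φ ν₂ (φ y) y := by
    intro i hi
    by_cases hb : margOn s φ ν₂ (φ y) = 0
    · have h0 := hpp.mul_eq_zero hp (fun i _ => margOn_nonneg hν₁.nonneg i) hi hj hb
      rw [h0, zero_mul]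
      refine Finset.sum_eq_zero fun x hx => ?_
      rw [stepKernel, (mem_fiberOn.1 hx).2, ← margOn_mul_condOn hν₁.nonneg hx]
      calc _ = (margOn s φ ν₁ i * p i (φ y)) * (condOn s φ ν₁ i x * P i (φ y) x (T i y)) := by ring
        _ = 0 := by rw [h0, zero_mul]
    by_cases ha : margOn s φ ν₁ i = 0
    · rw [ha, zero_mul, zero_mul]
      refine Finset.sum_eq_zero fun x hx => ?_
      rw [eq_zero_of_margOn_eq_zero hν₁.nonneg ha hx, zero_mul]
    · have h1 := hP i hi (φ y) hj ha hb (T i y)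
        (mem_fiberOn.2 ⟨h.twist_mem y hy i hi, h.map_twist y hy i hi⟩)
      beta_reduce at h1
      rw [h.twist_twist y hy i hi] at h1
      rw [← h1, Finset.mul_sum]
      refine Finset.sum_congr rfl fun x hx => ?_
      rw [stepKernel, (mem_fiberOn.1 hx).2, ← margOn_mul_condOn hν₁.nonneg hx]
      ring
  rw [← sum_fiberOn h.map_mem, Finset.sum_congr rfl key, ← Finset.sum_mul, hpp _ hj]
  exact margOn_mul_condOn hν₂.nonneg (mem_fiberOn.2 ⟨hy, rfl⟩)

theorem IsTwisted.sum_step_eq (h : IsTwisted s V φ T) (hν₁ : IsProbOn s ν₁) (G : Y → Y → X → ℝ) :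
    ∑ x ∈ s, ν₁ x * ∑ j ∈ V, p (φ x) j * G (φ x) j x =
      ∑ i ∈ V, ∑ j ∈ V, margOn s φ ν₁ i * p i j *
        ∑ x ∈ fiberOn s φ i, condOn s φ ν₁ i x * G i j x := by
  rw [← sum_fiberOn h.map_mem]
  refine Finset.sum_congr rfl fun i _ => ?_
  simp only [Finset.mul_sum]
  rw [Finset.sum_comm]
  refine Finset.sum_congr rfl fun j _ => Finset.sum_congr rfl fun x hx => ?_
  rw [(mem_fiberOn.1 hx).2, ← margOn_mul_condOn hν₁.nonneg hx]
  ring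

/-- Conditional costs bounded by a term in `i` plus a term in `j` add up to averages of these terms
under the two marginals. With entropies for `e₁` and `e₂`, these are exactly the conditional terms
of the chain rule. The squared variant below first uses Jensen for the coupling of the base values.
-/
theorem IsTwisted.sum_step_le (h : IsTwisted s V φ T) (hν₁ : IsProbOn s ν₁)
    (hp : IsKernelOn V p) (hpp : Pushes V p (margOn s φ ν₁) (margOn s φ ν₂))
    {G : Y → Y → X → ℝ} {e₁ e₂ : Y → ℝ}
    (hG : ∀ i ∈ V, ∀ j ∈ V, margOn s φ ν₁ i ≠ 0 → margOn s φ ν₂ j ≠ 0 →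
      ∑ x ∈ fiberOn s φ i, condOn s φ ν₁ i x * G i j x ≤ e₁ i + e₂ j) :
    ∑ x ∈ s, ν₁ x * ∑ j ∈ V, p (φ x) j * G (φ x) j x ≤
      ∑ i ∈ V, margOn s φ ν₁ i * e₁ i + ∑ j ∈ V, margOn s φ ν₂ j * e₂ j := by
  rw [h.sum_step_eq hν₁]
  exact hpp.sum_le hp (fun i _ => margOn_nonneg hν₁.nonneg i) hG

theorem IsTwisted.sq_sum_step_le (h : IsTwisted s V φ T) (hν₁ : IsProbOn s ν₁)
    (hp : IsKernelOn V p) (hpp : Pushes V p (margOn s φ ν₁) (margOn s φ ν₂))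
    {G : Y → Y → X → ℝ} {e₁ e₂ : Y → ℝ}
    (hG : ∀ i ∈ V, ∀ j ∈ V, margOn s φ ν₁ i ≠ 0 → margOn s φ ν₂ j ≠ 0 →
      (∑ x ∈ fiberOn s φ i, condOn s φ ν₁ i x * G i j x) ^ 2 ≤ e₁ i + e₂ j) :
    (∑ x ∈ s, ν₁ x * ∑ j ∈ V, p (φ x) j * G (φ x) j x) ^ 2 ≤
      ∑ i ∈ V, margOn s φ ν₁ i * e₁ i + ∑ j ∈ V, margOn s φ ν₂ j * e₂ j := by
  rw [h.sum_step_eq hν₁, ← Finset.sum_product']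
  refine le_trans ?_ (hpp.sum_le hp (fun i _ => margOn_nonneg hν₁.nonneg i) hG)
  rw [← Finset.sum_product']
  refine sq_sum_mul_le (fun q hq => ?_) (le_of_eq ?_)
  · rw [Finset.mem_product] at hq
    exact mul_nonneg (margOn_nonneg hν₁.nonneg _) (hp.nonneg _ hq.1 _ hq.2)
  · rw [Finset.sum_product, ← (hν₁.marg h.map_mem).sum_eq]
    refine Finset.sum_congr rfl fun i hi => ?_
    dsimp only
    rw [← Finset.mul_sum, hp.sum_eq i hi, mul_one]

end Fibration

/-! ### Averages of kernels. -/

section Average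

variable {s : Finset X} {A : Finset ι} {P : ι → X → X → ℝ} {ν₁ ν₂ : X → ℝ}

/-- The average of a finite family of kernels. -/
def avgKernel (A : Finset ι) (P : ι → X → X → ℝ) : X → X → ℝ :=
  fun x y => (A.card : ℝ)⁻¹ * ∑ l ∈ A, P l x y

theorem sum_avgKernel (x : X) (g : X → ℝ) : ∑ y ∈ s, avgKernel A P x y * g y =
    (A.card : ℝ)⁻¹ * ∑ l ∈ A, ∑ y ∈ s, P l x y * g y := by
  rw [Finset.sum_comm, Finset.mul_sum]
  refine Finset.sum_congr rfl fun y _ => ?_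
  rw [avgKernel, mul_assoc, Finset.sum_mul]

theorem isKernelOn_avg (hA : A.Nonempty) (hP : ∀ l ∈ A, IsKernelOn s (P l)) :
    IsKernelOn s (avgKernel A P) where
  nonneg x hx y hy := mul_nonneg (by positivity)
    (Finset.sum_nonneg fun l hl => (hP l hl).nonneg x hx y hy)
  sum_eq x hx := by
    have h := sum_avgKernel (s := s) (A := A) (P := P) x (fun _ => 1)
    simp only [mul_one] at h
    rw [h, Finset.sum_congr rfl fun l hl => (hP l hl).sum_eq x hx]
    have : (A.card : ℝ) ≠ 0 := by exact_mod_cast hA.card_pos.ne'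
    simp [this]

theorem pushes_avg (hA : A.Nonempty) (hP : ∀ l ∈ A, Pushes s (P l) ν₁ ν₂) :
    Pushes s (avgKernel A P) ν₁ ν₂ := fun y hy => by
  have : (A.card : ℝ) ≠ 0 := by exact_mod_cast hA.card_pos.ne'
  have h : ∑ x ∈ s, ν₁ x * avgKernel A P x y = (A.card : ℝ)⁻¹ *
      ∑ l ∈ A, ∑ x ∈ s, ν₁ x * P l x y := by
    rw [Finset.sum_comm, Finset.mul_sum]
    refine Finset.sum_congr rfl fun x _ => ?_
    rw [avgKernel, ← Finset.mul_sum]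
    ring
  rw [h, Finset.sum_congr rfl fun l hl => hP l hl y hy]
  simp [this]

end Average

end FiniteKernels

/-! ### Transport of a single value: total variation coupling and flow kernel. -/

section OneStep

variable {Y : Type*} {V : Finset Y} {a b : Y → ℝ}

theorem IsProbOn.sum_card_mul (ha : IsProbOn V a) : ∑ i ∈ V, (V.card * a i - 1) = 0 := by
  rw [Finset.sum_sub_distrib, ← Finset.mul_sum, ha.sum_eq]
  simp

/-- Pinsker's inequality. -/
theorem IsProbOn.sq_sum_abs_le (ha : IsProbOn V a) :
    (∑ i ∈ V, |a i - unifOn V i|) ^ 2 ≤ 2 * entOn V a := by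
  have hN := ha.card_pos
  -- Cauchy–Schwarz against the weights `2 / 3 * (a i + 2 / V.card)`, which come from the pointwise
  -- Pinsker inequality and have total mass 2.
  have h := Finset.sum_sq_le_sum_mul_sum_of_sq_le_mul V (r := fun i => |a i - unifOn V i|)
    (f := fun i => 2 / 3 * (a i + 2 * (V.card : ℝ)⁻¹))
    (g := fun i => (V.card : ℝ)⁻¹ * klFun (V.card * a i))
    (fun i hi => by have := ha.nonneg i hi; positivity)
    (fun i hi => mul_nonneg (by positivity)
      (klFun_nonneg (mul_nonneg hN.le (ha.nonneg i hi))))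
    (fun i hi => by
      have h1 := three_mul_sq_le_klFun (mul_nonneg hN.le (ha.nonneg i hi))
      rw [sq_abs, unifOn]
      have h2 : (a i - (V.card : ℝ)⁻¹) ^ 2 =
          ((V.card : ℝ)⁻¹) ^ 2 / 3 * (3 * (V.card * a i - 1) ^ 2) := by
        field_simp
      rw [h2]
      refine (mul_le_mul_of_nonneg_left h1 (by positivity)).trans_eq ?_
      field_simp)
  refine h.trans_eq ?_
  rw [← Finset.mul_sum, ← Finset.mul_sum, ← entOn_eq_klFun ha, Finset.sum_add_distrib, ha.sum_eq,
    Finset.sum_const, nsmul_eq_mul]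
  field_simp
  norm_num

/-- The mass that stays at `i` in the optimal transport of `a` to `b` for the total variation. -/
def stayMass (a b : Y → ℝ) (i : Y) : ℝ := if a i ≤ b i then 1 else b i / a i

theorem stayMass_mem (ha : IsProbOn V a) (hb : IsProbOn V b) {i : Y} (hi : i ∈ V) :
    0 ≤ stayMass a b i ∧ stayMass a b i ≤ 1 := by
  unfold stayMass
  split_ifs with h
  · simp
  · exact ⟨div_nonneg (hb.nonneg i hi) (ha.nonneg i hi),
      div_le_one_of_le₀ (not_le.1 h).le (ha.nonneg i hi)⟩

theorem mul_one_sub_stayMass (hb : IsProbOn V b) {i : Y} (hi : i ∈ V) :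
    a i * (1 - stayMass a b i) = max (a i - b i) 0 := by
  unfold stayMass
  split_ifs with h
  · rw [max_eq_right (by linarith)]; ring
  · have : a i ≠ 0 := by linarith [hb.nonneg i hi]
    rw [max_eq_left (by linarith)]
    field_simp

theorem max_sub_zero (x y : ℝ) : max (x - y) 0 = (|x - y| + (x - y)) / 2 := by
  rcases le_total x y with h | h
  · rw [max_eq_right (by linarith), abs_of_nonpos (by linarith)]; ring
  · rw [max_eq_left (by linarith), abs_of_nonneg (by linarith)]; ring

theorem sum_max_sub (ha : IsProbOn V a) (hb : IsProbOn V b) :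
    ∑ i ∈ V, max (a i - b i) 0 = (∑ i ∈ V, |a i - b i|) / 2 := by
  simp only [max_sub_zero, ← Finset.sum_div, Finset.sum_add_distrib, Finset.sum_sub_distrib,
    ha.sum_eq, hb.sum_eq]
  ring

theorem sum_max_sub_comm (ha : IsProbOn V a) (hb : IsProbOn V b) :
    ∑ i ∈ V, max (a i - b i) 0 = ∑ i ∈ V, max (b i - a i) 0 := by
  rw [sum_max_sub ha hb, sum_max_sub hb ha]
  simp only [abs_sub_comm]

theorem entOn_eq_zero (ha : ∀ i ∈ V, a i = unifOn V i) : entOn V a = 0 :=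
  (entOn_congr ha).trans (entOn_unifOn V)

/-- Marton's inequality in total variation form. -/
theorem sum_mul_one_sub_stayMass_sq_le (ha : IsProbOn V a) (hb : IsProbOn V b)
    (hu : (∀ i ∈ V, a i = unifOn V i) ∨ ∀ i ∈ V, b i = unifOn V i) :
    ∑ i ∈ V, a i * (1 - stayMass a b i) ^ 2 ≤ 2 * (entOn V a + entOn V b) := by
  have hN := ha.card_pos
  rcases hu with hu | hu
  · rw [entOn_eq_zero hu, zero_add, entOn_eq_klFun hb, ← mul_assoc, mul_comm (2 : ℝ), mul_assoc,
      Finset.mul_sum, Finset.mul_sum]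
    refine Finset.sum_le_sum fun i hi => ?_
    have h0 := mul_nonneg hN.le (hb.nonneg i hi)
    unfold stayMass
    rw [hu i hi, unifOn]
    refine mul_le_mul_of_nonneg_left ?_ (inv_nonneg.2 hN.le)
    split_ifs with h
    · simpa using klFun_nonneg h0
    · rw [div_inv_eq_mul, mul_comm]
      refine sq_le_two_mul_klFun_of_le_one h0 ?_
      rw [not_le] at h
      have := mul_le_mul_of_nonneg_left h.le hN.le
      rwa [mul_inv_cancel₀ hN.ne'] at this
  · rw [entOn_eq_zero hu, add_zero, entOn_eq_klFun ha, ← mul_assoc, mul_comm (2 : ℝ), mul_assoc,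
      Finset.mul_sum, Finset.mul_sum]
    refine Finset.sum_le_sum fun i hi => ?_
    have h0 := mul_nonneg hN.le (ha.nonneg i hi)
    unfold stayMass
    rw [hu i hi, unifOn]
    split_ifs with h
    · simpa using mul_nonneg (inv_nonneg.2 hN.le) (mul_nonneg zero_le_two (klFun_nonneg h0))
    · rw [not_le] at h
      have h1 : 1 ≤ V.card * a i := by
        rw [inv_lt_iff_one_lt_mul₀ hN] at h
        linarith
      have h2 : 0 < a i := (inv_pos.2 hN).trans h
      refine le_trans (le_of_eq ?_) (mul_le_mul_of_nonneg_left
        (sq_div_le_two_mul_klFun_of_one_le h1) (inv_nonneg.2 hN.le))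
      field_simp

theorem sq_sum_mul_one_sub_stayMass_le (ha : IsProbOn V a) (hb : IsProbOn V b)
    (hu : (∀ i ∈ V, a i = unifOn V i) ∨ ∀ i ∈ V, b i = unifOn V i) :
    (∑ i ∈ V, a i * (1 - stayMass a b i)) ^ 2 ≤ (entOn V a + entOn V b) / 2 := by
  rw [Finset.sum_congr rfl fun i hi => mul_one_sub_stayMass hb hi, sum_max_sub ha hb]
  rcases hu with hu | hu
  · have h := hb.sq_sum_abs_le
    rw [Finset.sum_congr rfl fun i hi => by rw [← hu i hi, abs_sub_comm]] at h
    rw [entOn_eq_zero hu]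
    linarith
  · have h := ha.sq_sum_abs_le
    rw [Finset.sum_congr rfl fun i hi => by rw [← hu i hi]] at h
    rw [entOn_eq_zero hu]
    linarith

/-- The flow out of `i` in one step of the random walk on the complete graph. -/
def outflow (V : Finset Y) (a : Y → ℝ) (i j : Y) : ℝ :=
  (V.card : ℝ)⁻¹ * if a j < a i then 1 - a j / a i else 0

theorem outflow_self (i : Y) : outflow V a i i = 0 := by simp [outflow]

theorem outflow_mem (ha : IsProbOn V a) {i j : Y} (hi : i ∈ V) (hj : j ∈ V) :
    0 ≤ outflow V a i j ∧ outflow V a i j ≤ (V.card : ℝ)⁻¹ := by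
  have hN := ha.card_pos
  unfold outflow
  have h0 : 0 ≤ a j / a i := div_nonneg (ha.nonneg j hj) (ha.nonneg i hi)
  split_ifs with h
  · have h1 : a j / a i ≤ 1 := div_le_one_of_le₀ h.le (ha.nonneg i hi)
    exact ⟨mul_nonneg (by positivity) (by linarith),
      mul_le_of_le_one_right (by positivity) (by linarith)⟩
  · simp

theorem mul_outflow (ha : IsProbOn V a) {i j : Y} (hj : j ∈ V) :
    a i * outflow V a i j = (V.card : ℝ)⁻¹ * max (a i - a j) 0 := by
  unfold outflow
  split_ifs with h
  · have : a i ≠ 0 := by linarith [ha.nonneg j hj]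
    rw [max_eq_left (by linarith)]
    field_simp
  · rw [max_eq_right (by linarith)]; simp

/-- With the density `f = V.card * a`, the left side is `V.card⁻²` times the sum of `(f i - f j)² /
f i` over the pairs with `f j < f i`. Symmetrising the pairs and applying `sq_div_le_klFun_add`
leaves only `klFun` terms, because `f - 1` has sum zero and kills the corrections. -/
theorem sum_mul_outflow_sq_le (ha : IsProbOn V a) :
    ∑ i ∈ V, a i * (V.card * ∑ j ∈ V, outflow V a i j ^ 2) ≤ 2 * entOn V a := by
  have hN := ha.card_pos
  set f : Y → ℝ := fun i => V.card * a i with hf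
  have hf0 : ∀ i ∈ V, 0 ≤ f i := fun i hi => mul_nonneg hN.le (ha.nonneg i hi)
  let K : Y → Y → ℝ := fun i j => if f j < f i then (f i - f j) ^ 2 / f i else 0
  have h1 : ∀ i ∈ V, ∀ j ∈ V, a i * (V.card * outflow V a i j ^ 2) =
      ((V.card : ℝ)⁻¹) ^ 2 * K i j := fun i hi j hj => by
    simp only [K, hf, outflow, mul_lt_mul_iff_right₀ hN]
    split_ifs with h
    · have : a i ≠ 0 := by linarith [ha.nonneg j hj]
      field_simp
    · simp
  have h2 : ∀ i ∈ V, ∀ j ∈ V, K i j + K j i ≤ 2 * klFun (f i) + 2 * klFun (f j) +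
      (f i - 1) * pairCorrection (f j) + (f j - 1) * pairCorrection (f i) := by
    intro i hi j hj
    simp only [K]
    rcases lt_trichotomy (f i) (f j) with h | h | h
    · rw [if_neg h.not_gt, if_pos h]
      have := sq_div_le_klFun_add (hf0 i hi) h.le
      linarith
    · rw [h, if_neg (lt_irrefl _)]
      have := sq_div_le_klFun_add (hf0 j hj) le_rfl
      simpa using this
    · rw [if_neg h.not_gt, if_pos h]
      have := sq_div_le_klFun_add (hf0 j hj) h.le
      linarith
  have h3 : 2 * ∑ i ∈ V, ∑ j ∈ V, K i j ≤ 4 * (V.card * ∑ i ∈ V, klFun (f i)) := by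
    calc 2 * ∑ i ∈ V, ∑ j ∈ V, K i j = ∑ i ∈ V, ∑ j ∈ V, (K i j + K j i) := by
          simp only [Finset.sum_add_distrib]
          rw [Finset.sum_comm (f := fun i j => K j i), two_mul]
      _ ≤ ∑ i ∈ V, ∑ j ∈ V, (2 * klFun (f i) + 2 * klFun (f j) +
          (f i - 1) * pairCorrection (f j) + (f j - 1) * pairCorrection (f i)) :=
          Finset.sum_le_sum fun i hi => Finset.sum_le_sum fun j hj => h2 i hi j hj
      _ = _ := by
          simp only [Finset.sum_add_distrib, ← Finset.mul_sum, ← Finset.sum_mul, hf,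
            ha.sum_card_mul, Finset.sum_const, nsmul_eq_mul]
          ring
  calc ∑ i ∈ V, a i * (V.card * ∑ j ∈ V, outflow V a i j ^ 2)
      = ((V.card : ℝ)⁻¹) ^ 2 * ∑ i ∈ V, ∑ j ∈ V, K i j := by
        rw [Finset.mul_sum]
        refine Finset.sum_congr rfl fun i hi => ?_
        rw [Finset.mul_sum, Finset.mul_sum, Finset.mul_sum]
        exact Finset.sum_congr rfl fun j hj => h1 i hi j hj
    _ ≤ ((V.card : ℝ)⁻¹) ^ 2 * (2 * (V.card * ∑ i ∈ V, klFun (f i))) :=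
        mul_le_mul_of_nonneg_left (by linarith) (by positivity)
    _ = _ := by
        rw [entOn_eq_klFun ha]
        simp only [hf]
        field_simp

variable [DecidableEq Y]

/-- The kernel of the optimal transport of `a` to `b` for the total variation. -/
def tvKernel (V : Finset Y) (a b : Y → ℝ) (i j : Y) : ℝ :=
  (if i = j then stayMass a b i else 0) +
    (1 - stayMass a b i) * (max (b j - a j) 0 / ∑ l ∈ V, max (b l - a l) 0)

theorem isKernelOn_tv (ha : IsProbOn V a) (hb : IsProbOn V b) : IsKernelOn V (tvKernel V a b) where
  nonneg i hi j hj := by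
    have h := stayMass_mem ha hb hi
    refine add_nonneg (by split_ifs <;> simp [h.1]) (mul_nonneg (sub_nonneg.2 h.2)
      (div_nonneg (le_max_right _ _) (Finset.sum_nonneg fun l _ => le_max_right _ _)))
  sum_eq i hi := by
    simp only [tvKernel]
    rw [Finset.sum_add_distrib, Finset.sum_ite_eq, if_pos hi, ← Finset.mul_sum, ← Finset.sum_div]
    by_cases h0 : ∑ l ∈ V, max (b l - a l) 0 = 0
    · have h1 : max (a i - b i) 0 = 0 := by
        rw [← sum_max_sub_comm ha hb] at h0
        exact (Finset.sum_eq_zero_iff_of_nonneg fun l _ => le_max_right _ _).1 h0 i hi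
      have h2 : a i ≤ b i := by
        have := le_max_left (a i - b i) 0
        linarith
      simp [stayMass, h2]
    · rw [div_self h0]; ring

theorem pushes_tv (ha : IsProbOn V a) (hb : IsProbOn V b) : Pushes V (tvKernel V a b) a b := by
  intro j hj
  have h1 : ∀ i ∈ V, a i * tvKernel V a b i j = (if i = j then a i * stayMass a b i else 0) +
      max (a i - b i) 0 * (max (b j - a j) 0 / ∑ l ∈ V, max (b l - a l) 0) := fun i hi => by
    rw [← mul_one_sub_stayMass hb hi, tvKernel]
    split_ifs <;> ring
  rw [Finset.sum_congr rfl h1, Finset.sum_add_distrib, Finset.sum_ite_eq', if_pos hj,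
    ← Finset.sum_mul, sum_max_sub_comm ha hb]
  have h2 : (∑ l ∈ V, max (b l - a l) 0) * (max (b j - a j) 0 / ∑ l ∈ V, max (b l - a l) 0) =
      max (b j - a j) 0 := by
    refine mul_div_cancel_of_imp' fun h0 => ?_
    exact (Finset.sum_eq_zero_iff_of_nonneg fun l _ => le_max_right _ _).1 h0 j hj
  have h3 := mul_one_sub_stayMass (a := a) hb hj
  rw [max_sub_zero] at h3
  rw [h2, max_sub_zero, abs_sub_comm]
  linarith

theorem tvKernel_self (i : Y) :
    tvKernel V a b i i = stayMass a b i := by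
  rw [tvKernel, if_pos rfl]
  unfold stayMass
  split_ifs with h
  · simp
  · rw [max_eq_right (by linarith)]; simp

theorem IsKernelOn.sum_erase {p : Y → Y → ℝ} (hp : IsKernelOn V p) {i : Y} (hi : i ∈ V) :
    ∑ j ∈ V.erase i, p i j = 1 - p i i := by
  rw [← hp.sum_eq i hi, ← Finset.add_sum_erase V _ hi]
  ring

/-- A kernel that transports `a` to the uniform weights by a flow along the edges of the complete
graph. -/
def flowKernel (V : Finset Y) (a : Y → ℝ) (i j : Y) : ℝ :=
  (if i = j then 1 - ∑ l ∈ V, outflow V a i l else 0) + outflow V a i j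

theorem flowKernel_self (i : Y) : flowKernel V a i i = 1 - ∑ l ∈ V, outflow V a i l := by
  simp [flowKernel, outflow_self]

theorem flowKernel_of_ne {i j : Y} (h : i ≠ j) : flowKernel V a i j = outflow V a i j := by
  simp [flowKernel, h]

theorem isKernelOn_flow (ha : IsProbOn V a) : IsKernelOn V (flowKernel V a) where
  nonneg i hi j hj := by
    refine add_nonneg ?_ (outflow_mem ha hi hj).1
    split_ifs
    · rw [sub_nonneg]
      refine (Finset.sum_le_sum fun l hl => (outflow_mem ha hi hl).2).trans_eq ?_
      have := ha.card_pos.ne'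
      simp [this]
    · exact le_rfl
  sum_eq i hi := by
    simp only [flowKernel]
    rw [Finset.sum_add_distrib, Finset.sum_ite_eq, if_pos hi]
    ring

/-- The net flow from `l` to `j` is `(a l - a j) / V.card`, and summing over `l` brings to `j`
exactly its deficit `V.card⁻¹ - a j`. -/
theorem pushes_flow (ha : IsProbOn V a) : Pushes V (flowKernel V a) a (unifOn V) := by
  intro j hj
  have hN := ha.card_pos
  have h1 : ∀ i ∈ V, a i * flowKernel V a i j =
      (if i = j then a i - ∑ l ∈ V, (V.card : ℝ)⁻¹ * max (a i - a l) 0 else 0) +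
      (V.card : ℝ)⁻¹ * max (a i - a j) 0 := fun i hi => by
    rw [← mul_outflow ha hj, flowKernel, ← Finset.sum_congr rfl fun l hl => mul_outflow ha hl,
      ← Finset.mul_sum]
    split_ifs <;> ring
  rw [Finset.sum_congr rfl h1, Finset.sum_add_distrib, Finset.sum_ite_eq', if_pos hj]
  have h2 : ∑ l ∈ V, (V.card : ℝ)⁻¹ * max (a l - a j) 0 -
      ∑ l ∈ V, (V.card : ℝ)⁻¹ * max (a j - a l) 0 = (V.card : ℝ)⁻¹ - a j := by
    rw [← Finset.sum_sub_distrib]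
    have h3 : ∀ l ∈ V, (V.card : ℝ)⁻¹ * max (a l - a j) 0 - (V.card : ℝ)⁻¹ * max (a j - a l) 0 =
        (V.card : ℝ)⁻¹ * (a l - a j) := fun l _ => by
      rw [max_sub_zero, max_sub_zero, abs_sub_comm]; ring
    rw [Finset.sum_congr rfl h3, ← Finset.mul_sum, Finset.sum_sub_distrib, ha.sum_eq]
    simp
    field_simp
  rw [unifOn]
  linarith

end OneStep

/-- The mean of `g` over `s`. -/
def meanOn {X : Type*} (s : Finset X) (g : X → ℝ) : ℝ := (s.card : ℝ)⁻¹ * ∑ x ∈ s, g x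

theorem meanOn_congr {X : Type*} {s : Finset X} {g g' : X → ℝ} (h : ∀ x ∈ s, g x = g' x) :
    meanOn s g = meanOn s g' := by rw [meanOn, meanOn, Finset.sum_congr rfl h]

theorem meanOn_const {X : Type*} {s : Finset X} (hs : s.Nonempty) (c : ℝ) :
    meanOn s (fun _ => c) = c := by
  have : (s.card : ℝ) ≠ 0 := by exact_mod_cast hs.card_pos.ne'
  simp [meanOn, this]

theorem IsTwisted.meanOn_eq {X Y : Type*} [DecidableEq Y] {s : Finset X} {V : Finset Y} {φ : X → Y}
    {T : Y → X → X} (h : IsTwisted s V φ T) (g : X → ℝ) :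
    meanOn s g = meanOn V fun i => meanOn (fiberOn s φ i) g := by
  simp only [meanOn]
  rw [← sum_fiberOn h.map_mem, Finset.mul_sum, Finset.mul_sum]
  refine Finset.sum_congr rfl fun i hi => ?_
  rw [← h.card_mul hi, mul_inv, mul_assoc]

/-! ### Cosets of permutations with prescribed values. -/

section Coset

variable {α : Type*} [Fintype α] [DecidableEq α]

/-- The permutations that agree with `ρ` on `A`. -/
def coset (A : Finset α) (ρ : Equiv.Perm α) : Finset (Equiv.Perm α) :=
  Finset.univ.filter fun σ => ∀ a ∈ A, σ a = ρ a

/-- The values that `ρ` does not take on `A`. -/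
def freeValues (A : Finset α) (ρ : Equiv.Perm α) : Finset α := (A.map ρ.toEmbedding)ᶜ

/-- Left multiplication by the transposition that gives `σ` the value `j` at `l`. -/
def swapTo (l j : α) (σ : Equiv.Perm α) : Equiv.Perm α := Equiv.swap (σ l) j * σ

variable {A : Finset α} {ρ : Equiv.Perm α}

theorem mem_coset {σ : Equiv.Perm α} : σ ∈ coset A ρ ↔ ∀ a ∈ A, σ a = ρ a := by simp [coset]

theorem self_mem_coset : ρ ∈ coset A ρ := mem_coset.2 fun _ _ => rfl

theorem coset_nonempty : (coset A ρ).Nonempty := ⟨ρ, self_mem_coset⟩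

theorem mem_freeValues {v : α} : v ∈ freeValues A ρ ↔ ∀ a ∈ A, ρ a ≠ v := by
  simp [freeValues, -Finset.mem_map_equiv]

theorem card_freeValues : (freeValues A ρ).card = Aᶜ.card := by
  rw [freeValues, Finset.card_compl, Finset.card_compl, Finset.card_map]

theorem apply_mem_freeValues {σ : Equiv.Perm α} (hσ : σ ∈ coset A ρ) {l : α} :
    σ l ∈ freeValues A ρ ↔ l ∈ Aᶜ := by
  rw [mem_freeValues, Finset.mem_compl]
  rw [mem_coset] at hσ
  constructor
  · exact fun h hl => h l hl (hσ l hl).symm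
  · intro hl a ha h
    rw [← hσ a ha] at h
    exact hl (σ.injective h ▸ ha)

/-- The transposition exchanges `σ l` and `j`, neither of which is taken on `A`, so the prescribed
values survive. The same transposition, applied again, undoes it. -/
theorem isTwisted_coset {l : α} (hl : l ∈ Aᶜ) :
    IsTwisted (coset A ρ) (freeValues A ρ) (fun σ => σ l) (swapTo l) where
  map_mem σ hσ := (apply_mem_freeValues hσ).2 hl
  twist_mem σ hσ j hj := by
    have h1 := mem_coset.1 hσ
    rw [mem_coset]
    intro a ha
    rw [swapTo, Equiv.Perm.mul_apply, Equiv.swap_apply_of_ne_of_ne, h1 a ha]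
    · exact fun h => Finset.mem_compl.1 hl (σ.injective h ▸ ha)
    · rw [h1 a ha]
      exact mem_freeValues.1 hj a ha
  map_twist σ _ j _ := by simp [swapTo]
  twist_twist σ _ j _ := by
    ext x
    simp [swapTo, Equiv.swap_comm j]

/-- Fibres of evaluation at a free position are cosets of the same kind with one free position less,
which is what lets the inductions proceed. -/
theorem fiberOn_coset {l i : α} (hl : l ∈ Aᶜ) (hi : i ∈ freeValues A ρ) :
    fiberOn (coset A ρ) (fun σ => σ l) i = coset (insert l A) (swapTo l i ρ) := by
  have h := isTwisted_coset (ρ := ρ) hl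
  have h1 := mem_coset.1 (h.twist_mem ρ self_mem_coset i hi)
  have h2 : swapTo l i ρ l = i := h.map_twist ρ self_mem_coset i hi
  ext σ
  rw [mem_fiberOn, mem_coset, mem_coset]
  constructor
  · rintro ⟨h3, h4⟩ a ha
    rcases Finset.mem_insert.1 ha with rfl | ha
    · rw [h4, h2]
    · rw [h3 a ha, h1 a ha]
  · intro h3
    refine ⟨fun a ha => ?_, ?_⟩
    · rw [h3 a (Finset.mem_insert_of_mem ha), h1 a ha]
    · rw [h3 l (Finset.mem_insert_self l A), h2]

theorem freeValues_insert {l i : α} (hl : l ∈ Aᶜ) (hi : i ∈ freeValues A ρ) :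
    freeValues (insert l A) (swapTo l i ρ) = (freeValues A ρ).erase i := by
  have h := isTwisted_coset (ρ := ρ) hl
  have h1 := mem_coset.1 (h.twist_mem ρ self_mem_coset i hi)
  have h2 : swapTo l i ρ l = i := h.map_twist ρ self_mem_coset i hi
  ext v
  rw [Finset.mem_erase, mem_freeValues, mem_freeValues, Finset.forall_mem_insert, h2, ne_comm]
  refine and_congr_right fun _ => forall₂_congr fun a ha => ?_
  rw [h1 a ha]

theorem compl_insert_eq_erase (l : α) : (insert l A)ᶜ = Aᶜ.erase l := by
  rw [Finset.compl_insert]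

theorem sum_erase_comp_coset {σ : Equiv.Perm α} (hσ : σ ∈ coset A ρ) (l : α) (h : α → ℝ) :
    ∑ m ∈ Aᶜ.erase l, h (σ m) = ∑ v ∈ (freeValues A ρ).erase (σ l), h v :=
  Finset.sum_equiv σ (fun m => by
    rw [Finset.mem_erase, Finset.mem_erase, apply_mem_freeValues hσ, σ.injective.ne_iff])
    fun _ _ => rfl

theorem meanOn_coset_eval {l : α} (hl : l ∈ Aᶜ) (h : α → ℝ) :
    meanOn (coset A ρ) (fun σ => h (σ l)) = meanOn (freeValues A ρ) h := by
  rw [(isTwisted_coset hl).meanOn_eq]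
  refine meanOn_congr fun i hi => ?_
  rw [fiberOn_coset hl hi, meanOn_congr (g' := fun _ => h i), meanOn_const coset_nonempty]
  intro σ hσ
  rw [← fiberOn_coset hl hi] at hσ
  rw [(mem_fiberOn.1 hσ).2]

theorem meanOn_coset_insert {l : α} (hl : l ∈ Aᶜ) (g : α → Equiv.Perm α → ℝ) :
    meanOn (coset A ρ) (fun σ => g (σ l) σ) = meanOn (freeValues A ρ) fun i =>
      meanOn (coset (insert l A) (swapTo l i ρ)) (g i) := by
  rw [(isTwisted_coset hl).meanOn_eq]
  refine meanOn_congr fun i hi => ?_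
  rw [fiberOn_coset hl hi]
  refine meanOn_congr fun σ hσ => ?_
  rw [← fiberOn_coset hl hi] at hσ
  rw [(mem_fiberOn.1 hσ).2]

/-- The values of a uniform permutation at three free positions are three successive draws without
replacement. -/
theorem meanOn_coset_eval₃ {m l l' : α} (hm : m ∈ Aᶜ) (hl : l ∈ Aᶜ.erase m)
    (hl' : l' ∈ (Aᶜ.erase m).erase l) (H : α → α → α → ℝ) :
    meanOn (coset A ρ) (fun σ => H (σ m) (σ l) (σ l')) = meanOn (freeValues A ρ) fun v =>
      meanOn ((freeValues A ρ).erase v) fun i =>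
        meanOn (((freeValues A ρ).erase v).erase i) (H v i) := by
  rw [meanOn_coset_insert hm (fun v σ => H v (σ l) (σ l'))]
  refine meanOn_congr fun v hv => ?_
  rw [← compl_insert_eq_erase] at hl hl'
  rw [meanOn_coset_insert hl (fun i σ => H v i (σ l')), freeValues_insert hm hv]
  refine meanOn_congr fun i hi => ?_
  rw [← compl_insert_eq_erase] at hl'
  rw [← freeValues_insert hm hv] at hi ⊢
  rw [meanOn_coset_eval hl', freeValues_insert hl hi]

/-- The laws of the values at the free positions form a doubly stochastic matrix. -/
theorem sum_margOn_coset {ν : Equiv.Perm α → ℝ} (hν : IsProbOn (coset A ρ) ν) {v : α}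
    (hv : v ∈ freeValues A ρ) : ∑ l ∈ Aᶜ, margOn (coset A ρ) (fun σ => σ l) ν v = 1 := by
  simp only [margOn, fiberOn, Finset.sum_filter]
  rw [Finset.sum_comm, ← hν.sum_eq]
  refine Finset.sum_congr rfl fun σ hσ => ?_
  rw [Finset.sum_eq_single (σ.symm v)]
  · simp
  · intro l _ hl
    rw [if_neg]
    rintro rfl
    simp at hl
  · intro h
    exact absurd ((apply_mem_freeValues hσ).1 (by simpa using hv)) h

theorem sum_mul_comp_eval {ν : Equiv.Perm α → ℝ} {l : α} (hl : l ∈ Aᶜ) (h : α → ℝ) :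
    ∑ σ ∈ coset A ρ, ν σ * h (σ l) =
      ∑ i ∈ freeValues A ρ, margOn (coset A ρ) (fun σ => σ l) ν i * h i := by
  rw [← sum_fiberOn (isTwisted_coset hl).map_mem]
  refine Finset.sum_congr rfl fun i _ => ?_
  rw [margOn, Finset.sum_mul]
  refine Finset.sum_congr rfl fun σ hσ => ?_
  rw [(mem_fiberOn.1 hσ).2]

theorem sum_unifOn_mul {X : Type*} (s : Finset X) (g : X → ℝ) :
    ∑ x ∈ s, unifOn s x * g x = meanOn s g := by
  rw [meanOn, Finset.mul_sum]
  rfl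

end Coset

/-! ### The mass received by a value above the uniform level. -/

section Excess

variable {Y : Type*}

/-- The excess of the density of `b` over the uniform density. -/
def excess (V : Finset Y) (b : Y → ℝ) (v : Y) : ℝ := max (V.card * b v - 1) 0

/-- At each `v` at most one of the two terms on the left is nonzero, according as the density is
below or above 1, so a single `klFun` pays for both. -/
theorem stayMass_sq_add_excess_le {V : Finset Y} {b : Y → ℝ} (hb : IsProbOn V b) {v : Y}
    (hv : v ∈ V) : 2 * (1 - stayMass (unifOn V) b v) ^ 2 +
      2 * (excess V b v ^ 2 / (1 + excess V b v)) ≤ 4 * klFun (V.card * b v) := by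
  have hN := hb.card_pos
  have h0 := mul_nonneg hN.le (hb.nonneg v hv)
  unfold stayMass excess unifOn
  split_ifs with h
  · have h1 : 1 ≤ V.card * b v := by
      have := mul_le_mul_of_nonneg_left h hN.le
      rwa [mul_inv_cancel₀ hN.ne'] at this
    have h2 := sq_div_le_two_mul_klFun_of_one_le h1
    rw [max_eq_left (by linarith), add_sub_cancel]
    linarith
  · have h1 : V.card * b v ≤ 1 := by
      have := mul_le_mul_of_nonneg_left (not_le.1 h).le hN.le
      rwa [mul_inv_cancel₀ hN.ne'] at this
    have h2 := sq_le_two_mul_klFun_of_le_one h0 h1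
    rw [max_eq_right (by linarith), div_inv_eq_mul, mul_comm (b v)]
    linarith

variable [DecidableEq Y]

/-- Under a uniform source, the mass entering `v` from elsewhere is `V.card⁻¹` times this column
sum, and it must equal the positive part of `b v - V.card⁻¹`. -/
theorem sum_erase_tvKernel_unifOn {V : Finset Y} {b : Y → ℝ} (hb : IsProbOn V b) {v : Y}
    (hv : v ∈ V) : ∑ i ∈ V.erase v, tvKernel V (unifOn V) b i v = excess V b v := by
  have hN := hb.card_pos
  have hu := isProbOn_unifOn hb.nonempty
  have h1 := pushes_tv hu hb v hv
  have h2 := mul_one_sub_stayMass (a := unifOn V) hb hv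
  rw [← Finset.add_sum_erase V _ hv, tvKernel_self] at h1
  simp only [unifOn] at h1 h2 ⊢
  rw [← Finset.mul_sum] at h1
  have h3 : excess V b v = V.card * max (b v - (V.card : ℝ)⁻¹) 0 := by
    rw [excess, mul_max_of_nonneg _ _ hN.le, mul_zero, mul_sub, mul_inv_cancel₀ hN.ne']
  rw [h3]
  have h4 : max (b v - (V.card : ℝ)⁻¹) 0 = b v - (V.card : ℝ)⁻¹ + max ((V.card : ℝ)⁻¹ - b v) 0 := by
    rw [max_sub_zero, max_sub_zero, abs_sub_comm]; ring
  rw [h4, ← h2, ← h1]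
  field_simp
  ring

theorem IsKernelOn.sum_sq_erase_le {V : Finset Y} {p : Y → Y → ℝ} (hp : IsKernelOn V p) {i : Y}
    (hi : i ∈ V) : ∑ v ∈ V.erase i, p i v ^ 2 ≤ (1 - p i i) ^ 2 := by
  have h0 : ∀ v ∈ V.erase i, 0 ≤ p i v := fun v hv =>
    hp.nonneg i hi v (Finset.mem_of_mem_erase hv)
  rw [← hp.sum_erase hi, sq (∑ v ∈ V.erase i, p i v), Finset.sum_mul]
  refine Finset.sum_le_sum fun v hv => ?_
  rw [sq]
  exact mul_le_mul_of_nonneg_left (Finset.single_le_sum h0 hv) (h0 v hv)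

end Excess

/-! ### The one-step displacement in mean square. -/

section Displacement

variable {α : Type*} [Fintype α] [DecidableEq α] {A : Finset α} {ρ : Equiv.Perm α}
  {ν : Equiv.Perm α → ℝ}

/-- The law of the value at `l` of a random permutation in the coset. -/
abbrev evalLaw (A : Finset α) (ρ : Equiv.Perm α) (ν : Equiv.Perm α → ℝ) (l : α) : α → ℝ :=
  margOn (coset A ρ) (fun σ => σ l) ν

/-- A bound for the probability that the position `m` of `σ` is altered when the value at a random
position is moved by the kernels `p`. -/
def displacement (A : Finset α) (p : α → α → α → ℝ) (σ : Equiv.Perm α) (m : α) : ℝ :=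
  (1 - p m (σ m) (σ m)) + ∑ l ∈ Aᶜ.erase m, p l (σ l) (σ m)

theorem IsProbOn.evalLaw (hν : IsProbOn (coset A ρ) ν) {l : α} (hl : l ∈ Aᶜ) :
    IsProbOn (freeValues A ρ) (evalLaw A ρ ν l) :=
  hν.marg (isTwisted_coset hl).map_mem

theorem sq_sum_erase_le {ι : Type*} [DecidableEq ι] {s : Finset ι} {i : ι} (f : ι → ℝ) :
    (∑ j ∈ s.erase i, f j) ^ 2 ≤ s.card * ∑ j ∈ s.erase i, f j ^ 2 := by
  refine sq_sum_le_card_mul_sum_sq.trans ?_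
  gcongr
  exact Finset.erase_subset i s

/-- Both parts of the displacement are sums of outflows: those leaving `σ m` at position `m`, and
those entering `σ m` from the other positions. Cauchy–Schwarz costs a factor `V.card` in each, and
after summation over `m` the two contributions coincide. `sum_mul_outflow_sq_le` absorbs the factor,
since each outflow is itself at most `V.card⁻¹`-sized; the constant is `4 * 2`. -/
theorem displacement_flow_le (hν : IsProbOn (coset A ρ) ν) :
    ∑ σ ∈ coset A ρ, ν σ * ∑ m ∈ Aᶜ,
      displacement A (fun l => flowKernel (freeValues A ρ) (evalLaw A ρ ν l)) σ m ^ 2 ≤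
      8 * ∑ l ∈ Aᶜ, entOn (freeValues A ρ) (evalLaw A ρ ν l) := by
  set V := freeValues A ρ with hV
  let q : α → α → α → ℝ := fun l => outflow V (evalLaw A ρ ν l)
  have hpt : ∀ σ ∈ coset A ρ, ∑ m ∈ Aᶜ,
      displacement A (fun l => flowKernel V (evalLaw A ρ ν l)) σ m ^ 2 ≤
      4 * ∑ l ∈ Aᶜ, V.card * ∑ j ∈ V, q l (σ l) j ^ 2 := by
    intro σ hσ
    have h1 : ∀ m ∈ Aᶜ, displacement A (fun l => flowKernel V (evalLaw A ρ ν l)) σ m ^ 2 ≤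
        2 * (V.card * ∑ j ∈ V, q m (σ m) j ^ 2) +
          2 * (V.card * ∑ l ∈ Aᶜ.erase m, q l (σ l) (σ m) ^ 2) := by
      intro m _
      have h2 : displacement A (fun l => flowKernel V (evalLaw A ρ ν l)) σ m =
          ∑ j ∈ V, q m (σ m) j + ∑ l ∈ Aᶜ.erase m, q l (σ l) (σ m) := by
        rw [displacement, flowKernel_self, sub_sub_cancel]
        congr 1
        refine Finset.sum_congr rfl fun l hl => ?_
        rw [flowKernel_of_ne (σ.injective.ne (Finset.ne_of_mem_erase hl))]
      have h3 : (∑ j ∈ V, q m (σ m) j) ^ 2 ≤ V.card * ∑ j ∈ V, q m (σ m) j ^ 2 :=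
        sq_sum_le_card_mul_sum_sq
      have h4 := sq_sum_erase_le (s := Aᶜ) (i := m) fun l => q l (σ l) (σ m)
      rw [← card_freeValues (ρ := ρ), ← hV] at h4
      rw [h2]
      refine add_sq_le.trans ?_
      linarith
    -- Incoming flow is turned into outgoing flow: as `m` runs over the free positions other than
    -- `l`, `σ m` runs over the free values other than `σ l`.
    have h5 : ∑ m ∈ Aᶜ, ∑ l ∈ Aᶜ.erase m, q l (σ l) (σ m) ^ 2 =
        ∑ l ∈ Aᶜ, ∑ j ∈ V, q l (σ l) j ^ 2 := by
      rw [Finset.sum_comm' (t' := Aᶜ) (s' := fun l => Aᶜ.erase l)]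
      · refine Finset.sum_congr rfl fun l hl => ?_
        rw [sum_erase_comp_coset hσ l fun v => q l (σ l) v ^ 2]
        refine Finset.sum_erase _ ?_
        simp only [q, outflow_self]
        norm_num
      · intro x y
        simp only [Finset.mem_erase, ne_comm]
        tauto
    refine (Finset.sum_le_sum h1).trans_eq ?_
    rw [Finset.sum_add_distrib, ← Finset.mul_sum, ← Finset.mul_sum, ← Finset.mul_sum,
      ← Finset.mul_sum, h5]
    ring
  calc _ ≤ ∑ σ ∈ coset A ρ, ν σ * (4 * ∑ l ∈ Aᶜ, V.card * ∑ j ∈ V, q l (σ l) j ^ 2) :=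
        Finset.sum_le_sum fun σ hσ => mul_le_mul_of_nonneg_left (hpt σ hσ) (hν.nonneg σ hσ)
    _ = 4 * ∑ l ∈ Aᶜ, ∑ σ ∈ coset A ρ, ν σ * (V.card * ∑ j ∈ V, q l (σ l) j ^ 2) := by
        rw [Finset.sum_comm, Finset.mul_sum]
        refine Finset.sum_congr rfl fun σ _ => ?_
        rw [Finset.mul_sum, Finset.mul_sum, Finset.mul_sum]
        exact Finset.sum_congr rfl fun l _ => by ring
    _ ≤ 4 * ∑ l ∈ Aᶜ, 2 * entOn V (evalLaw A ρ ν l) := by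
        refine mul_le_mul_of_nonneg_left (Finset.sum_le_sum fun l hl => ?_) (by norm_num)
        rw [sum_mul_comp_eval hl fun i => V.card * ∑ j ∈ V, q l i j ^ 2]
        exact sum_mul_outflow_sq_le (hν.evalLaw hl)
    _ = _ := by rw [← Finset.mul_sum]; ring

theorem meanOn_add {X : Type*} {s : Finset X} {f g : X → ℝ} :
    meanOn s (fun x => f x + g x) = meanOn s f + meanOn s g := by
  rw [meanOn, meanOn, meanOn, Finset.sum_add_distrib, mul_add]

theorem meanOn_sum {X ι : Type*} {s : Finset X} {I : Finset ι} {f : ι → X → ℝ} :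
    meanOn s (fun x => ∑ i ∈ I, f i x) = ∑ i ∈ I, meanOn s (f i) := by
  simp only [meanOn]
  rw [Finset.sum_comm, Finset.mul_sum]

theorem meanOn_mul_left {X : Type*} {s : Finset X} {f : X → ℝ} (c : ℝ) :
    meanOn s (fun x => c * f x) = c * meanOn s f := by
  simp only [meanOn, ← Finset.mul_sum]
  ring

theorem meanOn_mono {X : Type*} {s : Finset X} {f g : X → ℝ} (h : ∀ x ∈ s, f x ≤ g x) :
    meanOn s f ≤ meanOn s g :=
  mul_le_mul_of_nonneg_left (Finset.sum_le_sum h) (by positivity)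

variable {b : α → α → ℝ}

/-- The correlation of two corrupted positions, for independent uniform values. -/
theorem meanOn_corruption_mul_le (hb : ∀ l ∈ Aᶜ, IsProbOn (freeValues A ρ) (b l)) {m l l' : α}
    (hm : m ∈ Aᶜ) (hl : l ∈ Aᶜ.erase m) (hl' : l' ∈ (Aᶜ.erase m).erase l) :
    meanOn (coset A ρ) (fun σ =>
      tvKernel (freeValues A ρ) (unifOn (freeValues A ρ)) (b l) (σ l) (σ m) *
      tvKernel (freeValues A ρ) (unifOn (freeValues A ρ)) (b l') (σ l') (σ m)) ≤
    ((Aᶜ.card : ℝ) * (Aᶜ.card - 1) * (Aᶜ.card - 2))⁻¹ * ∑ v ∈ freeValues A ρ,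
      excess (freeValues A ρ) (b l) v * excess (freeValues A ρ) (b l') v := by
  set V := freeValues A ρ with hV
  set p : α → α → α → ℝ := fun l => tvKernel V (unifOn V) (b l) with hp
  have hl1 : l ∈ Aᶜ := Finset.mem_of_mem_erase hl
  have hl2 : l' ∈ Aᶜ := Finset.mem_of_mem_erase (Finset.mem_of_mem_erase hl')
  have hk : ∀ l ∈ Aᶜ, IsKernelOn V (p l) := fun l hl =>
    isKernelOn_tv (isProbOn_unifOn (hb l hl).nonempty) (hb l hl)
  have hcard : V.card = Aᶜ.card := card_freeValues
  have h3 : 3 ≤ Aᶜ.card := by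
    have e1 := Finset.card_erase_of_mem hm
    have e2 := Finset.card_erase_of_mem hl
    have e3 := Finset.card_pos.2 ⟨l', hl'⟩
    omega
  rw [meanOn_coset_eval₃ hm hl hl' fun v i i' => p l i v * p l' i' v, ← hV]
  have hc1 : ∀ v ∈ V, ((V.erase v).card : ℝ) = Aᶜ.card - 1 := fun v hv => by
    rw [Finset.card_erase_of_mem hv, hcard, Nat.cast_sub (by omega)]; simp
  have hc2 : ∀ v ∈ V, ∀ i ∈ V.erase v, (((V.erase v).erase i).card : ℝ) = Aᶜ.card - 2 :=
    fun v hv i hi => by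
      rw [Finset.card_erase_of_mem hi, Finset.card_erase_of_mem hv, hcard,
        Nat.cast_sub (by omega), Nat.cast_sub (by omega)]; push_cast; ring
  have h3' : (3 : ℝ) ≤ Aᶜ.card := by exact_mod_cast h3
  rw [mul_inv, mul_inv, mul_assoc, mul_assoc, meanOn, hcard]
  refine mul_le_mul_of_nonneg_left ?_ (by positivity)
  rw [Finset.mul_sum, Finset.mul_sum]
  refine Finset.sum_le_sum fun v hv => ?_
  rw [meanOn, hc1 v hv]
  refine mul_le_mul_of_nonneg_left ?_ (inv_nonneg.2 (by linarith))
  rw [← sum_erase_tvKernel_unifOn (hb l hl1) hv, Finset.sum_mul, Finset.mul_sum]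
  refine Finset.sum_le_sum fun i hi => ?_
  rw [meanOn_mul_left, meanOn, hc2 v hv i hi, mul_left_comm]
  refine mul_le_mul_of_nonneg_left (mul_le_mul_of_nonneg_left ?_
    ((hk l hl1).nonneg i (Finset.mem_of_mem_erase hi) v hv)) (inv_nonneg.2 (by linarith))
  rw [← sum_erase_tvKernel_unifOn (hb l' hl2) hv]
  exact Finset.sum_le_sum_of_subset_of_nonneg (Finset.erase_subset _ _) fun j hj _ =>
    (hk l' hl2).nonneg j (Finset.mem_of_mem_erase hj) v hv

theorem sq_sum_eq_sum_sq_add {ι : Type*} [DecidableEq ι] (s : Finset ι) (f : ι → ℝ) :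
    (∑ l ∈ s, f l) ^ 2 = ∑ l ∈ s, f l ^ 2 + ∑ l ∈ s, ∑ l' ∈ s.erase l, f l * f l' := by
  rw [sq, Finset.sum_mul_sum, ← Finset.sum_add_distrib]
  refine Finset.sum_congr rfl fun l hl => ?_
  rw [← Finset.add_sum_erase s _ hl, sq]

/-- Each ordered pair of distinct indices is counted once for every index avoiding both. -/
theorem sum_erase_erase {ι : Type*} [DecidableEq ι] (s : Finset ι) (c : ι → ι → ℝ) :
    ∑ m ∈ s, ∑ l ∈ s.erase m, ∑ l' ∈ (s.erase m).erase l, c l l' =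
      ((s.card : ℝ) - 2) * ∑ l ∈ s, ∑ l' ∈ s.erase l, c l l' := by
  have h1 : ∀ l ∈ s, ∑ m ∈ s.erase l, ∑ l' ∈ (s.erase m).erase l, c l l' =
      ((s.card : ℝ) - 2) * ∑ l' ∈ s.erase l, c l l' := by
    intro l hl
    rw [Finset.sum_comm' (t' := s.erase l) (s' := fun l' => (s.erase l).erase l'), Finset.mul_sum]
    · refine Finset.sum_congr rfl fun l' hl' => ?_
      have hp := Finset.card_pos.2 ⟨l', hl'⟩
      rw [Finset.sum_const, Finset.card_erase_of_mem hl', nsmul_eq_mul, Nat.cast_sub hp,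
        Finset.card_erase_of_mem hl, Nat.cast_sub (Finset.card_pos.2 ⟨l, hl⟩)]
      push_cast
      ring
    · intro x y
      simp only [Finset.mem_erase, ne_comm]
      tauto
  rw [Finset.sum_comm' (t' := s) (s' := fun l => s.erase l), Finset.mul_sum]
  · exact Finset.sum_congr rfl h1
  · intro x y
    simp only [Finset.mem_erase, ne_comm]
    tauto

/-- Cauchy–Schwarz with weights `1 + excess`. Since the laws of the values at the free positions
form a doubly stochastic matrix, the excesses at `v` total at most `Aᶜ.card`, and the weights at
most twice that. -/
theorem sq_sum_excess_le (hb : ∀ l ∈ Aᶜ, IsProbOn (freeValues A ρ) (b l)) {v : α}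
    (hv : v ∈ freeValues A ρ) (hds : ∑ l ∈ Aᶜ, b l v = 1) :
    (∑ l ∈ Aᶜ, excess (freeValues A ρ) (b l) v) ^ 2 ≤ 2 * Aᶜ.card *
      ∑ l ∈ Aᶜ, excess (freeValues A ρ) (b l) v ^ 2 / (1 + excess (freeValues A ρ) (b l) v) := by
  have hu : ∀ l, 0 ≤ excess (freeValues A ρ) (b l) v := fun l => le_max_right _ _
  have h := Finset.sum_sq_le_sum_mul_sum_of_sq_le_mul Aᶜ
    (r := fun l => excess (freeValues A ρ) (b l) v)
    (f := fun l => 1 + excess (freeValues A ρ) (b l) v)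
    (g := fun l => excess (freeValues A ρ) (b l) v ^ 2 / (1 + excess (freeValues A ρ) (b l) v))
    (fun l _ => by linarith [hu l])
    (fun l _ => div_nonneg (sq_nonneg _) (by linarith [hu l]))
    (fun l _ => by rw [mul_div_cancel₀ _ (by linarith [hu l])])
  refine h.trans (mul_le_mul_of_nonneg_right ?_ (Finset.sum_nonneg fun l _ =>
    div_nonneg (sq_nonneg _) (by linarith [hu l])))
  have h2 : ∑ l ∈ Aᶜ, excess (freeValues A ρ) (b l) v ≤ ∑ l ∈ Aᶜ, Aᶜ.card * b l v :=
    Finset.sum_le_sum fun l hl => by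
      have := mul_nonneg (Nat.cast_nonneg (α := ℝ) Aᶜ.card) ((hb l hl).nonneg v hv)
      rw [excess, card_freeValues]
      exact max_le (by linarith) this
  rw [← Finset.mul_sum, hds] at h2
  rw [Finset.sum_add_distrib]
  simp only [Finset.sum_const, nsmul_eq_mul]
  linarith

/-- Squaring the collision sum gives diagonal and cross terms. The diagonal, summed over positions,
is at most the total squared probability of leaving. The cross terms are averaged over the uniform
permutation: two positions sending mass to the same third value correlate only through the products
of their excesses, which double stochasticity controls. Departures and excesses then share one
`klFun` by `stayMass_sq_add_excess_le`. -/
theorem meanOn_displacement_tv_le (hb : ∀ l ∈ Aᶜ, IsProbOn (freeValues A ρ) (b l))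
    (hds : ∀ v ∈ freeValues A ρ, ∑ l ∈ Aᶜ, b l v = 1) :
    meanOn (coset A ρ) (fun σ => ∑ m ∈ Aᶜ, displacement A
      (fun l => tvKernel (freeValues A ρ) (unifOn (freeValues A ρ)) (b l)) σ m ^ 2) ≤
      8 * ∑ l ∈ Aᶜ, entOn (freeValues A ρ) (b l) := by
  set V := freeValues A ρ with hV
  set p : α → α → α → ℝ := fun l => tvKernel V (unifOn V) (b l) with hp
  have hk : ∀ l ∈ Aᶜ, IsKernelOn V (p l) := fun l hl =>
    isKernelOn_tv (isProbOn_unifOn (hb l hl).nonempty) (hb l hl)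
  set c : α → α → ℝ := fun l l' => ∑ v ∈ V, excess V (b l) v * excess V (b l') v with hc
  set N : ℝ := (Aᶜ.card : ℝ) with hN
  have hcard : (V.card : ℝ) = N := by rw [hN, hV, card_freeValues]
  let O : α → α → ℝ := fun l v => (1 - stayMass (unifOn V) (b l) v) ^ 2
  have hpt : ∀ σ ∈ coset A ρ, ∑ m ∈ Aᶜ, displacement A p σ m ^ 2 ≤
      4 * ∑ l ∈ Aᶜ, O l (σ l) + 2 * ∑ m ∈ Aᶜ, ∑ l ∈ Aᶜ.erase m, ∑ l' ∈ (Aᶜ.erase m).erase l,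
        p l (σ l) (σ m) * p l' (σ l') (σ m) := by
    intro σ hσ
    have h1 : ∀ m ∈ Aᶜ, displacement A p σ m ^ 2 ≤ 2 * O m (σ m) +
        2 * ∑ l ∈ Aᶜ.erase m, p l (σ l) (σ m) ^ 2 + 2 * ∑ l ∈ Aᶜ.erase m,
          ∑ l' ∈ (Aᶜ.erase m).erase l, p l (σ l) (σ m) * p l' (σ l') (σ m) := by
      intro m _
      refine add_sq_le.trans (le_of_eq ?_)
      rw [sq_sum_eq_sum_sq_add]
      simp only [O, hp, tvKernel_self]
      ring
    have h2 : ∑ m ∈ Aᶜ, ∑ l ∈ Aᶜ.erase m, p l (σ l) (σ m) ^ 2 ≤ ∑ l ∈ Aᶜ, O l (σ l) := by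
      rw [Finset.sum_comm' (t' := Aᶜ) (s' := fun l => Aᶜ.erase l)]
      · refine Finset.sum_le_sum fun l hl => ?_
        rw [sum_erase_comp_coset hσ l fun v => p l (σ l) v ^ 2]
        refine ((hk l hl).sum_sq_erase_le ((apply_mem_freeValues hσ).2 hl)).trans_eq ?_
        simp only [hp, O, tvKernel_self]
      · intro x y
        simp only [Finset.mem_erase, ne_comm]
        tauto
    refine (Finset.sum_le_sum h1).trans ?_
    rw [Finset.sum_add_distrib, Finset.sum_add_distrib, ← Finset.mul_sum, ← Finset.mul_sum,
      ← Finset.mul_sum]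
    linarith
  have hQ : ∑ l ∈ Aᶜ, ∑ l' ∈ Aᶜ.erase l, c l l' =
      ∑ v ∈ V, ((∑ l ∈ Aᶜ, excess V (b l) v) ^ 2 - ∑ l ∈ Aᶜ, excess V (b l) v ^ 2) := by
    simp only [sq_sum_eq_sum_sq_add, add_sub_cancel_left, hc]
    rw [Finset.sum_comm (s := V)]
    refine Finset.sum_congr rfl fun l _ => ?_
    rw [Finset.sum_comm]
  have hQ0 : 0 ≤ ∑ l ∈ Aᶜ, ∑ l' ∈ Aᶜ.erase l, c l l' :=
    Finset.sum_nonneg fun l _ => Finset.sum_nonneg fun l' _ => Finset.sum_nonneg fun v _ =>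
      mul_nonneg (le_max_right _ _) (le_max_right _ _)
  have hcorr : meanOn (coset A ρ) (fun σ => ∑ m ∈ Aᶜ, ∑ l ∈ Aᶜ.erase m,
      ∑ l' ∈ (Aᶜ.erase m).erase l, p l (σ l) (σ m) * p l' (σ l') (σ m)) ≤
      2 * N⁻¹ * ∑ l ∈ Aᶜ, ∑ v ∈ V, excess V (b l) v ^ 2 / (1 + excess V (b l) v) := by
    rcases Finset.eq_empty_or_nonempty Aᶜ with h0 | h0
    · simp [h0, meanOn]
    have hN1 : 1 ≤ N := by rw [hN]; exact_mod_cast h0.card_pos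
    simp only [meanOn_sum]
    calc _ ≤ ∑ m ∈ Aᶜ, ∑ l ∈ Aᶜ.erase m, ∑ l' ∈ (Aᶜ.erase m).erase l,
          (N * (N - 1) * (N - 2))⁻¹ * c l l' :=
          Finset.sum_le_sum fun m hm => Finset.sum_le_sum fun l hl => Finset.sum_le_sum
            fun l' hl' => meanOn_corruption_mul_le hb hm hl hl'
      _ = (N * (N - 1))⁻¹ * ((N - 2)⁻¹ * (N - 2)) * ∑ l ∈ Aᶜ, ∑ l' ∈ Aᶜ.erase l, c l l' := by
          simp only [← Finset.mul_sum]
          rw [sum_erase_erase, mul_inv]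
          ring
      -- The factor `(N - 2)⁻¹ * (N - 2)` is 1, or 0 when `N = 2`, where no triple of positions
      -- exists.
      _ ≤ (N * (N - 1))⁻¹ * 1 * ∑ l ∈ Aᶜ, ∑ l' ∈ Aᶜ.erase l, c l l' := by
          refine mul_le_mul_of_nonneg_right (mul_le_mul_of_nonneg_left inv_mul_le_one
            (inv_nonneg.2 (mul_nonneg (by linarith) (by linarith)))) hQ0
      _ ≤ (N ^ 2)⁻¹ * ∑ v ∈ V, (∑ l ∈ Aᶜ, excess V (b l) v) ^ 2 := by
          rw [hQ, mul_one, Finset.mul_sum, Finset.mul_sum]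
          refine Finset.sum_le_sum fun v _ => ?_
          -- Removing the diagonal lowers the squared sum by at least its `N`-th part, which
          -- improves the factor `(N * (N - 1))⁻¹` to `(N ^ 2)⁻¹`. For `N = 1` the former is zero by
          -- convention.
          have h1 : (∑ l ∈ Aᶜ, excess V (b l) v) ^ 2 ≤ N * ∑ l ∈ Aᶜ, excess V (b l) v ^ 2 :=
            sq_sum_le_card_mul_sum_sq
          rcases hN1.eq_or_lt with h2 | h2
          · rw [← h2]; simp; positivity
          rw [← div_eq_inv_mul, ← div_eq_inv_mul, div_le_div_iff₀ (by nlinarith) (by nlinarith)]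
          nlinarith
      _ ≤ (N ^ 2)⁻¹ * ∑ v ∈ V, 2 * N *
          ∑ l ∈ Aᶜ, excess V (b l) v ^ 2 / (1 + excess V (b l) v) :=
          mul_le_mul_of_nonneg_left (Finset.sum_le_sum
            fun v hv => sq_sum_excess_le hb hv (hds v hv))
            (by positivity)
      _ = _ := by
          rw [← Finset.mul_sum, Finset.sum_comm]
          field_simp
  calc _ ≤ meanOn (coset A ρ) (fun σ => 4 * ∑ l ∈ Aᶜ, O l (σ l) +
        2 * ∑ m ∈ Aᶜ, ∑ l ∈ Aᶜ.erase m, ∑ l' ∈ (Aᶜ.erase m).erase l,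
          p l (σ l) (σ m) * p l' (σ l') (σ m)) := meanOn_mono hpt
    _ ≤ 4 * ∑ l ∈ Aᶜ, N⁻¹ * ∑ v ∈ V, O l v +
        2 * (2 * N⁻¹ * ∑ l ∈ Aᶜ, ∑ v ∈ V, excess V (b l) v ^ 2 / (1 + excess V (b l) v)) := by
        rw [meanOn_add, meanOn_mul_left, meanOn_mul_left, meanOn_sum]
        refine add_le_add (le_of_eq ?_) (mul_le_mul_of_nonneg_left hcorr (by norm_num))
        congr 1
        refine Finset.sum_congr rfl fun l hl => ?_
        rw [meanOn_coset_eval hl, meanOn, ← hV, hcard]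
    _ = 2 * N⁻¹ * ∑ l ∈ Aᶜ, ∑ v ∈ V,
        (2 * O l v + 2 * (excess V (b l) v ^ 2 / (1 + excess V (b l) v))) := by
        simp only [Finset.sum_add_distrib, ← Finset.mul_sum]
        ring
    _ ≤ 2 * N⁻¹ * ∑ l ∈ Aᶜ, ∑ v ∈ V, 4 * klFun (V.card * b l v) :=
        mul_le_mul_of_nonneg_left (Finset.sum_le_sum fun l hl => Finset.sum_le_sum fun v hv =>
          stayMass_sq_add_excess_le (hb l hl) hv) (by positivity)
    _ = _ := by
        rw [Finset.mul_sum, Finset.mul_sum]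
        refine Finset.sum_congr rfl fun l hl => ?_
        rw [entOn_eq_klFun (hb l hl), ← Finset.mul_sum, hcard]
        ring

end Displacement

/-! ### Marginals and conditional laws of uniform weights. -/

section Uniform

variable {X Y : Type*} [DecidableEq Y] {s : Finset X} {V : Finset Y} {φ : X → Y} {T : Y → X → X}
  {ν ν' : X → ℝ}

theorem margOn_congr (h : ∀ x ∈ s, ν x = ν' x) (i : Y) : margOn s φ ν i = margOn s φ ν' i :=
  Finset.sum_congr rfl fun x hx => h x (mem_fiberOn.1 hx).1

theorem IsTwisted.margOn_of_unif (h : IsTwisted s V φ T) (hs : s.Nonempty)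
    (hν : ∀ x ∈ s, ν x = unifOn s x) {i : Y} (hi : i ∈ V) : margOn s φ ν i = unifOn V i := by
  rw [margOn_congr hν, h.margOn_unifOn hi hs]

theorem IsTwisted.condOn_of_unif (h : IsTwisted s V φ T) (hs : s.Nonempty)
    (hν : ∀ x ∈ s, ν x = unifOn s x) {i : Y} (hi : i ∈ V) {x : X} (hx : x ∈ fiberOn s φ i) :
    condOn s φ ν i x = unifOn (fiberOn s φ i) x := by
  rw [← h.condOn_unifOn hi hs, condOn, condOn, margOn_congr hν, hν x (mem_fiberOn.1 hx).1]

theorem IsTwisted.condOn_twist_of_unif (h : IsTwisted s V φ T) (hs : s.Nonempty)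
    (hν : ∀ x ∈ s, ν x = unifOn s x) {i j : Y} (hi : i ∈ V) (hj : j ∈ V) {x : X}
    (hx : x ∈ fiberOn s φ i) : condOn s φ ν j (T j x) = unifOn (fiberOn s φ i) x := by
  have hx' := mem_fiberOn.1 hx
  rw [h.condOn_of_unif hs hν hj
    (mem_fiberOn.2 ⟨h.twist_mem x hx'.1 j hj, h.map_twist x hx'.1 j hj⟩), unifOn, unifOn,
    h.card_fiberOn_eq hj hi]

/-- The kernel given by the independent coupling. -/
theorem IsProbOn.exists_indep {ν₁ ν₂ : X → ℝ} (h₁ : IsProbOn s ν₁) (h₂ : IsProbOn s ν₂) :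
    IsKernelOn s (fun _ => ν₂) ∧ Pushes s (fun _ => ν₂) ν₁ ν₂ :=
  ⟨⟨fun _ _ => h₂.nonneg, fun _ _ => h₂.sum_eq⟩, fun y _ => by
    rw [← Finset.sum_mul, h₁.sum_eq, one_mul]⟩

end Uniform

/-! ### The coordinatewise weak cost on permutations. -/

section Hat

variable {α : Type*} [DecidableEq α]

/-- The indicator that two permutations differ at `m`. -/
def differAt (m : α) (σ τ : Equiv.Perm α) : ℝ := if σ m = τ m then 0 else 1

theorem differAt_nonneg (m : α) (σ τ : Equiv.Perm α) : 0 ≤ differAt m σ τ := by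
  unfold differAt; split_ifs <;> norm_num

theorem differAt_triangle (m : α) (σ τ υ : Equiv.Perm α) :
    differAt m σ υ ≤ differAt m σ τ + differAt m τ υ := by
  unfold differAt
  by_cases h1 : σ m = τ m
  · simp [h1]
  · rw [if_neg h1]; split_ifs <;> norm_num

variable [Fintype α] {A : Finset α} {ρ : Equiv.Perm α} {ν₁ ν₂ : Equiv.Perm α → ℝ}

/-- The kernel depends on which law is uniform: total variation coupling out of a uniform source,
flow into a uniform target. -/
theorem exists_evalKernels (h₁ : IsProbOn (coset A ρ) ν₁) (h₂ : IsProbOn (coset A ρ) ν₂)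
    (hu : (∀ σ ∈ coset A ρ, ν₁ σ = unifOn (coset A ρ) σ) ∨
      ∀ σ ∈ coset A ρ, ν₂ σ = unifOn (coset A ρ) σ) :
    ∃ p : α → α → α → ℝ, (∀ l ∈ Aᶜ, IsKernelOn (freeValues A ρ) (p l)) ∧
      (∀ l ∈ Aᶜ, Pushes (freeValues A ρ) (p l) (evalLaw A ρ ν₁ l) (evalLaw A ρ ν₂ l)) ∧
      ∑ σ ∈ coset A ρ, ν₁ σ * ∑ m ∈ Aᶜ, displacement A p σ m ^ 2 ≤
        8 * ∑ l ∈ Aᶜ, (entOn (freeValues A ρ) (evalLaw A ρ ν₁ l) +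
          entOn (freeValues A ρ) (evalLaw A ρ ν₂ l)) := by
  rcases hu with hu | hu
  · have hm : ∀ l ∈ Aᶜ, ∀ v ∈ freeValues A ρ, evalLaw A ρ ν₁ l v = unifOn (freeValues A ρ) v :=
      fun l hl v hv => (isTwisted_coset hl).margOn_of_unif coset_nonempty hu hv
    have hpr : ∀ l ∈ Aᶜ, IsProbOn (freeValues A ρ) (unifOn (freeValues A ρ)) := fun l hl =>
      isProbOn_unifOn (h₂.evalLaw hl).nonempty
    refine ⟨fun l => tvKernel (freeValues A ρ) (unifOn (freeValues A ρ)) (evalLaw A ρ ν₂ l),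
      fun l hl => isKernelOn_tv (hpr l hl) (h₂.evalLaw hl), fun l hl v hv => ?_, ?_⟩
    · rw [← pushes_tv (hpr l hl) (h₂.evalLaw hl) v hv]
      exact Finset.sum_congr rfl fun i hi => by rw [hm l hl i hi]
    · rw [Finset.sum_congr rfl fun σ hσ => by rw [hu σ hσ], sum_unifOn_mul]
      refine (meanOn_displacement_tv_le (fun l hl => h₂.evalLaw hl)
        fun v hv => sum_margOn_coset h₂ hv).trans_eq ?_
      congr 1
      exact Finset.sum_congr rfl fun l hl => by rw [entOn_eq_zero (hm l hl), zero_add]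
  · have hm : ∀ l ∈ Aᶜ, ∀ v ∈ freeValues A ρ, evalLaw A ρ ν₂ l v = unifOn (freeValues A ρ) v :=
      fun l hl v hv => (isTwisted_coset hl).margOn_of_unif coset_nonempty hu hv
    refine ⟨fun l => flowKernel (freeValues A ρ) (evalLaw A ρ ν₁ l),
      fun l hl => isKernelOn_flow (h₁.evalLaw hl), fun l hl v hv => ?_, ?_⟩
    · rw [hm l hl v hv, ← pushes_flow (h₁.evalLaw hl) v hv]
    · refine (displacement_flow_le h₁).trans_eq ?_
      congr 1
      exact Finset.sum_congr rfl fun l hl => by rw [entOn_eq_zero (hm l hl), add_zero]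

theorem sum_step_differAt_self {p : α → α → ℝ} {P : α → α → Equiv.Perm α → Equiv.Perm α → ℝ}
    {m : α} (hm : m ∈ Aᶜ) (hp : IsKernelOn (freeValues A ρ) p)
    (hP : ∀ i ∈ freeValues A ρ, ∀ j ∈ freeValues A ρ,
      IsKernelOn (fiberOn (coset A ρ) (fun σ => σ m) i) (P i j))
    {σ : Equiv.Perm α} (hσ : σ ∈ coset A ρ) :
    ∑ τ ∈ coset A ρ, stepKernel (fun σ => σ m) (swapTo m) p P σ τ * differAt m σ τ =
      1 - p (σ m) (σ m) := by
  have hT := isTwisted_coset (ρ := ρ) hm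
  have hv := hT.map_mem σ hσ
  rw [hT.sum_stepKernel hσ, ← hp.sum_erase hv, ← Finset.add_sum_erase _ _ hv]
  have h1 : ∀ j ∈ freeValues A ρ, ∑ y ∈ fiberOn (coset A ρ) (fun σ => σ m) (σ m),
      P (σ m) j σ y * differAt m σ (swapTo m j y) = if σ m = j then 0 else 1 := by
    intro j hj
    have h2 : (if σ m = j then (0 : ℝ) else 1) = ∑ y ∈ fiberOn (coset A ρ) (fun σ => σ m) (σ m),
        P (σ m) j σ y * if σ m = j then 0 else 1 := by
      rw [← Finset.sum_mul, (hP _ hv _ hj).sum_eq σ (mem_fiberOn.2 ⟨hσ, rfl⟩), one_mul]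
    rw [h2]
    refine Finset.sum_congr rfl fun y hy => ?_
    rw [differAt, hT.map_twist y (mem_fiberOn.1 hy).1 j hj]
  rw [h1 _ hv, if_pos rfl, mul_zero, zero_add]
  refine Finset.sum_congr rfl fun j hj => ?_
  rw [h1 j (Finset.mem_of_mem_erase hj), if_neg (Finset.ne_of_mem_erase hj).symm, mul_one]

/-- The final transposition acts on a permutation `y` with `y l = σ l`, and alters only position `l`
and the position where `y` takes the value `j`. Hence for `m ≠ l` a change at `m` comes either from
the motion inside the fibre or from `j = σ m`. -/
theorem sum_step_differAt_le {p : α → α → ℝ} {P : α → α → Equiv.Perm α → Equiv.Perm α → ℝ}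
    {l m : α} (hm : m ∈ Aᶜ) (hl : l ∈ Aᶜ) (hlm : l ≠ m) (hp : IsKernelOn (freeValues A ρ) p)
    (hP : ∀ i ∈ freeValues A ρ, ∀ j ∈ freeValues A ρ,
      IsKernelOn (fiberOn (coset A ρ) (fun σ => σ l) i) (P i j))
    {σ : Equiv.Perm α} (hσ : σ ∈ coset A ρ) :
    ∑ τ ∈ coset A ρ, stepKernel (fun σ => σ l) (swapTo l) p P σ τ * differAt m σ τ ≤
      ∑ j ∈ freeValues A ρ, p (σ l) j * ∑ y ∈ fiberOn (coset A ρ) (fun σ => σ l) (σ l),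
        P (σ l) j σ y * differAt m σ y + p (σ l) (σ m) := by
  have hT := isTwisted_coset (ρ := ρ) hl
  have hv := hT.map_mem σ hσ
  have hvm : σ m ∈ freeValues A ρ := (apply_mem_freeValues hσ).2 hm
  have h0 : p (σ l) (σ m) = ∑ j ∈ freeValues A ρ, p (σ l) j * if j = σ m then 1 else 0 := by
    simp [hvm]
  rw [hT.sum_stepKernel hσ, h0, ← Finset.sum_add_distrib]
  refine Finset.sum_le_sum fun j hj => ?_
  rw [← mul_add]
  refine mul_le_mul_of_nonneg_left ?_ (hp.nonneg _ hv j hj)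
  have hK := hP _ hv _ hj
  have hmem : σ ∈ fiberOn (coset A ρ) (fun σ => σ l) (σ l) := mem_fiberOn.2 ⟨hσ, rfl⟩
  have hind : (if j = σ m then (1 : ℝ) else 0) = ∑ y ∈ fiberOn (coset A ρ) (fun σ => σ l) (σ l),
      P (σ l) j σ y * if j = σ m then 1 else 0 := by
    rw [← Finset.sum_mul, hK.sum_eq σ hmem, one_mul]
  rw [hind, ← Finset.sum_add_distrib]
  refine Finset.sum_le_sum fun y hy => ?_
  rw [← mul_add]
  refine mul_le_mul_of_nonneg_left ?_ (hK.nonneg σ hmem y hy)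
  have hyl : y l = σ l := (mem_fiberOn.1 hy).2
  by_cases hj' : j = σ m
  · rw [if_pos hj']
    have := differAt_nonneg m σ y
    unfold differAt at this ⊢
    split_ifs at this ⊢ <;> linarith
  · rw [if_neg hj', add_zero]
    by_cases h : σ m = y m
    · have : swapTo l j y m = σ m := by
        rw [swapTo, Equiv.Perm.mul_apply, Equiv.swap_apply_of_ne_of_ne, h]
        · exact fun h => hlm (y.injective h).symm
        · rw [← h]; exact fun h => hj' h.symm
      rw [differAt, this, if_pos rfl]
      exact differAt_nonneg m σ y
    · rw [differAt, differAt, if_neg h]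
      split_ifs <;> norm_num

theorem sq_sum_erase_add_le {ι : Type*} [DecidableEq ι] {s : Finset ι} {m : ι} (hm : m ∈ s)
    (f : ι → ℝ) (t : ℝ) :
    (∑ l ∈ s.erase m, f l + t) ^ 2 ≤ s.card * (∑ l ∈ s.erase m, f l ^ 2 + t ^ 2) := by
  have h := sq_sum_le_card_mul_sum_sq (s := s) (f := fun l => if l = m then t else f l)
  have hf : ∀ l ∈ s.erase m, (if l = m then t else f l) = f l := fun l hl =>
    if_neg (Finset.ne_of_mem_erase hl)
  have hf2 : ∑ l ∈ s.erase m, (if l = m then t else f l) ^ 2 = ∑ l ∈ s.erase m, f l ^ 2 :=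
    Finset.sum_congr rfl fun l hl => by rw [hf l hl]
  rwa [← Finset.sum_erase_add s _ hm, ← Finset.sum_erase_add s _ hm, if_pos rfl,
    Finset.sum_congr rfl hf, hf2] at h

/-- The kernel is the average over free `l` of the one-step kernels revealing `l` first. At position
`m`, the runs with `l ≠ m` contribute their conditional displacements, and everything caused by the
moved values gathers into a single further term, `displacement`. These are `Aᶜ.card` terms with
prefactor `Aᶜ.card⁻¹`, so Cauchy–Schwarz loses nothing in the constant, and the chain rule for each
`l` restores the full entropy. -/
theorem exists_kernel_differAt (N : ℕ) : ∀ (A : Finset α) (ρ : Equiv.Perm α)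
    (ν₁ ν₂ : Equiv.Perm α → ℝ), Aᶜ.card = N → IsProbOn (coset A ρ) ν₁ → IsProbOn (coset A ρ) ν₂ →
    ((∀ σ ∈ coset A ρ, ν₁ σ = unifOn (coset A ρ) σ) ∨
      ∀ σ ∈ coset A ρ, ν₂ σ = unifOn (coset A ρ) σ) →
    ∃ P, IsKernelOn (coset A ρ) P ∧ Pushes (coset A ρ) P ν₁ ν₂ ∧
      weakCostOn (coset A ρ) Aᶜ differAt ν₁ P ≤
        8 * (entOn (coset A ρ) ν₁ + entOn (coset A ρ) ν₂) := by
  induction N with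
  | zero =>
    intro A ρ ν₁ ν₂ hN h₁ h₂ _
    refine ⟨_, (h₁.exists_indep h₂).1, (h₁.exists_indep h₂).2, ?_⟩
    rw [Finset.card_eq_zero] at hN
    have := entOn_nonneg h₁
    have := entOn_nonneg h₂
    simp only [weakCostOn, hN, Finset.sum_empty, mul_zero, Finset.sum_const_zero]
    positivity
  | succ N ih =>
    intro A ρ ν₁ ν₂ hN h₁ h₂ hu
    set C := coset A ρ with hC
    set V := freeValues A ρ with hV
    have hB : Aᶜ.Nonempty := Finset.card_pos.1 (by omega)
    have hT : ∀ l ∈ Aᶜ, IsTwisted C V (fun σ => σ l) (swapTo l) := fun l hl => isTwisted_coset hl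
    obtain ⟨p, hpk, hpp, hpd⟩ := exists_evalKernels h₁ h₂ hu
    let c₁ : α → α → Equiv.Perm α → ℝ := fun l => condOn C (fun σ => σ l) ν₁
    let c₂ : α → α → Equiv.Perm α → ℝ := fun l => condOn C (fun σ => σ l) ν₂
    let F : α → α → Finset (Equiv.Perm α) := fun l => fiberOn C (fun σ => σ l)
    -- Outside the relevant indices a dummy is supplied, and over null values, where the conditional
    -- laws are not probabilities, any Markov kernel; `choose` then gives a total family. The target
    -- conditional law is pulled back by the twist so that both laws live on one smaller coset.
    have hsub : ∀ l i j, ∃ P, l ∈ Aᶜ → i ∈ V → j ∈ V → IsKernelOn (F l i) P ∧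
        (evalLaw A ρ ν₁ l i ≠ 0 → evalLaw A ρ ν₂ l j ≠ 0 →
          Pushes (F l i) P (c₁ l i) (fun y => c₂ l j (swapTo l j y)) ∧
          weakCostOn (F l i) (Aᶜ.erase l) differAt (c₁ l i) P ≤
            8 * entOn (F l i) (c₁ l i) + 8 * entOn (F l j) (c₂ l j)) := by
      intro l i j
      by_cases hlij : l ∈ Aᶜ ∧ i ∈ V ∧ j ∈ V
      swap
      · exact ⟨fun _ _ => 0, fun h1 h2 h3 => absurd ⟨h1, h2, h3⟩ hlij⟩
      obtain ⟨hl, hi, hj⟩ := hlij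
      by_cases h0 : evalLaw A ρ ν₁ l i ≠ 0 ∧ evalLaw A ρ ν₂ l j ≠ 0
      swap
      · obtain ⟨P, hP⟩ := exists_isKernelOn (F l i)
        exact ⟨P, fun _ _ _ => ⟨hP, fun h1 h2 => absurd ⟨h1, h2⟩ h0⟩⟩
      have hF : F l i = coset (insert l A) (swapTo l i ρ) := fiberOn_coset hl hi
      have hp1 : IsProbOn (F l i) (c₁ l i) := h₁.cond h0.1
      have hp2 : IsProbOn (F l i) (fun y => c₂ l j (swapTo l j y)) :=
        (hT l hl).isProbOn_twist hi hj (h₂.cond h0.2)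
      have hun : (∀ σ ∈ F l i, c₁ l i σ = unifOn (F l i) σ) ∨
          ∀ σ ∈ F l i, c₂ l j (swapTo l j σ) = unifOn (F l i) σ := by
        rcases hu with hu | hu
        · exact Or.inl fun σ hσ => (hT l hl).condOn_of_unif coset_nonempty hu hi hσ
        · exact Or.inr fun σ hσ => (hT l hl).condOn_twist_of_unif coset_nonempty hu hi hj hσ
      have hent : entOn (F l i) (fun y => c₂ l j (swapTo l j y)) = entOn (F l j) (c₂ l j) :=
        (hT l hl).entOn_twist hi hj _
      rw [← hent, ← mul_add, ← compl_insert_eq_erase]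
      rw [hF] at hp1 hp2 hun ⊢
      obtain ⟨P, hP1, hP2, hP3⟩ := ih (insert l A) (swapTo l i ρ) _ _
        (by rw [compl_insert_eq_erase, Finset.card_erase_of_mem hl, hN, Nat.add_sub_cancel])
        hp1 hp2 hun
      exact ⟨P, fun _ _ _ => ⟨hP1, fun _ _ => ⟨hP2, hP3⟩⟩⟩
    choose P hP using hsub
    have hPk : ∀ l ∈ Aᶜ, ∀ i ∈ V, ∀ j ∈ V, IsKernelOn (F l i) (P l i j) :=
      fun l hl i hi j hj => (hP l i j hl hi hj).1
    let S : α → Equiv.Perm α → Equiv.Perm α → ℝ := fun l =>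
      stepKernel (fun σ => σ l) (swapTo l) (p l) (P l)
    have hSk : ∀ l ∈ Aᶜ, IsKernelOn C (S l) := fun l hl =>
      (hT l hl).isKernelOn_step (hpk l hl) (hPk l hl)
    have hSp : ∀ l ∈ Aᶜ, Pushes C (S l) ν₁ ν₂ := fun l hl =>
      (hT l hl).pushes_step h₁ h₂ (hpk l hl) (hpp l hl)
        fun i hi j hj ha hb => ((hP l i j hl hi hj).2 ha hb).1
    have hAk := isKernelOn_avg hB hSk
    refine ⟨avgKernel Aᶜ S, hAk, pushes_avg hB hSp, ?_⟩
    have hn : (0 : ℝ) < Aᶜ.card := by exact_mod_cast hB.card_pos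
    let c : α → α → α → α → Equiv.Perm α → ℝ := fun l i j m σ =>
      ∑ y ∈ F l i, P l i j σ y * differAt m σ y
    have hpt : ∀ σ ∈ C, ∀ m ∈ Aᶜ, (∑ τ ∈ C, avgKernel Aᶜ S σ τ * differAt m σ τ) ^ 2 ≤
        (Aᶜ.card : ℝ)⁻¹ * (∑ l ∈ Aᶜ.erase m, ∑ j ∈ V, p l (σ l) j * c l (σ l) j m σ ^ 2 +
          displacement A p σ m ^ 2) := by
      intro σ hσ m hm
      have hle : ∑ τ ∈ C, avgKernel Aᶜ S σ τ * differAt m σ τ ≤ (Aᶜ.card : ℝ)⁻¹ *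
          (∑ l ∈ Aᶜ.erase m, ∑ j ∈ V, p l (σ l) j * c l (σ l) j m σ + displacement A p σ m) := by
        rw [sum_avgKernel]
        refine mul_le_mul_of_nonneg_left ?_ (inv_nonneg.2 hn.le)
        rw [← Finset.sum_erase_add _ _ hm, displacement,
          sum_step_differAt_self hm (hpk m hm) (hPk m hm) hσ]
        have h1 := Finset.sum_le_sum fun l (hl : l ∈ Aᶜ.erase m) =>
          sum_step_differAt_le hm (Finset.mem_of_mem_erase hl) (Finset.ne_of_mem_erase hl)
            (hpk l (Finset.mem_of_mem_erase hl)) (hPk l (Finset.mem_of_mem_erase hl)) hσ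
        rw [Finset.sum_add_distrib] at h1
        linarith
      refine (pow_le_pow_left₀ (Finset.sum_nonneg fun τ hτ => mul_nonneg (hAk.nonneg σ hσ τ hτ)
        (differAt_nonneg m σ τ)) hle 2).trans ?_
      rw [mul_pow, sq (Aᶜ.card : ℝ)⁻¹, mul_assoc]
      refine mul_le_mul_of_nonneg_left ?_ (inv_nonneg.2 hn.le)
      rw [inv_mul_le_iff₀ hn]
      refine (sq_sum_erase_add_le hm _ _).trans ?_
      gcongr with l hl
      have hl' := Finset.mem_of_mem_erase hl
      have hv := (hT l hl').map_mem σ hσ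
      exact sq_sum_mul_le ((hpk l hl').nonneg _ hv) ((hpk l hl').sum_eq _ hv).le
    -- For fixed `l`, the positions `m ≠ l` are the free positions of the smaller coset, so the
    -- inner sum becomes its weak cost.
    have hcomm : ∀ σ, ∑ m ∈ Aᶜ, ∑ l ∈ Aᶜ.erase m, ∑ j ∈ V, p l (σ l) j * c l (σ l) j m σ ^ 2 =
        ∑ l ∈ Aᶜ, ∑ j ∈ V, p l (σ l) j * ∑ m ∈ Aᶜ.erase l, c l (σ l) j m σ ^ 2 := by
      intro σ
      rw [Finset.sum_comm' (t' := Aᶜ) (s' := fun l => Aᶜ.erase l)]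
      · refine Finset.sum_congr rfl fun l _ => ?_
        rw [Finset.sum_comm]
        simp only [Finset.mul_sum]
      · intro x y
        simp only [Finset.mem_erase, ne_comm]
        tauto
    calc weakCostOn C Aᶜ differAt ν₁ (avgKernel Aᶜ S)
        ≤ ∑ σ ∈ C, ν₁ σ * ((Aᶜ.card : ℝ)⁻¹ *
          (∑ l ∈ Aᶜ, ∑ j ∈ V, p l (σ l) j * ∑ m ∈ Aᶜ.erase l, c l (σ l) j m σ ^ 2 +
            ∑ m ∈ Aᶜ, displacement A p σ m ^ 2)) := by
          refine Finset.sum_le_sum fun σ hσ => mul_le_mul_of_nonneg_left ?_ (h₁.nonneg σ hσ)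
          refine (Finset.sum_le_sum (hpt σ hσ)).trans_eq ?_
          rw [← Finset.mul_sum, Finset.sum_add_distrib, hcomm]
      _ = (Aᶜ.card : ℝ)⁻¹ * (∑ l ∈ Aᶜ, ∑ σ ∈ C, ν₁ σ *
            ∑ j ∈ V, p l (σ l) j * ∑ m ∈ Aᶜ.erase l, c l (σ l) j m σ ^ 2 +
            ∑ σ ∈ C, ν₁ σ * ∑ m ∈ Aᶜ, displacement A p σ m ^ 2) := by
          rw [Finset.sum_comm, ← Finset.sum_add_distrib, Finset.mul_sum]
          refine Finset.sum_congr rfl fun σ _ => ?_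
          rw [← Finset.mul_sum]
          ring
      _ ≤ (Aᶜ.card : ℝ)⁻¹ * (∑ l ∈ Aᶜ,
            (∑ i ∈ V, evalLaw A ρ ν₁ l i * (8 * entOn (F l i) (c₁ l i)) +
              ∑ j ∈ V, evalLaw A ρ ν₂ l j * (8 * entOn (F l j) (c₂ l j))) +
            8 * ∑ l ∈ Aᶜ, (entOn V (evalLaw A ρ ν₁ l) + entOn V (evalLaw A ρ ν₂ l))) := by
          refine mul_le_mul_of_nonneg_left (add_le_add (Finset.sum_le_sum fun l hl => ?_) hpd)
            (inv_nonneg.2 hn.le)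
          exact (hT l hl).sum_step_le h₁ (hpk l hl) (hpp l hl)
            (G := fun i j σ => ∑ m ∈ Aᶜ.erase l, c l i j m σ ^ 2)
            fun i hi j hj ha hb => ((hP l i j hl hi hj).2 ha hb).2
      _ = (Aᶜ.card : ℝ)⁻¹ * ∑ l ∈ Aᶜ, 8 * (entOn C ν₁ + entOn C ν₂) := by
          rw [Finset.mul_sum (a := (8 : ℝ)), ← Finset.sum_add_distrib]
          congr 1
          refine Finset.sum_congr rfl fun l hl => ?_
          rw [(hT l hl).entOn_eq h₁, (hT l hl).entOn_eq h₂]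
          simp only [mul_left_comm _ (8 : ℝ), ← Finset.mul_sum]
          ring
      _ = _ := by
          rw [Finset.sum_const, nsmul_eq_mul]
          field_simp

end Hat

/-! ### The cost counting displaced points of the image of a set. -/

section Image

variable {α : Type*} [DecidableEq α]

/-- The number of points of the image of `K` under `σ` that are not in its image under `τ`. -/
def imageDist (K : Finset α) (σ τ : Equiv.Perm α) : ℝ :=
  ((K.map σ.toEmbedding \ K.map τ.toEmbedding).card : ℝ)

theorem imageDist_nonneg (K : Finset α) (σ τ : Equiv.Perm α) : 0 ≤ imageDist K σ τ :=
  Nat.cast_nonneg _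

theorem imageDist_triangle (K : Finset α) (σ τ υ : Equiv.Perm α) :
    imageDist K σ υ ≤ imageDist K σ τ + imageDist K τ υ := by
  unfold imageDist
  have h : K.map σ.toEmbedding \ K.map υ.toEmbedding ⊆
      (K.map σ.toEmbedding \ K.map τ.toEmbedding) ∪ (K.map τ.toEmbedding \ K.map υ.toEmbedding) :=
    sdiff_triangle _ _ _
  exact_mod_cast (Finset.card_le_card h).trans (Finset.card_union_le _ _)

/-- The transposition replaces `σ l` by `j` in the image of `K`, or leaves the image unchanged if
`j` already belongs to it. Unlike for `differAt`, the disturbed second position costs nothing extra.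
-/
theorem imageDist_swapTo_le {K : Finset α} {l : α} (hl : l ∈ K) (j : α) (σ : Equiv.Perm α) :
    imageDist K σ (swapTo l j σ) ≤ if σ l = j then 0 else 1 := by
  unfold imageDist
  split_ifs with h
  · have : swapTo l j σ = σ := by rw [swapTo, h, Equiv.swap_self]; rfl
    simp [this]
  · have : K.map σ.toEmbedding \ K.map (swapTo l j σ).toEmbedding ⊆ {σ l} := by
      intro v hv
      rw [Finset.mem_sdiff, Finset.mem_map, Finset.mem_map] at hv
      obtain ⟨⟨a, ha, rfl⟩, hv⟩ := hv
      rw [Finset.mem_singleton]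
      by_contra hne
      by_cases hj : σ a = j
      · exact hv ⟨l, hl, by simp [swapTo, hj]⟩
      · refine hv ⟨a, ha, ?_⟩
        simp only [Equiv.toEmbedding_apply, swapTo, Equiv.Perm.mul_apply]
        exact Equiv.swap_apply_of_ne_of_ne hne hj
    exact_mod_cast Finset.card_le_card this

/-- Cauchy–Schwarz for one new step against `c` earlier ones, without division, so that `c = 0` is
included. -/
theorem add_sq_le_of_sq_le {x r u w c : ℝ} (hc : 0 ≤ c) (hu : 0 ≤ u) (hw : 0 ≤ w)
    (hx : x ^ 2 ≤ u) (hr : r ^ 2 ≤ c * w) : (x + r) ^ 2 ≤ (c + 1) * (u + w) := by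
  have h1 : 2 * (x * r) ≤ c * u + w := by
    refine abs_le_of_sq_le_sq' ?_ (by positivity) |>.2
    have h2 : x ^ 2 * r ^ 2 ≤ u * (c * w) := mul_le_mul hx hr (sq_nonneg _) hu
    nlinarith [sq_nonneg (c * u - w)]
  nlinarith

variable [Fintype α] {A : Finset α} {ρ : Equiv.Perm α} {ν₁ ν₂ : Equiv.Perm α → ℝ}

theorem sum_step_imageDist_le {K : Finset α} {p : α → α → ℝ}
    {P : α → α → Equiv.Perm α → Equiv.Perm α → ℝ}
    {l : α} (hK : l ∈ K) (hl : l ∈ Aᶜ) (hp : IsKernelOn (freeValues A ρ) p)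
    (hP : ∀ i ∈ freeValues A ρ, ∀ j ∈ freeValues A ρ,
      IsKernelOn (fiberOn (coset A ρ) (fun σ => σ l) i) (P i j))
    {σ : Equiv.Perm α} (hσ : σ ∈ coset A ρ) :
    ∑ τ ∈ coset A ρ, stepKernel (fun σ => σ l) (swapTo l) p P σ τ * imageDist K σ τ ≤
      (1 - p (σ l) (σ l)) + ∑ j ∈ freeValues A ρ, p (σ l) j *
        ∑ y ∈ fiberOn (coset A ρ) (fun σ => σ l) (σ l), P (σ l) j σ y * imageDist K σ y := by
  have hT := isTwisted_coset (ρ := ρ) hl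
  have hv := hT.map_mem σ hσ
  have h0 : 1 - p (σ l) (σ l) = ∑ j ∈ freeValues A ρ, p (σ l) j * if σ l = j then 0 else 1 := by
    rw [← hp.sum_erase hv, ← Finset.add_sum_erase _ _ hv, if_pos rfl, mul_zero, zero_add]
    exact Finset.sum_congr rfl fun j hj => by
      rw [if_neg (Finset.ne_of_mem_erase hj).symm, mul_one]
  rw [hT.sum_stepKernel hσ, h0, ← Finset.sum_add_distrib]
  refine Finset.sum_le_sum fun j hj => ?_
  rw [← mul_add]
  refine mul_le_mul_of_nonneg_left ?_ (hp.nonneg _ hv j hj)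
  have hk := hP _ hv _ hj
  have hmem : σ ∈ fiberOn (coset A ρ) (fun σ => σ l) (σ l) := mem_fiberOn.2 ⟨hσ, rfl⟩
  have hind : (if σ l = j then (0 : ℝ) else 1) = ∑ y ∈ fiberOn (coset A ρ) (fun σ => σ l) (σ l),
      P (σ l) j σ y * if σ l = j then 0 else 1 := by
    rw [← Finset.sum_mul, hk.sum_eq σ hmem, one_mul]
  rw [hind, ← Finset.sum_add_distrib]
  refine Finset.sum_le_sum fun y hy => ?_
  rw [← mul_add]
  refine mul_le_mul_of_nonneg_left ?_ (hk.nonneg σ hmem y hy)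
  have h1 := imageDist_triangle K σ y (swapTo l j y)
  have h2 := imageDist_swapTo_le hK j y
  have hyl : y l = σ l := (mem_fiberOn.1 hy).2
  rw [hyl] at h2
  linarith

/-- Only the points of `K` need revealing: once `K ⊆ A`, all permutations in the coset have the same
image of `K`. Each step uses the total variation coupling, paid by Pinsker for the linear cost and
by Marton for the weak cost, and one kernel serves both. -/
theorem exists_kernel_imageDist (K : Finset α) (c : ℕ) : ∀ (A : Finset α) (ρ : Equiv.Perm α)
    (ν₁ ν₂ : Equiv.Perm α → ℝ), (K \ A).card = c → IsProbOn (coset A ρ) ν₁ →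
    IsProbOn (coset A ρ) ν₂ →
    ((∀ σ ∈ coset A ρ, ν₁ σ = unifOn (coset A ρ) σ) ∨
      ∀ σ ∈ coset A ρ, ν₂ σ = unifOn (coset A ρ) σ) →
    ∃ P, IsKernelOn (coset A ρ) P ∧ Pushes (coset A ρ) P ν₁ ν₂ ∧
      linCostOn (coset A ρ) (imageDist K) ν₁ P ^ 2 ≤
        c * (1 / 2 * (entOn (coset A ρ) ν₁ + entOn (coset A ρ) ν₂)) ∧
      weakCostOn (coset A ρ) (Finset.univ : Finset Unit) (fun _ => imageDist K) ν₁ P ≤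
        c * (2 * (entOn (coset A ρ) ν₁ + entOn (coset A ρ) ν₂)) := by
  induction c with
  | zero =>
    intro A ρ ν₁ ν₂ hc h₁ h₂ _
    refine ⟨_, (h₁.exists_indep h₂).1, (h₁.exists_indep h₂).2, ?_⟩
    have hKA : K ⊆ A := by rwa [Finset.card_eq_zero, Finset.sdiff_eq_empty_iff_subset] at hc
    have h0 : ∀ σ ∈ coset A ρ, ∑ τ ∈ coset A ρ, ν₂ τ * imageDist K σ τ = 0 := by
      intro σ hσ
      refine Finset.sum_eq_zero fun τ hτ => ?_
      have : K.map σ.toEmbedding = K.map τ.toEmbedding := by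
        rw [mem_coset] at hσ hτ
        simp only [Finset.map_eq_image, Equiv.coe_toEmbedding]
        exact Finset.image_congr fun a ha => by
          simp [hσ a (hKA ha), hτ a (hKA ha)]
      simp [imageDist, this]
    constructor
    · rw [linCostOn, Finset.sum_eq_zero fun σ hσ => by rw [h0 σ hσ, mul_zero]]
      simp
    · rw [weakCostOn, Finset.sum_eq_zero fun σ hσ => by
        rw [Finset.sum_congr rfl fun _ _ => by rw [h0 σ hσ]]; simp]
      simp
  | succ c ih =>
    intro A ρ ν₁ ν₂ hc h₁ h₂ hu
    set C := coset A ρ with hC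
    set V := freeValues A ρ with hV
    obtain ⟨l, hlKA⟩ := Finset.card_pos.1 (by omega : 0 < (K \ A).card)
    obtain ⟨hlK, hlA⟩ := Finset.mem_sdiff.1 hlKA
    have hl : l ∈ Aᶜ := Finset.mem_compl.2 hlA
    have hT : IsTwisted C V (fun σ => σ l) (swapTo l) := isTwisted_coset hl
    have ha : IsProbOn V (evalLaw A ρ ν₁ l) := h₁.evalLaw hl
    have hb : IsProbOn V (evalLaw A ρ ν₂ l) := h₂.evalLaw hl
    have hab : (∀ i ∈ V, evalLaw A ρ ν₁ l i = unifOn V i) ∨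
        ∀ i ∈ V, evalLaw A ρ ν₂ l i = unifOn V i := by
      rcases hu with hu | hu
      · exact Or.inl fun i hi => hT.margOn_of_unif coset_nonempty hu hi
      · exact Or.inr fun i hi => hT.margOn_of_unif coset_nonempty hu hi
    set p := tvKernel V (evalLaw A ρ ν₁ l) (evalLaw A ρ ν₂ l) with hp
    have hpk : IsKernelOn V p := isKernelOn_tv ha hb
    have hpp : Pushes V p (evalLaw A ρ ν₁ l) (evalLaw A ρ ν₂ l) := pushes_tv ha hb
    let c₁ : α → Equiv.Perm α → ℝ := condOn C (fun σ => σ l) ν₁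
    let c₂ : α → Equiv.Perm α → ℝ := condOn C (fun σ => σ l) ν₂
    let F : α → Finset (Equiv.Perm α) := fiberOn C (fun σ => σ l)
    have hsub : ∀ i j, ∃ P, i ∈ V → j ∈ V → IsKernelOn (F i) P ∧
        (evalLaw A ρ ν₁ l i ≠ 0 → evalLaw A ρ ν₂ l j ≠ 0 →
          Pushes (F i) P (c₁ i) (fun y => c₂ j (swapTo l j y)) ∧
          linCostOn (F i) (imageDist K) (c₁ i) P ^ 2 ≤
            c * (1 / 2 * entOn (F i) (c₁ i)) + c * (1 / 2 * entOn (F j) (c₂ j)) ∧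
          weakCostOn (F i) (Finset.univ : Finset Unit) (fun _ => imageDist K) (c₁ i) P ≤
            c * (2 * entOn (F i) (c₁ i)) + c * (2 * entOn (F j) (c₂ j))) := by
      intro i j
      by_cases hij : i ∈ V ∧ j ∈ V
      swap
      · exact ⟨fun _ _ => 0, fun h1 h2 => absurd ⟨h1, h2⟩ hij⟩
      obtain ⟨hi, hj⟩ := hij
      by_cases h0 : evalLaw A ρ ν₁ l i ≠ 0 ∧ evalLaw A ρ ν₂ l j ≠ 0
      swap
      · obtain ⟨P, hP⟩ := exists_isKernelOn (F i)
        exact ⟨P, fun _ _ => ⟨hP, fun h1 h2 => absurd ⟨h1, h2⟩ h0⟩⟩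
      have hF : F i = coset (insert l A) (swapTo l i ρ) := fiberOn_coset hl hi
      have hp1 : IsProbOn (F i) (c₁ i) := h₁.cond h0.1
      have hp2 : IsProbOn (F i) (fun y => c₂ j (swapTo l j y)) :=
        hT.isProbOn_twist hi hj (h₂.cond h0.2)
      have hun : (∀ σ ∈ F i, c₁ i σ = unifOn (F i) σ) ∨
          ∀ σ ∈ F i, c₂ j (swapTo l j σ) = unifOn (F i) σ := by
        rcases hu with hu | hu
        · exact Or.inl fun σ hσ => hT.condOn_of_unif coset_nonempty hu hi hσ
        · exact Or.inr fun σ hσ => hT.condOn_twist_of_unif coset_nonempty hu hi hj hσ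
      have hent : entOn (F i) (fun y => c₂ j (swapTo l j y)) = entOn (F j) (c₂ j) :=
        hT.entOn_twist hi hj _
      simp only [← hent, ← mul_add]
      rw [hF] at hp1 hp2 hun ⊢
      obtain ⟨P, hP1, hP2, hP3⟩ := ih (insert l A) (swapTo l i ρ) _ _
        (by rw [Finset.sdiff_insert, Finset.card_erase_of_mem hlKA, hc, Nat.add_sub_cancel])
        hp1 hp2 hun
      exact ⟨P, fun _ _ => ⟨hP1, fun _ _ => ⟨hP2, hP3⟩⟩⟩
    choose P hP using hsub
    have hPk : ∀ i ∈ V, ∀ j ∈ V, IsKernelOn (F i) (P i j) := fun i hi j hj => (hP i j hi hj).1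
    have hSk := hT.isKernelOn_step hpk hPk
    refine ⟨stepKernel (fun σ => σ l) (swapTo l) p P, hSk, hT.pushes_step h₁ h₂ hpk hpp
      fun i hi j hj ha hb => ((hP i j hi hj).2 ha hb).1, ?_⟩
    let own : Equiv.Perm α → ℝ := fun σ => 1 - stayMass (evalLaw A ρ ν₁ l) (evalLaw A ρ ν₂ l) (σ l)
    let G : α → α → Equiv.Perm α → ℝ := fun i j σ => ∑ y ∈ F i, P i j σ y * imageDist K σ y
    let r : Equiv.Perm α → ℝ := fun σ => ∑ j ∈ V, p (σ l) j * G (σ l) j σ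
    have hpt : ∀ σ ∈ C, ∑ τ ∈ C, stepKernel (fun σ => σ l) (swapTo l) p P σ τ * imageDist K σ τ ≤
        own σ + r σ := by
      intro σ hσ
      refine (sum_step_imageDist_le hlK hl hpk hPk hσ).trans_eq ?_
      rw [hp, tvKernel_self]
    have hpt0 : ∀ σ ∈ C, 0 ≤
        ∑ τ ∈ C, stepKernel (fun σ => σ l) (swapTo l) p P σ τ * imageDist K σ τ := fun σ hσ =>
      Finset.sum_nonneg fun τ hτ => mul_nonneg (hSk.nonneg σ hσ τ hτ) (imageDist_nonneg K σ τ)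
    have hown : ∑ σ ∈ C, ν₁ σ * own σ = ∑ i ∈ V, evalLaw A ρ ν₁ l i *
        (1 - stayMass (evalLaw A ρ ν₁ l) (evalLaw A ρ ν₂ l) i) :=
      sum_mul_comp_eval hl fun i => 1 - stayMass (evalLaw A ρ ν₁ l) (evalLaw A ρ ν₂ l) i
    have hown2 : ∑ σ ∈ C, ν₁ σ * own σ ^ 2 = ∑ i ∈ V, evalLaw A ρ ν₁ l i *
        (1 - stayMass (evalLaw A ρ ν₁ l) (evalLaw A ρ ν₂ l) i) ^ 2 :=
      sum_mul_comp_eval hl fun i => (1 - stayMass (evalLaw A ρ ν₁ l) (evalLaw A ρ ν₂ l) i) ^ 2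
    set e₀ := entOn V (evalLaw A ρ ν₁ l) + entOn V (evalLaw A ρ ν₂ l) with he₀
    set e₁ := ∑ i ∈ V, evalLaw A ρ ν₁ l i * entOn (F i) (c₁ i) +
      ∑ j ∈ V, evalLaw A ρ ν₂ l j * entOn (F j) (c₂ j) with he₁
    have he : entOn C ν₁ + entOn C ν₂ = e₀ + e₁ := by
      rw [hT.entOn_eq h₁, hT.entOn_eq h₂, he₀, he₁]
      ring
    have he₀0 : 0 ≤ e₀ := add_nonneg (entOn_nonneg ha) (entOn_nonneg hb)
    have hsum0 : ∀ {ν : Equiv.Perm α → ℝ}, IsProbOn C ν → 0 ≤ ∑ i ∈ V, evalLaw A ρ ν l i *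
        entOn (F i) (condOn C (fun σ => σ l) ν i) := fun {ν} hν =>
      Finset.sum_nonneg fun i _ => by
        by_cases h0 : evalLaw A ρ ν l i = 0
        · rw [h0, zero_mul]
        · exact mul_nonneg (margOn_nonneg hν.nonneg i) (entOn_nonneg (hν.cond h0))
    have he₁0 : 0 ≤ e₁ := add_nonneg (hsum0 h₁) (hsum0 h₂)
    rw [he]
    push_cast
    constructor
    · have hR : (∑ σ ∈ C, ν₁ σ * r σ) ^ 2 ≤ c * (1 / 2 * e₁) := by
        refine (hT.sq_sum_step_le h₁ hpk hpp
          fun i hi j hj ha hb => ((hP i j hi hj).2 ha hb).2.1).trans_eq ?_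
        simp only [he₁, mul_add, Finset.mul_sum]
        congr 1 <;> exact Finset.sum_congr rfl fun _ _ => by ring
      have hX : (∑ σ ∈ C, ν₁ σ * own σ) ^ 2 ≤ 1 / 2 * e₀ := by
        rw [hown]
        exact (sq_sum_mul_one_sub_stayMass_le ha hb hab).trans_eq (by rw [he₀]; ring)
      have hle : linCostOn C (imageDist K) ν₁ (stepKernel (fun σ => σ l) (swapTo l) p P) ≤
          ∑ σ ∈ C, ν₁ σ * own σ + ∑ σ ∈ C, ν₁ σ * r σ := by
        rw [← Finset.sum_add_distrib]
        refine Finset.sum_le_sum fun σ hσ => ?_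
        rw [← mul_add]
        exact mul_le_mul_of_nonneg_left (hpt σ hσ) (h₁.nonneg σ hσ)
      refine (pow_le_pow_left₀ (Finset.sum_nonneg fun σ hσ =>
        mul_nonneg (h₁.nonneg σ hσ) (hpt0 σ hσ)) hle 2).trans ?_
      rw [mul_add (1 / 2 : ℝ)]
      exact add_sq_le_of_sq_le (Nat.cast_nonneg c) (by positivity) (by positivity) hX hR
    · have hR : ∑ σ ∈ C, ν₁ σ * r σ ^ 2 ≤ c * (2 * e₁) := by
        have h1 : ∑ σ ∈ C, ν₁ σ * r σ ^ 2 ≤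
            ∑ σ ∈ C, ν₁ σ * ∑ j ∈ V, p (σ l) j * G (σ l) j σ ^ 2 :=
          Finset.sum_le_sum fun σ hσ => mul_le_mul_of_nonneg_left
            (sq_sum_mul_le (hpk.nonneg _ (hT.map_mem σ hσ)) (hpk.sum_eq _ (hT.map_mem σ hσ)).le)
            (h₁.nonneg σ hσ)
        refine (h1.trans (hT.sum_step_le h₁ hpk hpp (G := fun i j σ => G i j σ ^ 2)
          (e₁ := fun i => c * (2 * entOn (F i) (c₁ i)))
          (e₂ := fun j => c * (2 * entOn (F j) (c₂ j)))
          fun i hi j hj ha hb => ?_)).trans_eq ?_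
        · simpa only [weakCostOn, Finset.univ_unique, Finset.sum_singleton] using
            ((hP i j hi hj).2 ha hb).2.2
        · simp only [he₁, mul_add, Finset.mul_sum]
          congr 1 <;> exact Finset.sum_congr rfl fun _ _ => by ring
      have hX : ∑ σ ∈ C, ν₁ σ * own σ ^ 2 ≤ 2 * e₀ := by
        rw [hown2]
        exact sum_mul_one_sub_stayMass_sq_le ha hb hab
      have hX0 : 0 ≤ ∑ σ ∈ C, ν₁ σ * own σ ^ 2 :=
        Finset.sum_nonneg fun σ hσ => mul_nonneg (h₁.nonneg σ hσ) (sq_nonneg _)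
      have hR0 : 0 ≤ ∑ σ ∈ C, ν₁ σ * r σ ^ 2 :=
        Finset.sum_nonneg fun σ hσ => mul_nonneg (h₁.nonneg σ hσ) (sq_nonneg _)
      calc _ ≤ ∑ σ ∈ C, ν₁ σ * (own σ + r σ) ^ 2 := by
            refine Finset.sum_le_sum fun σ hσ => mul_le_mul_of_nonneg_left ?_ (h₁.nonneg σ hσ)
            rw [Finset.univ_unique, Finset.sum_singleton]
            exact pow_le_pow_left₀ (hpt0 σ hσ) (hpt σ hσ) 2
        _ ≤ _ := sum_mul_add_sq_le h₁.nonneg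
        _ ≤ _ := by
            rw [mul_add (2 : ℝ)]
            refine add_sq_le_of_sq_le (Nat.cast_nonneg c) (by positivity) (by positivity) ?_ ?_
            · rwa [Real.sq_sqrt hX0]
            · rwa [Real.sq_sqrt hR0]

end Image

/-! ### Passing through the uniform law. -/

section Gluing

variable {X : Type*} {s : Finset X} {ν₁ ν₂ : X → ℝ}

theorem sqrt_mul_add_sqrt_mul_sq {t : ℝ} (ht : 0 ≤ t) (a b : ℝ) :
    (√(t * a) + √(t * b)) ^ 2 = t * (√a + √b) ^ 2 := by
  rw [Real.sqrt_mul ht, Real.sqrt_mul ht, ← mul_add, mul_pow, Real.sq_sqrt ht]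

/-- The composed kernel goes from `ν₁` to uniform and from uniform to `ν₂`; each half pays for one
entropy only, since that of the uniform law is zero. The set `I₁` of linear costs lets one kernel
control linear and weak costs together, and may be empty. -/
theorem exists_kernel_through_unif {I₁ : Finset (X → X → ℝ)} {ι : Type*} {I : Finset ι}
    {D : ι → X → X → ℝ} {c t : ℝ} (hc : 0 ≤ c) (ht : 0 ≤ t)
    (hd0 : ∀ d ∈ I₁, ∀ x ∈ s, ∀ y ∈ s, 0 ≤ d x y)
    (hd : ∀ d ∈ I₁, ∀ x ∈ s, ∀ y ∈ s, ∀ z ∈ s, d x z ≤ d x y + d y z)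
    (hD0 : ∀ i ∈ I, ∀ x ∈ s, ∀ y ∈ s, 0 ≤ D i x y)
    (hD : ∀ i ∈ I, ∀ x ∈ s, ∀ y ∈ s, ∀ z ∈ s, D i x z ≤ D i x y + D i y z)
    (key : ∀ ν₁ ν₂ : X → ℝ, IsProbOn s ν₁ → IsProbOn s ν₂ →
      ((∀ x ∈ s, ν₁ x = unifOn s x) ∨ ∀ x ∈ s, ν₂ x = unifOn s x) →
      ∃ P, IsKernelOn s P ∧ Pushes s P ν₁ ν₂ ∧
        (∀ d ∈ I₁, linCostOn s d ν₁ P ^ 2 ≤ c * (entOn s ν₁ + entOn s ν₂)) ∧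
        weakCostOn s I D ν₁ P ≤ t * (entOn s ν₁ + entOn s ν₂))
    (h₁ : IsProbOn s ν₁) (h₂ : IsProbOn s ν₂) :
    ∃ P, IsKernelOn s P ∧ Pushes s P ν₁ ν₂ ∧
      (∀ d ∈ I₁, linCostOn s d ν₁ P ^ 2 ≤ c * (√(entOn s ν₁) + √(entOn s ν₂)) ^ 2) ∧
      weakCostOn s I D ν₁ P ≤ t * (√(entOn s ν₁) + √(entOn s ν₂)) ^ 2 := by
  have hU := isProbOn_unifOn h₁.nonempty
  obtain ⟨P, hP, hPp, hPl, hPc⟩ := key _ _ h₁ hU (Or.inr fun _ _ => rfl)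
  obtain ⟨Q, hQ, hQp, hQl, hQc⟩ := key _ _ hU h₂ (Or.inl fun _ _ => rfl)
  simp only [entOn_unifOn, add_zero, zero_add] at hPc hPl hQc hQl
  refine ⟨_, hP.comp hQ, hPp.comp hQp, fun d hdI => ?_, ?_⟩
  · rw [← sqrt_mul_add_sqrt_mul_sq hc]
    refine pow_le_pow_left₀ (Finset.sum_nonneg fun x hx => mul_nonneg (h₁.nonneg x hx)
      (Finset.sum_nonneg fun y hy => mul_nonneg ((hP.comp hQ).nonneg x hx y hy)
        (hd0 d hdI x hx y hy))) ?_ 2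
    exact (linCostOn_comp_le h₁.nonneg hP hQ hPp (hd d hdI)).trans
      (add_le_add (Real.le_sqrt_of_sq_le (hPl d hdI)) (Real.le_sqrt_of_sq_le (hQl d hdI)))
  · rw [← sqrt_mul_add_sqrt_mul_sq ht]
    exact (weakCostOn_comp_le h₁.nonneg hP hQ hPp hD0 hD).trans (pow_le_pow_left₀ (by positivity)
      (add_le_add (Real.sqrt_le_sqrt hPc) (Real.sqrt_le_sqrt hQc)) 2)

variable {α : Type*} [Fintype α] [DecidableEq α] {ν₁ ν₂ : Equiv.Perm α → ℝ}

theorem coset_empty (ρ : Equiv.Perm α) : coset ∅ ρ = Finset.univ := by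
  ext σ
  simp [mem_coset]

theorem exists_kernel_differAt_univ (h₁ : IsProbOn Finset.univ ν₁) (h₂ : IsProbOn Finset.univ ν₂) :
    ∃ P, IsKernelOn Finset.univ P ∧ Pushes Finset.univ P ν₁ ν₂ ∧
      weakCostOn Finset.univ Finset.univ differAt ν₁ P ≤
        8 * (√(entOn Finset.univ ν₁) + √(entOn Finset.univ ν₂)) ^ 2 := by
  rw [← coset_empty 1] at h₁ h₂ ⊢
  rw [← Finset.compl_empty (α := α)]
  obtain ⟨P, hP, hPp, -, hPc⟩ := exists_kernel_through_unif (I₁ := ∅) (I := (∅ : Finset α)ᶜ)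
    (D := differAt) le_rfl (by norm_num : (0 : ℝ) ≤ 8) (by simp) (by simp)
    (fun _ _ _ _ _ _ => differAt_nonneg _ _ _) (fun _ _ _ _ _ _ _ _ => differAt_triangle _ _ _ _)
    (fun ν₁ ν₂ h₁ h₂ hu => by
      obtain ⟨P, hP, hPp, hPc⟩ := exists_kernel_differAt _ ∅ 1 ν₁ ν₂ rfl h₁ h₂ hu
      exact ⟨P, hP, hPp, by simp, hPc⟩) h₁ h₂
  exact ⟨P, hP, hPp, hPc⟩

theorem exists_kernel_imageDist_univ (K : Finset α) (h₁ : IsProbOn Finset.univ ν₁)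
    (h₂ : IsProbOn Finset.univ ν₂) :
    ∃ P, IsKernelOn Finset.univ P ∧ Pushes Finset.univ P ν₁ ν₂ ∧
      2 * linCostOn Finset.univ (imageDist K) ν₁ P ^ 2 ≤
        K.card * (√(entOn Finset.univ ν₁) + √(entOn Finset.univ ν₂)) ^ 2 ∧
      1 / 2 * weakCostOn Finset.univ (Finset.univ : Finset Unit) (fun _ => imageDist K) ν₁ P ≤
        K.card * (√(entOn Finset.univ ν₁) + √(entOn Finset.univ ν₂)) ^ 2 := by
  rw [← coset_empty 1] at h₁ h₂ ⊢
  have hK : (0 : ℝ) ≤ K.card := Nat.cast_nonneg _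
  obtain ⟨P, hP, hPp, hPl, hPc⟩ := exists_kernel_through_unif (I₁ := {imageDist K})
    (I := (Finset.univ : Finset Unit)) (D := fun _ => imageDist K) (c := K.card * (1 / 2))
    (t := K.card * 2) (by positivity) (by positivity)
    (by simpa using fun _ _ _ _ => imageDist_nonneg _ _ _)
    (by simpa using fun _ _ _ _ _ _ => imageDist_triangle _ _ _ _)
    (fun _ _ _ _ _ _ => imageDist_nonneg _ _ _) (fun _ _ _ _ _ _ _ _ => imageDist_triangle _ _ _ _)
    (fun ν₁ ν₂ h₁ h₂ hu => by
      obtain ⟨P, hP, hPp, hPl, hPc⟩ := exists_kernel_imageDist K _ ∅ 1 ν₁ ν₂ rfl h₁ h₂ hu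
      rw [Finset.sdiff_empty, ← mul_assoc] at hPl hPc
      exact ⟨P, hP, hPp, by simpa using hPl, hPc⟩) h₁ h₂
  have hPl := hPl _ (Finset.mem_singleton_self _)
  exact ⟨P, hP, hPp, by linarith, by linarith⟩

end Gluing

/-! ### Projection along maps with fibres of constant size. -/

section Quotient

variable {X Y ι : Type*} [DecidableEq X] {s : Finset Y} {V : Finset X} {q : Y → X} {r : ℕ}
  {ν ν₁ ν₂ : X → ℝ} {P : Y → Y → ℝ}

/-- `q` maps `s` to `V` and all its fibres have `r > 0` points. -/
structure IsUniformMap (s : Finset Y) (V : Finset X) (q : Y → X) (r : ℕ) : Prop where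
  map_mem : ∀ y ∈ s, q y ∈ V
  card_fiber : ∀ x ∈ V, (fiberOn s q x).card = r
  pos : 0 < r

/-- The image under `q` of a kernel on `s`. -/
def quotKernel (s : Finset Y) (q : Y → X) (r : ℕ) (P : Y → Y → ℝ) (x x' : X) : ℝ :=
  (r : ℝ)⁻¹ * ∑ y ∈ fiberOn s q x, ∑ y' ∈ fiberOn s q x', P y y'

theorem IsUniformMap.inv_mul_sum_fiber (h : IsUniformMap s V q r) (g : X → ℝ) {x : X}
    (hx : x ∈ V) : (r : ℝ)⁻¹ * ∑ y ∈ fiberOn s q x, g (q y) = g x := by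
  have hr : (r : ℝ) ≠ 0 := by exact_mod_cast h.pos.ne'
  rw [Finset.sum_congr rfl fun y hy => by rw [(mem_fiberOn.1 hy).2], Finset.sum_const,
    h.card_fiber x hx, nsmul_eq_mul, inv_mul_cancel_left₀ hr]

theorem IsUniformMap.sum_comp_div (h : IsUniformMap s V q r) (g : X → ℝ) :
    ∑ y ∈ s, g (q y) / r = ∑ x ∈ V, g x := by
  rw [← sum_fiberOn h.map_mem]
  refine Finset.sum_congr rfl fun x hx => ?_
  rw [← Finset.sum_div, div_eq_inv_mul, h.inv_mul_sum_fiber g hx]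

theorem IsUniformMap.isProbOn_lift (h : IsUniformMap s V q r) (hν : IsProbOn V ν) :
    IsProbOn s fun y => ν (q y) / r where
  nonneg y hy := div_nonneg (hν.nonneg _ (h.map_mem y hy)) (Nat.cast_nonneg r)
  sum_eq := (h.sum_comp_div ν).trans hν.sum_eq

theorem IsUniformMap.entOn_lift (h : IsUniformMap s V q r) :
    entOn s (fun y => ν (q y) / r) = entOn V ν := by
  have hr : (r : ℝ) ≠ 0 := by exact_mod_cast h.pos.ne'
  have hc : (s.card : ℝ) = V.card * r := by
    have := h.sum_comp_div fun _ => (r : ℝ)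
    simpa [hr] using this
  rw [entOn, entOn, ← h.sum_comp_div]
  refine Finset.sum_congr rfl fun y _ => ?_
  rw [hc, mul_assoc, mul_div_cancel₀ _ hr, div_mul_eq_mul_div]

theorem IsUniformMap.sum_quotKernel_mul (h : IsUniformMap s V q r) (g : X → X → ℝ) (x : X) :
    ∑ x' ∈ V, quotKernel s q r P x x' * g x x' =
      (r : ℝ)⁻¹ * ∑ y ∈ fiberOn s q x, ∑ y' ∈ s, P y y' * g (q y) (q y') := by
  simp only [quotKernel, mul_assoc, ← Finset.mul_sum]
  congr 1
  simp only [Finset.sum_mul]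
  rw [Finset.sum_comm]
  refine Finset.sum_congr rfl fun y hy => ?_
  rw [← sum_fiberOn h.map_mem]
  refine Finset.sum_congr rfl fun x' _ => Finset.sum_congr rfl fun y' hy' => ?_
  rw [(mem_fiberOn.1 hy).2, (mem_fiberOn.1 hy').2]

theorem IsUniformMap.isKernelOn_quot (h : IsUniformMap s V q r) (hP : IsKernelOn s P) :
    IsKernelOn V (quotKernel s q r P) where
  nonneg x _ x' _ := mul_nonneg (by positivity) (Finset.sum_nonneg fun y hy =>
    Finset.sum_nonneg fun y' hy' => hP.nonneg y (mem_fiberOn.1 hy).1 y' (mem_fiberOn.1 hy').1)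
  sum_eq x hx := by
    have := h.sum_quotKernel_mul (P := P) (fun _ _ => 1) x
    simp only [mul_one] at this
    rw [this, Finset.sum_congr rfl fun y hy => hP.sum_eq y (mem_fiberOn.1 hy).1]
    exact h.inv_mul_sum_fiber (fun _ => 1) hx

theorem IsUniformMap.pushes_quot (h : IsUniformMap s V q r)
    (hP : Pushes s P (fun y => ν₁ (q y) / r) (fun y => ν₂ (q y) / r)) :
    Pushes V (quotKernel s q r P) ν₁ ν₂ := fun x' hx' => by
  have hr : (r : ℝ) ≠ 0 := by exact_mod_cast h.pos.ne'
  rw [← h.inv_mul_sum_fiber ν₂ hx', Finset.mul_sum]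
  have h1 : ∀ y' ∈ fiberOn s q x', (r : ℝ)⁻¹ * ν₂ (q y') = ∑ y ∈ s, ν₁ (q y) / r * P y y' :=
    fun y' hy' => by rw [hP y' (mem_fiberOn.1 hy').1]; exact (div_eq_inv_mul _ _).symm
  rw [Finset.sum_congr rfl h1, Finset.sum_comm, ← sum_fiberOn h.map_mem]
  refine Finset.sum_congr rfl fun x _ => ?_
  rw [quotKernel, Finset.mul_sum, Finset.mul_sum]
  refine Finset.sum_congr rfl fun y hy => ?_
  rw [(mem_fiberOn.1 hy).2, ← Finset.mul_sum]
  ring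

theorem IsUniformMap.linCostOn_quot_le (h : IsUniformMap s V q r) (hP : IsKernelOn s P)
    (hν : ∀ x ∈ V, 0 ≤ ν x) {d : X → X → ℝ} {d' : Y → Y → ℝ}
    (hd : ∀ y ∈ s, ∀ y' ∈ s, d (q y) (q y') ≤ d' y y') :
    linCostOn V d ν (quotKernel s q r P) ≤ linCostOn s d' (fun y => ν (q y) / r) P := by
  unfold linCostOn
  rw [← sum_fiberOn h.map_mem]
  refine Finset.sum_le_sum fun x hx => ?_
  rw [h.sum_quotKernel_mul, Finset.mul_sum, Finset.mul_sum]
  refine Finset.sum_le_sum fun y hy => ?_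
  obtain ⟨hys, rfl⟩ := mem_fiberOn.1 hy
  rw [← mul_assoc, ← div_eq_mul_inv]
  exact mul_le_mul_of_nonneg_left (Finset.sum_le_sum fun y' hy' =>
    mul_le_mul_of_nonneg_left (hd y hys y' hy') (hP.nonneg y hys y' hy'))
    (div_nonneg (hν _ hx) (Nat.cast_nonneg r))

/-- The mean displacement of the projected kernel at `x` is at most the average over the fibre of
those upstairs, and Jensen compares the squares. -/
theorem IsUniformMap.weakCostOn_quot_le (h : IsUniformMap s V q r) (hP : IsKernelOn s P)
    (hν : ∀ x ∈ V, 0 ≤ ν x) {I : Finset ι} {D : ι → X → X → ℝ} {D' : ι → Y → Y → ℝ}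
    (hD0 : ∀ i ∈ I, ∀ x x', 0 ≤ D i x x')
    (hD : ∀ i ∈ I, ∀ y ∈ s, ∀ y' ∈ s, D i (q y) (q y') ≤ D' i y y') :
    weakCostOn V I D ν (quotKernel s q r P) ≤ weakCostOn s I D' (fun y => ν (q y) / r) P := by
  have hr : (r : ℝ) ≠ 0 := by exact_mod_cast h.pos.ne'
  unfold weakCostOn
  rw [← sum_fiberOn h.map_mem]
  refine Finset.sum_le_sum fun x hx => ?_
  have h2 : ∑ y ∈ fiberOn s q x, ν (q y) / r * ∑ i ∈ I, (∑ y' ∈ s, P y y' * D' i y y') ^ 2 =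
      ν x * ∑ i ∈ I, ∑ y ∈ fiberOn s q x, (r : ℝ)⁻¹ * (∑ y' ∈ s, P y y' * D' i y y') ^ 2 := by
    rw [Finset.sum_comm, Finset.mul_sum]
    refine Finset.sum_congr rfl fun y hy => ?_
    rw [(mem_fiberOn.1 hy).2, ← Finset.mul_sum]
    ring
  rw [h2]
  refine mul_le_mul_of_nonneg_left (Finset.sum_le_sum fun i hi => ?_) (hν x hx)
  rw [h.sum_quotKernel_mul, Finset.mul_sum]
  refine (sq_sum_mul_le (fun y _ => by positivity) (le_of_eq ?_)).trans
    (Finset.sum_le_sum fun y hy => ?_)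
  · rw [Finset.sum_const, h.card_fiber x hx, nsmul_eq_mul, mul_inv_cancel₀ hr]
  · have hy := (mem_fiberOn.1 hy).1
    refine mul_le_mul_of_nonneg_left (pow_le_pow_left₀ (Finset.sum_nonneg fun y' hy' =>
      mul_nonneg (hP.nonneg y hy y' hy') (hD0 i hi _ _)) (Finset.sum_le_sum fun y' hy' =>
      mul_le_mul_of_nonneg_left (hD i hi y hy y' hy') (hP.nonneg y hy y' hy')) 2) (by positivity)

end Quotient

/-! ### Words as quotients of the symmetric group. -/

section Words

variable {n : ℕ} {E : Type*} [DecidableEq E]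

/-- `S` is an orbit of the action of the permutations on the words of length `n`. -/
def IsWordOrbit (S : Set (Fin n → E)) : Prop :=
  ∀ x ∈ S, ∀ y, y ∈ S ↔ ∃ σ : Equiv.Perm (Fin n), x ∘ σ = y

/-- Words with equal letter counts are related by gluing bijections between their level sets. -/
theorem exists_perm_comp_eq_iff {x y : Fin n → E} :
    (∃ σ : Equiv.Perm (Fin n), x ∘ σ = y) ↔
      ∀ l, (Finset.univ.filter fun i => y i = l).card =
        (Finset.univ.filter fun i => x i = l).card := by
  constructor
  · rintro ⟨σ, rfl⟩ l
    exact Finset.card_equiv σ fun i => by simp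
  · intro h
    have e : ∀ l, Nonempty ({i // y i = l} ≃ {i // x i = l}) := fun l =>
      Fintype.card_eq.1 (by rw [Fintype.card_subtype, Fintype.card_subtype, h l])
    exact ⟨Equiv.ofFiberEquiv fun l => (e l).some, funext fun i => Equiv.ofFiberEquiv_map _ i⟩

theorem isWordOrbit_multislice {m : ℕ} (k : Fin m → ℕ) : IsWordOrbit (multislice n k) := by
  intro x hx y
  rw [exists_perm_comp_eq_iff]
  exact forall_congr' fun l => by rw [hx l]

theorem mem_slice_iff {k : ℕ} {x : Fin n → Fin 2} :
    x ∈ slice n k ↔ (Finset.univ.filter fun i => x i = 1).card = k := by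
  have h : ∀ i, (x i : ℕ) = if x i = 1 then 1 else 0 := fun i => by
    generalize x i = a
    fin_cases a <;> rfl
  rw [slice, Set.mem_ofPred_eq, Finset.sum_congr rfl fun i _ => h i, ← Finset.card_filter]

theorem card_filter_zero (x : Fin n → Fin 2) : (Finset.univ.filter fun i => x i = 0).card =
    n - (Finset.univ.filter fun i => x i = 1).card := by
  have h := Finset.card_filter_add_card_filter_not (s := Finset.univ) fun i => x i = 1
  have h2 : (Finset.univ.filter fun i => ¬x i = 1) = Finset.univ.filter fun i => x i = 0 := by
    refine Finset.filter_congr fun i _ => ?_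
    generalize x i = a
    fin_cases a <;> decide
  rw [h2, Finset.card_univ, Fintype.card_fin] at h
  omega

theorem isWordOrbit_slice (k : ℕ) : IsWordOrbit (slice n k) := by
  intro x hx y
  rw [exists_perm_comp_eq_iff, mem_slice_iff, Fin.forall_fin_two, card_filter_zero,
    card_filter_zero x, mem_slice_iff.1 hx]
  exact ⟨fun h => ⟨by rw [h], h⟩, fun h => h.2⟩

variable {S : Set (Fin n → E)} [Fintype S]

/-- The word `x ∘ σ` as an element of the orbit of `x`. -/
def IsWordOrbit.act (h : IsWordOrbit S) (x : S) (σ : Equiv.Perm (Fin n)) : S :=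
  ⟨x.1 ∘ σ, (h x.1 x.2 _).2 ⟨σ, rfl⟩⟩

/-- The fibres are cosets of the stabiliser of `x`: right multiplication by `τ` carries the fibre
over `x` to that over `x ∘ τ`. -/
theorem IsWordOrbit.exists_isUniformMap (h : IsWordOrbit S) (x : S) :
    ∃ r, IsUniformMap Finset.univ Finset.univ (h.act x) r := by
  refine ⟨(fiberOn Finset.univ (h.act x) x).card, fun _ _ => Finset.mem_univ _, fun y _ => ?_,
    Finset.card_pos.2 ⟨1, mem_fiberOn.2 ⟨Finset.mem_univ _, rfl⟩⟩⟩
  obtain ⟨τ, hτ⟩ := (h x.1 x.2 y.1).1 y.2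
  refine (Finset.card_equiv (Equiv.mulRight τ) fun σ => ?_).symm
  simp only [mem_fiberOn, Finset.mem_univ, true_and, Subtype.ext_iff, IsWordOrbit.act, ← hτ,
    Equiv.coe_mulRight, Equiv.Perm.coe_mul, ← Function.comp_assoc]
  exact ⟨fun h => by rw [h], fun h => τ.surjective.injective_comp_right h⟩

theorem IsUniformMap.comp_equiv {X Y Z : Type*} [DecidableEq X] [Fintype Y] [Fintype Z]
    {V : Finset X} {q : Y → X} {r : ℕ} (h : IsUniformMap Finset.univ V q r) (e : Z ≃ Y) :
    IsUniformMap Finset.univ V (q ∘ e) r where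
  map_mem z _ := h.map_mem _ (Finset.mem_univ _)
  card_fiber x hx := by
    rw [← h.card_fiber x hx]
    exact Finset.card_equiv e fun z => by simp [mem_fiberOn]
  pos := h.pos

theorem IsWordOrbit.exists_kernel_hat (h : IsWordOrbit S) {ν₁ ν₂ : S → ℝ}
    (h₁ : IsProbOn Finset.univ ν₁) (h₂ : IsProbOn Finset.univ ν₂) :
    ∃ P, IsKernelOn Finset.univ P ∧ Pushes Finset.univ P ν₁ ν₂ ∧
      weakCostOn Finset.univ Finset.univ (fun i (x y : S) => if x.1 i = y.1 i then 0 else 1) ν₁ P ≤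
        8 * (√(entOn Finset.univ ν₁) + √(entOn Finset.univ ν₂)) ^ 2 := by
  obtain ⟨x, -⟩ := h₁.nonempty
  obtain ⟨r, hr⟩ := h.exists_isUniformMap x
  obtain ⟨P, hP, hPp, hPc⟩ :=
    exists_kernel_differAt_univ (hr.isProbOn_lift h₁) (hr.isProbOn_lift h₂)
  rw [hr.entOn_lift, hr.entOn_lift] at hPc
  refine ⟨_, hr.isKernelOn_quot hP, hr.pushes_quot hPp, (hr.weakCostOn_quot_le hP h₁.nonneg
    (fun i _ x y => by positivity) fun i _ σ _ τ _ => ?_).trans hPc⟩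
  simp only [IsWordOrbit.act, differAt, Function.comp_apply]
  by_cases h : σ i = τ i
  · simp [h]
  · by_cases h2 : x.1 (σ i) = x.1 (τ i) <;> simp [h, h2]

/-- With two letters, the positions of disagreement form the symmetric difference of the level sets
of `e`, whose two halves are equinumerous because the level sets are. -/
theorem sdiff_card_eq_half_hammingDist {k : ℕ} {x y : Fin n → Fin 2} (hx : x ∈ slice n k)
    (hy : y ∈ slice n k) (e : Fin 2) :
    ((Finset.univ.filter fun i => x i = e) \ Finset.univ.filter fun i => y i = e).card * 2 =
      hammingDist x y := by
  have hc : (Finset.univ.filter fun i => x i = e).card =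
      (Finset.univ.filter fun i => y i = e).card := by
    rw [mem_slice_iff] at hx hy
    fin_cases e
    · simpa [hx, hy] using (card_filter_zero x).trans (by rw [hx, ← hy, ← card_filter_zero y])
    · exact hx.trans hy.symm
  have h1 := Finset.card_sdiff_comm hc
  have h2 : (Finset.univ.filter fun i => x i ≠ y i) =
      ((Finset.univ.filter fun i => x i = e) \ Finset.univ.filter fun i => y i = e) ∪
        ((Finset.univ.filter fun i => y i = e) \ Finset.univ.filter fun i => x i = e) := by
    ext i
    simp only [Finset.mem_filter, Finset.mem_univ, true_and, Finset.mem_union, Finset.mem_sdiff]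
    generalize x i = a
    generalize y i = b
    clear hc h1 hx hy
    revert a b e
    decide
  rw [hammingDist, h2, Finset.card_union_of_disjoint, ← h1, mul_two]
  exact disjoint_sdiff_sdiff

theorem exists_kernel_slice {k : ℕ} [Fintype (slice n k)] (e : Fin 2) {ν₁ ν₂ : slice n k → ℝ}
    (h₁ : IsProbOn Finset.univ ν₁) (h₂ : IsProbOn Finset.univ ν₂) :
    ∃ P, IsKernelOn Finset.univ P ∧ Pushes Finset.univ P ν₁ ν₂ ∧
      2 * linCostOn Finset.univ (fun x y => (hammingDist x.1 y.1 : ℝ) / 2) ν₁ P ^ 2 ≤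
        ((if e = 1 then k else n - k : ℕ) : ℝ) *
          (√(entOn Finset.univ ν₁) + √(entOn Finset.univ ν₂)) ^ 2 ∧
      1 / 2 * weakCostOn Finset.univ (Finset.univ : Finset Unit)
          (fun _ x y => (hammingDist x.1 y.1 : ℝ) / 2) ν₁ P ≤
        ((if e = 1 then k else n - k : ℕ) : ℝ) *
          (√(entOn Finset.univ ν₁) + √(entOn Finset.univ ν₂)) ^ 2 := by
  obtain ⟨x, -⟩ := h₁.nonempty
  have h := isWordOrbit_slice (n := n) k
  obtain ⟨r, hr⟩ := h.exists_isUniformMap x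
  -- Inverting `σ` makes the level set of `e` in the word the image of `K` under `σ`, so that
  -- `imageDist K` is the halved Hamming distance.
  replace hr := hr.comp_equiv (Equiv.inv (Equiv.Perm (Fin n)))
  set q := h.act x ∘ Equiv.inv (Equiv.Perm (Fin n)) with hq
  set K := Finset.univ.filter fun i => x.1 i = e with hK
  have hKc : K.card = if e = 1 then k else n - k := by
    have hx := mem_slice_iff.1 x.2
    fin_cases e
    · exact (card_filter_zero x.1).trans (by rw [hx]; rfl)
    · exact hx
  have hmap : ∀ σ : Equiv.Perm (Fin n), K.map σ.toEmbedding =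
      Finset.univ.filter fun i => (q σ).1 i = e := fun σ => by
    ext i
    simp [hK, hq, IsWordOrbit.act, Equiv.Perm.inv_def]
  have hd : ∀ σ ∈ Finset.univ, ∀ τ ∈ Finset.univ,
      (hammingDist (q σ).1 (q τ).1 : ℝ) / 2 ≤ imageDist K σ τ := fun σ _ τ _ => by
    rw [imageDist, hmap, hmap, ← sdiff_card_eq_half_hammingDist (q σ).2 (q τ).2 e]
    push_cast
    linarith
  obtain ⟨P, hP, hPp, hPl, hPc⟩ :=
    exists_kernel_imageDist_univ K (hr.isProbOn_lift h₁) (hr.isProbOn_lift h₂)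
  rw [hr.entOn_lift, hr.entOn_lift, hKc] at hPc hPl
  have hQ := hr.isKernelOn_quot hP
  refine ⟨_, hQ, hr.pushes_quot hPp, le_trans ?_ hPl, le_trans ?_ hPc⟩
  · refine mul_le_mul_of_nonneg_left (pow_le_pow_left₀ ?_
      (hr.linCostOn_quot_le hP h₁.nonneg hd) 2) zero_le_two
    exact Finset.sum_nonneg fun y hy => mul_nonneg (h₁.nonneg y hy) (Finset.sum_nonneg fun z hz =>
      mul_nonneg (hQ.nonneg y hy z hz) (by positivity))
  · exact mul_le_mul_of_nonneg_left (hr.weakCostOn_quot_le hP h₁.nonneg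
      (fun _ _ _ _ => by positivity) fun _ _ => hd) (by norm_num)

end Words

/-! ### From weights and kernels to measures and couplings. -/

section FiniteMeasures

variable {X : Type*} [Fintype X] [MeasurableSpace X] [MeasurableSingletonClass X]
  {ν ν₁ ν₂ : Measure X} {P : X → X → ℝ}

theorem isProbOn_real (ν : Measure X) [IsProbabilityMeasure ν] :
    IsProbOn Finset.univ fun x => ν.real {x} where
  nonneg _ _ := measureReal_nonneg
  sum_eq := by
    rw [sum_measureReal_singleton, Finset.coe_univ, probReal_univ]

theorem uniformLaw_singleton (x : X) : uniformLaw X {x} = (Fintype.card X : ℝ≥0∞)⁻¹ := by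
  rw [uniformLaw, uniformOn_univ, Measure.count_singleton, one_div]

/-- Every point has positive uniform mass, so absolute continuity is automatic and the density at
`x` is the cardinality times the mass of `x`. -/
theorem klDiv_uniformLaw (ν : Measure X) [IsProbabilityMeasure ν] :
    klDiv ν (uniformLaw X) = ENNReal.ofReal (entOn Finset.univ fun x => ν.real {x}) := by
  have hpos : ∀ x : X, (Fintype.card X : ℝ≥0∞)⁻¹ ≠ 0 := fun x =>
    ENNReal.inv_ne_zero.2 (ENNReal.natCast_ne_top _)
  have hX : Nonempty X := ν.nonempty_of_neZero
  have : IsProbabilityMeasure (uniformLaw X) := isProbabilityMeasure_uniformOn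
    Set.finite_univ Set.univ_nonempty
  have hac : ν ≪ uniformLaw X := fun A hA => by
    have : A = ∅ := Set.eq_empty_of_forall_notMem fun x hx => hpos x <| by
      rw [← uniformLaw_singleton x]
      exact measure_mono_null (Set.singleton_subset_iff.2 hx) hA
    rw [this, measure_empty]
  have hrn : ∀ x, (ν.rnDeriv (uniformLaw X) x).toReal = Fintype.card X * ν.real {x} := fun x => by
    have h := Measure.setLIntegral_rnDeriv hac {x}
    rw [lintegral_singleton, uniformLaw_singleton] at h
    rw [measureReal_def, ← h, ENNReal.toReal_mul, ENNReal.toReal_inv, ENNReal.toReal_natCast,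
      mul_comm, inv_mul_cancel_right₀ (by exact_mod_cast Fintype.card_ne_zero)]
  rw [klDiv_eq_lintegral_klFun_of_ac hac, lintegral_fintype, entOn_eq_klFun (isProbOn_real ν),
    ENNReal.ofReal_mul (by positivity), ENNReal.ofReal_sum_of_nonneg fun x _ =>
      klFun_nonneg (mul_nonneg (Nat.cast_nonneg _) measureReal_nonneg), Finset.card_univ,
    ENNReal.ofReal_inv_of_pos (by exact_mod_cast Fintype.card_pos), ENNReal.ofReal_natCast,
    Finset.mul_sum]
  exact Finset.sum_congr rfl fun x _ => by rw [hrn, uniformLaw_singleton, mul_comm]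

theorem entropyBound_uniformLaw (ν₁ ν₂ : Measure X) [IsProbabilityMeasure ν₁]
    [IsProbabilityMeasure ν₂] : entropyBound (uniformLaw X) ν₁ ν₂ =
      ENNReal.ofReal ((√(entOn Finset.univ fun x => ν₁.real {x}) +
        √(entOn Finset.univ fun x => ν₂.real {x})) ^ 2) := by
  have h₁ := entOn_nonneg (isProbOn_real ν₁)
  have h₂ := entOn_nonneg (isProbOn_real ν₂)
  rw [entropyBound, klDiv_uniformLaw, klDiv_uniformLaw, ENNReal.ofReal_rpow_of_nonneg h₁ (by simp),
    ENNReal.ofReal_rpow_of_nonneg h₂ (by simp), ← Real.sqrt_eq_rpow, ← Real.sqrt_eq_rpow,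
    ← ENNReal.ofReal_add (by positivity) (by positivity), ← ENNReal.ofReal_pow (by positivity)]

/-- The measure with weights `w` on a finite type. -/
def weighted {Z : Type*} [Fintype Z] [MeasurableSpace Z] (w : Z → ℝ) : Measure Z :=
  ∑ z, ENNReal.ofReal (w z) • Measure.dirac z

theorem weighted_apply {Z : Type*} [Fintype Z] [MeasurableSpace Z] [MeasurableSingletonClass Z]
    (w : Z → ℝ) (A : Set Z) [DecidablePred (· ∈ A)] :
    weighted w A = ∑ z, if z ∈ A then ENNReal.ofReal (w z) else 0 := by
  rw [weighted, Measure.finsetSum_apply]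
  refine Finset.sum_congr rfl fun z _ => ?_
  rw [Measure.smul_apply, Measure.dirac_apply, smul_eq_mul, Set.indicator_apply]
  split_ifs <;> simp

theorem weighted_singleton {Z : Type*} [Fintype Z] [MeasurableSpace Z]
    [MeasurableSingletonClass Z] (w : Z → ℝ) (z : Z) :
    weighted w {z} = ENNReal.ofReal (w z) := by
  classical
  simp [weighted_apply]

theorem isProbabilityMeasure_weighted {w : X → ℝ} (h : IsProbOn Finset.univ w) :
    IsProbabilityMeasure (weighted w) where
  measure_univ := by
    classical
    simp only [weighted_apply, Set.mem_univ, if_true]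
    rw [← ENNReal.ofReal_sum_of_nonneg fun z hz => h.nonneg z hz, h.sum_eq, ENNReal.ofReal_one]

theorem exists_coupling [IsProbabilityMeasure ν₁] [IsProbabilityMeasure ν₂]
    (hP : IsKernelOn Finset.univ P)
    (hp : Pushes Finset.univ P (fun x => ν₁.real {x}) (fun x => ν₂.real {x})) :
    ∃ π ∈ couplings ν₁ ν₂, IsDisintegration π ν₁ (fun x => weighted (P x)) ∧
      ∀ x y, π {(x, y)} = ENNReal.ofReal (ν₁.real {x} * P x y) := by
  classical
  set w : X × X → ℝ := fun z => ν₁.real {z.1} * P z.1 z.2 with hw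
  have hw0 : ∀ z, 0 ≤ w z := fun z => mul_nonneg measureReal_nonneg
    (hP.nonneg _ (Finset.mem_univ _) _ (Finset.mem_univ _))
  have hfst : (weighted w).map Prod.fst = ν₁ := by
    refine Measure.ext_of_singleton fun x => ?_
    rw [Measure.map_apply measurable_fst (measurableSet_singleton x), weighted_apply,
      Fintype.sum_prod_type]
    simp only [Set.mem_preimage, Set.mem_singleton_iff]
    rw [Finset.sum_eq_single x (fun x' _ hx => by simp [hx]) (by simp)]
    simp only [if_true]
    rw [← ENNReal.ofReal_sum_of_nonneg fun y _ => hw0 _]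
    simp only [hw]
    rw [← Finset.mul_sum,
      hP.sum_eq x (Finset.mem_univ x), mul_one, ofReal_measureReal]
  have hsnd : (weighted w).map Prod.snd = ν₂ := by
    refine Measure.ext_of_singleton fun y => ?_
    rw [Measure.map_apply measurable_snd (measurableSet_singleton y), weighted_apply,
      Fintype.sum_prod_type]
    simp only [Set.mem_preimage, Set.mem_singleton_iff, Finset.sum_ite_eq', Finset.mem_univ,
      if_true]
    rw [← ENNReal.ofReal_sum_of_nonneg fun y _ => hw0 _, hp y (Finset.mem_univ y),
      ofReal_measureReal]
  refine ⟨weighted w, ⟨⟨?_⟩, hfst, hsnd⟩, ⟨fun x => isProbabilityMeasure_weighted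
    ⟨hP.nonneg x (Finset.mem_univ x), hP.sum_eq x (Finset.mem_univ x)⟩, fun x y => ?_⟩,
    fun x y => weighted_singleton w _⟩
  · rw [← Set.preimage_univ (f := Prod.fst), ← Measure.map_apply measurable_fst .univ, hfst,
      measure_univ]
  · rw [weighted_singleton, weighted_singleton, hw, ENNReal.ofReal_mul measureReal_nonneg,
      ofReal_measureReal]

theorem lintegral_weighted {Z : Type*} [Fintype Z] [MeasurableSpace Z]
    [MeasurableSingletonClass Z] {w f : Z → ℝ} (hw : ∀ z, 0 ≤ w z) (hf : ∀ z, 0 ≤ f z) :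
    ∫⁻ z, ENNReal.ofReal (f z) ∂(weighted w) = ENNReal.ofReal (∑ z, w z * f z) := by
  rw [lintegral_fintype, ENNReal.ofReal_sum_of_nonneg fun z _ => mul_nonneg (hw z) (hf z)]
  refine Finset.sum_congr rfl fun z _ => ?_
  rw [weighted_singleton, ENNReal.ofReal_mul (hw z), mul_comm]

theorem lintegral_ofReal_eq [IsProbabilityMeasure ν] {f : X → ℝ} (hf : ∀ x, 0 ≤ f x) :
    ∫⁻ x, ENNReal.ofReal (f x) ∂ν = ENNReal.ofReal (∑ x, ν.real {x} * f x) := by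
  rw [lintegral_fintype, ENNReal.ofReal_sum_of_nonneg fun z _ =>
    mul_nonneg measureReal_nonneg (hf z)]
  refine Finset.sum_congr rfl fun z _ => ?_
  rw [ENNReal.ofReal_mul measureReal_nonneg, ofReal_measureReal, mul_comm]

variable [IsProbabilityMeasure ν₁] [IsProbabilityMeasure ν₂]

theorem wasserstein_le {d : X → X → ℝ≥0∞} {D : X → X → ℝ}
    (hd : ∀ x y, d x y = ENNReal.ofReal (D x y)) (hD : ∀ x y, 0 ≤ D x y) (hP : IsKernelOn Finset.univ P)
    (hp : Pushes Finset.univ P (fun x => ν₁.real {x}) (fun x => ν₂.real {x})) :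
    wasserstein d ν₁ ν₂ ≤
      ENNReal.ofReal (linCostOn Finset.univ D (fun x => ν₁.real {x}) P) := by
  obtain ⟨π, hπ, -, hw⟩ := exists_coupling hP hp
  refine (iInf₂_le π hπ).trans_eq ?_
  have hP0 : ∀ x y, 0 ≤ P x y := fun x y => hP.nonneg x (Finset.mem_univ x) y (Finset.mem_univ y)
  rw [lintegral_fintype, Fintype.sum_prod_type, linCostOn, ENNReal.ofReal_sum_of_nonneg fun x _ =>
    mul_nonneg measureReal_nonneg (Finset.sum_nonneg fun y _ => mul_nonneg (hP0 x y) (hD x y))]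
  refine Finset.sum_congr rfl fun x _ => ?_
  rw [Finset.mul_sum, ENNReal.ofReal_sum_of_nonneg fun y _ =>
    mul_nonneg measureReal_nonneg (mul_nonneg (hP0 x y) (hD x y))]
  refine Finset.sum_congr rfl fun y _ => ?_
  rw [hw, hd, ← ENNReal.ofReal_mul (hD x y)]
  congr 1
  ring

theorem lintegral_sum_sq_eq {ι : Type*} [Fintype ι] {D : ι → X → X → ℝ}
    (hD : ∀ i x y, 0 ≤ D i x y) (hP : IsKernelOn Finset.univ P) :
    ∫⁻ x, ∑ i, (∫⁻ y, ENNReal.ofReal (D i x y) ∂(weighted (P x))) ^ 2 ∂ν₁ =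
      ENNReal.ofReal (weakCostOn Finset.univ Finset.univ D (fun x => ν₁.real {x}) P) := by
  have hP0 : ∀ x y, 0 ≤ P x y := fun x y => hP.nonneg x (Finset.mem_univ x) y (Finset.mem_univ y)
  rw [weakCostOn, ← lintegral_ofReal_eq fun x => Finset.sum_nonneg fun i _ => sq_nonneg _]
  congr 1
  funext x
  rw [ENNReal.ofReal_sum_of_nonneg fun i _ => sq_nonneg _]
  refine Finset.sum_congr rfl fun i _ => ?_
  rw [lintegral_weighted (hP0 x) (hD i x), ENNReal.ofReal_pow
    (Finset.sum_nonneg fun y _ => mul_nonneg (hP0 x y) (hD i x y))]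

theorem weakCostTilde_le {d : X → X → ℝ≥0∞} {D : X → X → ℝ}
    (hd : ∀ x y, d x y = ENNReal.ofReal (D x y)) (hD : ∀ x y, 0 ≤ D x y)
    (hP : IsKernelOn Finset.univ P)
    (hp : Pushes Finset.univ P (fun x => ν₁.real {x}) (fun x => ν₂.real {x})) :
    weakCostTilde d ν₂ ν₁ ≤ ENNReal.ofReal (weakCostOn Finset.univ (Finset.univ : Finset Unit)
      (fun _ => D) (fun x => ν₁.real {x}) P) := by
  obtain ⟨π, hπ, hdis, -⟩ := exists_coupling hP hp
  refine (iInf₂_le π hπ).trans ((iInf₂_le _ hdis).trans_eq ?_)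
  rw [← lintegral_sum_sq_eq (fun _ => hD) hP]
  simp [hd]

end FiniteMeasures

/-! ### The transport inequalities for measures on words. -/

theorem weakCostHat_le {n : ℕ} {E : Type*} [DecidableEq E] [MeasurableSpace E]
    {S : Set (Fin n → E)} [Fintype S] [MeasurableSingletonClass S] {ν₁ ν₂ : Measure S}
    [IsProbabilityMeasure ν₁] [IsProbabilityMeasure ν₂] {P : S → S → ℝ}
    (hP : IsKernelOn Finset.univ P)
    (hp : Pushes Finset.univ P (fun x => ν₁.real {x}) (fun x => ν₂.real {x})) :
    weakCostHat ν₂ ν₁ ≤ ENNReal.ofReal (weakCostOn Finset.univ Finset.univ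
      (fun i (x y : S) => if x.1 i = y.1 i then 0 else 1) (fun x => ν₁.real {x}) P) := by
  obtain ⟨π, hπ, hdis, -⟩ := exists_coupling hP hp
  refine (iInf₂_le π hπ).trans ((iInf₂_le _ hdis).trans_eq ?_)
  rw [← lintegral_sum_sq_eq (fun i x y => by positivity) hP]
  congr! with x i - y
  split_ifs <;> simp_all

theorem IsWordOrbit.weakCostHat_le_entropyBound {n : ℕ} {E : Type*} [DecidableEq E] [Finite E]
    [MeasurableSpace E] [MeasurableSingletonClass E] {S : Set (Fin n → E)} (h : IsWordOrbit S)
    (ν₁ ν₂ : Measure S) [IsProbabilityMeasure ν₁] [IsProbabilityMeasure ν₂] :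
    (1 / 8) * weakCostHat ν₂ ν₁ ≤ entropyBound (uniformLaw S) ν₁ ν₂ := by
  have := Fintype.ofFinite S
  obtain ⟨P, hP, hp, hc⟩ := h.exists_kernel_hat (isProbOn_real ν₁) (isProbOn_real ν₂)
  rw [entropyBound_uniformLaw, one_div, mul_comm, ← div_eq_mul_inv]
  refine ENNReal.div_le_of_le_mul' ((weakCostHat_le hP hp).trans ?_)
  rw [show (8 : ℝ≥0∞) = ENNReal.ofReal 8 by simp, ← ENNReal.ofReal_mul (by norm_num)]
  exact ENNReal.ofReal_le_ofReal hc

theorem slice_cost_le {n k : ℕ} (e : Fin 2) (ν₁ ν₂ : Measure (slice n k)) [IsProbabilityMeasure ν₁]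
    [IsProbabilityMeasure ν₂] :
    2 * wasserstein halvedHamming ν₁ ν₂ ^ 2 ≤
        ((if e = 1 then k else n - k : ℕ) : ℝ≥0∞) *
          entropyBound (uniformLaw (slice n k)) ν₁ ν₂ ∧
      (1 / 2) * weakCostTilde halvedHamming ν₂ ν₁ ≤
        ((if e = 1 then k else n - k : ℕ) : ℝ≥0∞) *
          entropyBound (uniformLaw (slice n k)) ν₁ ν₂ := by
  have := Fintype.ofFinite (slice n k)
  obtain ⟨P, hP, hp, hl, hc⟩ := exists_kernel_slice e (isProbOn_real ν₁) (isProbOn_real ν₂)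
  have hd : ∀ x y : slice n k, halvedHamming x y =
      ENNReal.ofReal ((hammingDist x.1 y.1 : ℝ) / 2) := fun x y => by
    rw [halvedHamming, ENNReal.ofReal_div_of_pos (by norm_num), ENNReal.ofReal_natCast]
    simp
  rw [entropyBound_uniformLaw, ← ENNReal.ofReal_natCast, ← ENNReal.ofReal_mul (Nat.cast_nonneg _)]
  have hD : ∀ x y : slice n k, 0 ≤ (hammingDist x.1 y.1 : ℝ) / 2 := fun x y => by positivity
  constructor
  · refine le_trans ?_ (ENNReal.ofReal_le_ofReal hl)
    rw [ENNReal.ofReal_mul (by norm_num), ENNReal.ofReal_pow, ENNReal.ofReal_ofNat]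
    · gcongr
      exact wasserstein_le hd hD hP hp
    · exact Finset.sum_nonneg fun x _ => mul_nonneg measureReal_nonneg (Finset.sum_nonneg
        fun y _ => mul_nonneg (hP.nonneg x (Finset.mem_univ x) y (Finset.mem_univ y)) (hD x y))
  · refine le_trans ?_ (ENNReal.ofReal_le_ofReal hc)
    rw [ENNReal.ofReal_mul (by norm_num), ENNReal.ofReal_div_of_pos (by norm_num),
      ENNReal.ofReal_one, ENNReal.ofReal_ofNat]
    gcongr
    exact weakCostTilde_le hd hD hP hp

end

theorem theorem1p5 :
    (∀ n k : ℕ, 1 ≤ n → k ≤ n →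
      ∀ (ν₁ ν₂ : Measure (slice n k)) [IsProbabilityMeasure ν₁] [IsProbabilityMeasure ν₂],
        2 * wasserstein halvedHamming ν₁ ν₂ ^ 2 ≤
            ((min k (n - k) : ℕ) : ℝ≥0∞) * entropyBound (uniformLaw (slice n k)) ν₁ ν₂ ∧
          (1 / 2) * weakCostTilde halvedHamming ν₂ ν₁ ≤
            ((min k (n - k) : ℕ) : ℝ≥0∞) * entropyBound (uniformLaw (slice n k)) ν₁ ν₂ ∧
          (1 / 8) * weakCostHat ν₂ ν₁ ≤ entropyBound (uniformLaw (slice n k)) ν₁ ν₂) ∧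
    (∀ (m n : ℕ) (k : Fin m → ℕ), 1 ≤ n → (∀ l, 1 ≤ k l) → ∑ l, k l = n →
      ∀ (ν₁ ν₂ : Measure (multislice n k)) [IsProbabilityMeasure ν₁] [IsProbabilityMeasure ν₂],
        (1 / 8) * weakCostHat ν₂ ν₁ ≤ entropyBound (uniformLaw (multislice n k)) ν₁ ν₂) := by
  refine ⟨fun n k _ _ ν₁ ν₂ _ _ => ?_, fun m n k _ _ _ ν₁ ν₂ _ _ =>
    (isWordOrbit_multislice k).weakCostHat_le_entropyBound ν₁ ν₂⟩
  have h := (isWordOrbit_slice k).weakCostHat_le_entropyBound ν₁ ν₂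
  -- The minimum is reached by tracking the rarer letter: 1 when `k` is smaller, 0 otherwise.
  rcases le_total k (n - k) with hk | hk
  · rw [min_eq_left hk]
    exact ⟨(slice_cost_le 1 ν₁ ν₂).1, (slice_cost_le 1 ν₁ ν₂).2, h⟩
  · rw [min_eq_right hk]
    exact ⟨(slice_cost_le 0 ν₁ ν₂).1, (slice_cost_le 0 ν₁ ν₂).2, h⟩
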